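/- **Linearizability of a simplified contention-friendly search tree.** Let $K$ be a linearly ordered set of keys, let $\infty$ be an extra key above all of $K$, and let $T$ be any set of threads. The shared memory consists of nodes with an immutable field $key\in K\cup\{\infty\}$, pointers $left,right$ (possibly null), Boolean flags $del$ (logically deleted) and $rem$ (physically removed), and a lock. Initially there is only the node $root$, with key $\infty$, null children, and both flags false. $\mathrm{new}\ N(k)$ allocates a node with key $k$, null children, both flags false and a free lock, at a location never used before. The methods are the following; each releases all its locks, one by one, before it returns or restarts. * $locate(k)$: $x,y\leftarrow root$; while $y\ne null$ and $y.key\neq k$: $x\leftarrow y$, and then $y\leftarrow x.right$ if $x.key<k$, and $y\leftarrow x.left$ otherwise. Return $(x,y)$. (No locks are taken and $rem$ is not read.) * $contains(k)$: $(\_,y)\leftarrow locate(k)$; if $y=null$ return false; if $y.del$ return false; return true. * $delete(k)$: $(\_,y)\leftarrow locate(k)$; if $y=null$ return false; lock $y$; if $y.rem$ restart; $ret\leftarrow\neg y.del$; $y.del\leftarrow$ true; return $ret$. * $insert(k)$: $(x,y)\leftarrow locate(k)$. If $y\neq null$: lock $y$; if $y.rem$ restart; $ret\leftarrow y.del$;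 $y.del\leftarrow$ false; return $ret$. If $y=null$: lock $x$; if $x.rem$ restart; if $k<x.key$ and $x.left=null$ then $x.left\leftarrow \mathrm{new}\ N(k)$; else if $k>x.key$ and $x.right=null$ then $x.right\leftarrow\mathrm{new}\ N(k)$; else restart. Return true. * $removeRight$: $(z,\_)\leftarrow locate(*)$ for an arbitrary key $*\in K$; lock $z$; $y\leftarrow z.right$; if $y=null$ or $z.rem$ return; lock $y$; if $\neg y.del$ return; if $y.left=null$ then $z.right\leftarrow y.right$; else if $y.right=null$ then $z.right\leftarrow y.left$; else return; finally $y.rem\leftarrow$ true. * $rotateRightLeft$: $(p,\_)\leftarrow locate(*)$ for an arbitrary key $*\in K$; lock $p$; $y\leftarrow p.left$; if $y=null$ or $p.rem$ return; lock $y$; $x\leftarrow y.left$; if $x=null$ return; lock $x$; let $z$ be a newly allocated copy of all the fields of $y$ (with its own, free lock); $z.left\leftarrow x.right$; $x.right\leftarrow z$; $p.left\leftarrow x$; $y.rem\leftarrow$ true. * The mirror image $removeLeft$ of $removeRight$, and the three other rotations, obtained from $rotateRightLeft$ by choosing on which side of $p$ the node $y$ lies and, independently, on which side of $y$ the node $x$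 lies (in the latter case exchanging left and right in the updates of $z$ and $x$). A concurrent execution starts in the initial memory with all threads idle. It is a finite interleaving of atomic actions of the threads, each of which reads or writes one field of one node, acquires a free lock, releases a lock, or allocates a node. An idle thread may at any time call any set operation ($contains$, $insert$, $delete$ with a key in $K$) or any auxiliary method ($remove\ldots$, $rotate\ldots$). The history of the execution is the sequence of invocations and responses of the set operations. **Claim.** The algorithm is a linearizable implementation of a set: for every execution there is a sequence $L$ of operations of its history, all the completed ones with the values they returned and possibly some pending ones with suitable return values, which respects the real-time order (if one operation returns before another is invoked, it does not come after it in $L$) and is a legal sequential run of an initially empty set object, in which $contains(k)$ and $delete(k)$ return whether $k$ is present, $insert(k)$ returns whether $k$ is absent, and $insert(k)$ adds and $delete(k)$ removes $k$. Moreover, $L$ can be chosen so that the contents of the set after $L$ are $\mathcal A(H)$, where $H$ is the final memory of the execution and $$\mathcal A(H)=\{k\in K \mid \text{there is a node } x \text{ with } x.key=k,\ \neg x.del,\ \text{that lies on a } k\text{-search path from } root \text{ in } H\}.$$ Here a $k$-search path from $root$ is a sequence of nodes that starts with $root$ and in which every node $o$ but the last is followed by $o.left$, where $o.key>k$, or by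 $o.right$, where $o.key<k$. -/

import Mathlib

/-!
A contention-friendly binary search tree, its interleaving semantics, and linearizability with
respect to the sequential specification of a set.  `K` is the type of keys and `T` the type of
threads.  Locations of nodes are natural numbers and `none : Option ℕ` is the null pointer.
-/

namespace CFTree

/-! ### Memory -/

/-- The two children of a node. -/
inductive Side
  | left
  | right

/-- The opposite side. -/
def Side.flip : Side → Side
  | .left => .right
  | .right => .left

/-- A node: its key (`⊤` is the key `∞` of the root), its two child pointers, the flags saying
that it is logically deleted and physically removed, and the thread that holds its lock. -/
structure Node (T K : Type*) where
  key : WithTop K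
  left : Option ℕ
  right : Option ℕ
  del : Bool
  rem : Bool
  lock : Option T

variable {T K : Type*}

/-- The child pointer on side `s`. -/
def Node.child (n : Node T K) : Side → Option ℕ
  | .left => n.left
  | .right => n.right

/-- Overwrite the child pointer on side `s`. -/
def Node.setChild (n : Node T K) (s : Side) (v : Option ℕ) : Node T K :=
  match s with
  | .left => { n with left := v }
  | .right => { n with right := v }

/-- The shared state: the contents of every location, and the locations allocated so far. -/
structure Heap (T K : Type*) where
  mem : ℕ → Node T K
  alloc : Set ℕ

/-- Change the node at location `l`. -/
def Heap.modify (H : Heap T K) (l : ℕ) (f : Node T K → Node T K) : Heap T K :=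
  { H with mem := Function.update H.mem l (f (H.mem l)) }

/-- Put the node `n` at location `l`, which becomes allocated. -/
def Heap.place (H : Heap T K) (l : ℕ) (n : Node T K) : Heap T K :=
  { mem := Function.update H.mem l n, alloc := insert l H.alloc }

/-- `new N(k)`. -/
def Node.fresh (k : WithTop K) : Node T K :=
  { key := k, left := none, right := none, del := false, rem := false, lock := none }

/-- The location of the root. -/
def root : ℕ := 0

/-- The initial memory: only the root, with key `∞`, is allocated. -/
def Heap.init : Heap T K :=
  { mem := fun _ => Node.fresh ⊤, alloc := {root} }

/-! ### Programs -/

/-- The operations of a set object. -/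
inductive SetOp (K : Type*)
  | contains (k : K)
  | insert (k : K)
  | delete (k : K)

/-- The key an operation is about. -/
def SetOp.key : SetOp K → K
  | .contains k => k
  | .insert k => k
  | .delete k => k

/-- The auxiliary methods.  `remove s` is `removeRight` for `s = right` and `removeLeft` for
`s = left`.  `rotate c d` rotates the child `y` of `p` on side `c` down and the child of `y` on
side `d` up: `rotate left left` is `rotateRightLeft`, the other three are its mirror images. -/
inductive Aux
  | remove (s : Side)
  | rotate (c d : Side)

/-- A method call; an auxiliary method comes with the arbitrary key that it passes to `locate`. -/
inductive Call (K : Type*)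
  | op (o : SetOp K)
  | aux (a : Aux) (k : K)

/-- The key that the call passes to `locate`. -/
def Call.key : Call K → K
  | .op o => o.key
  | .aux _ k => k

/-- What a method does once it has released its locks: return a Boolean (set operations),
restart (set operations), or return nothing (auxiliary methods). -/
inductive After (K : Type*)
  | ret (b : Bool)
  | restart (o : SetOp K)
  | done

/-- The control points of a thread, with the values of the live local variables. -/
inductive PC (K : Type*)
  | idle
  | ret (b : Bool)
  | release (held : List ℕ) (a : After K)
  -- locate
  | locKey (c : Call K) (x y : ℕ)
  | locCmp (c : Call K) (x : ℕ)
  | locNext (c : Call K) (s : Side) (x : ℕ)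
  -- contains
  | conDel (y : ℕ)
  -- delete
  | delLock (k : K) (y : ℕ)
  | delRem (k : K) (y : ℕ)
  | delDel (y : ℕ)
  | delSet (y : ℕ) (r : Bool)
  -- insert, when a node with the key was found
  | insLockY (k : K) (y : ℕ)
  | insRemY (k : K) (y : ℕ)
  | insDelY (y : ℕ)
  | insSetY (y : ℕ) (r : Bool)
  -- insert, when no node with the key was found
  | insLockX (k : K) (x : ℕ)
  | insRemX (k : K) (x : ℕ)
  | insKey1 (k : K) (x : ℕ)
  | insLeft (k : K) (x : ℕ)
  | insKey2 (k : K) (x : ℕ)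
  | insRight (k : K) (x : ℕ)
  | insNew (k : K) (s : Side) (x : ℕ)
  | insLink (s : Side) (x n : ℕ)
  -- removeRight, removeLeft
  | rmvLockZ (s : Side) (z : ℕ)
  | rmvY (s : Side) (z : ℕ)
  | rmvRemZ (s : Side) (z y : ℕ)
  | rmvLockY (s : Side) (z y : ℕ)
  | rmvDel (s : Side) (z y : ℕ)
  | rmvInner (s : Side) (z y : ℕ)
  | rmvGetOuter (s : Side) (z y : ℕ)
  | rmvOuter (s : Side) (z y : ℕ)
  | rmvGetInner (s : Side) (z y : ℕ)
  | rmvLink (s : Side) (z y : ℕ) (v : Option ℕ)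
  | rmvMark (z y : ℕ)
  -- rotations
  | rotLockP (c d : Side) (p : ℕ)
  | rotY (c d : Side) (p : ℕ)
  | rotRemP (c d : Side) (p y : ℕ)
  | rotLockY (c d : Side) (p y : ℕ)
  | rotX (c d : Side) (p y : ℕ)
  | rotLockX (c d : Side) (p y x : ℕ)
  | dupKey (c d : Side) (p y x : ℕ)
  | dupLeft (c d : Side) (p y x : ℕ) (key : WithTop K)
  | dupRight (c d : Side) (p y x : ℕ) (key : WithTop K) (l : Option ℕ)
  | dupDel (c d : Side) (p y x : ℕ) (key : WithTop K) (l r : Option ℕ)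
  | dupRem (c d : Side) (p y x : ℕ) (key : WithTop K) (l r : Option ℕ) (del : Bool)
  | dupNew (c d : Side) (p y x : ℕ) (key : WithTop K) (l r : Option ℕ) (del rem : Bool)
  | rotGet (c d : Side) (p y x z : ℕ)
  | rotSetZ (c d : Side) (p y x z : ℕ) (v : Option ℕ)
  | rotSetX (c d : Side) (p y x z : ℕ)
  | rotSetP (c : Side) (p y x : ℕ)
  | rotMark (p y x : ℕ)

/-- An atomic action on the shared memory, with the control point that follows it. -/
inductive Instr (T K : Type*)
  | readKey (l : ℕ) (next : WithTop K → PC K)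
  | readChild (s : Side) (l : ℕ) (next : Option ℕ → PC K)
  | readDel (l : ℕ) (next : Bool → PC K)
  | readRem (l : ℕ) (next : Bool → PC K)
  | writeChild (s : Side) (l : ℕ) (v : Option ℕ) (next : PC K)
  | writeDel (l : ℕ) (v : Bool) (next : PC K)
  | writeRem (l : ℕ) (v : Bool) (next : PC K)
  | lock (l : ℕ) (next : PC K)
  /-- release one of the locks on `held`, chosen arbitrarily -/
  | unlock (held : List ℕ) (next : ℕ → PC K)
  /-- put a new node at a location that has not been allocated before -/
  | new (n : Node T K) (next : ℕ → PC K)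
  /-- no memory action: the thread is idle or about to return -/
  | halted

/-- Start of a call: `locate` begins with `x, y ← root`. -/
def PC.start (c : Call K) : PC K := .locKey c root root

/-- Release the locks in `held` and then do `a`. -/
def PC.finish (held : List ℕ) (a : After K) : PC K :=
  match held, a with
  | [], .ret b => .ret b
  | [], .restart o => .start (.op o)
  | [], .done => .idle
  | l :: ls, a => .release (l :: ls) a

/-- The control point at which the caller `c` continues when `locate` has returned `(x, y)`. -/
def PC.located (c : Call K) (x : ℕ) (y : Option ℕ) : PC K :=
  match c, y with
  | .op (.contains _), .none => .ret false
  | .op (.contains _), .some y => .conDel y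
  | .op (.delete _), .none => .ret false
  | .op (.delete k), .some y => .delLock k y
  | .op (.insert k), .some y => .insLockY k y
  | .op (.insert k), .none => .insLockX k x
  | .aux (.remove s) _, _ => .rmvLockZ s x
  | .aux (.rotate c d) _, _ => .rotLockP c d x

/-- The loop head of `locate`, where `y ≠ null` is tested. -/
def PC.locate (c : Call K) (x : ℕ) (y : Option ℕ) : PC K :=
  match y with
  | .none => .located c x .none
  | .some y => .locKey c x y

/-- The code.  Every control point performs one atomic memory action. -/
def code [LinearOrder K] : PC K → Instr T K
  | .idle => .halted
  | .ret _ => .halted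
  | .release held a => .unlock held fun l => .finish (held.erase l) a
  -- locate(k):  while (y ≠ null ∧ y.key ≠ k)
  | .locKey c x y => .readKey y fun q =>
      if q = c.key then .located c x (some y) else .locCmp c y
  --   x ← y;  if (x.key < k) y ← x.right else y ← x.left
  | .locCmp c x => .readKey x fun q =>
      if q < c.key then .locNext c .right x else .locNext c .left x
  | .locNext c s x => .readChild s x fun y => .locate c x y
  -- contains(k):  if (y.del) return false;  return true
  | .conDel y => .readDel y fun b => .ret (!b)
  -- delete(k):  lock(y);  if (y.rem) restart
  | .delLock k y => .lock y (.delRem k y)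
  | .delRem k y => .readRem y fun b =>
      if b then .finish [y] (.restart (.delete k)) else .delDel y
  --   ret ← ¬ y.del;  y.del ← true;  return ret
  | .delDel y => .readDel y fun b => .delSet y (!b)
  | .delSet y r => .writeDel y true (.finish [y] (.ret r))
  -- insert(k), y ≠ null:  lock(y);  if (y.rem) restart
  | .insLockY k y => .lock y (.insRemY k y)
  | .insRemY k y => .readRem y fun b =>
      if b then .finish [y] (.restart (.insert k)) else .insDelY y
  --   ret ← y.del;  y.del ← false;  return ret
  | .insDelY y => .readDel y fun b => .insSetY y b
  | .insSetY y r => .writeDel y false (.finish [y] (.ret r))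
  -- insert(k), y = null:  lock(x);  if (x.rem) restart
  | .insLockX k x => .lock x (.insRemX k x)
  | .insRemX k x => .readRem x fun b =>
      if b then .finish [x] (.restart (.insert k)) else .insKey1 k x
  --   if (k < x.key ∧ x.left = null)  x.left ← new N(k)
  | .insKey1 k x => .readKey x fun q => if k < q then .insLeft k x else .insKey2 k x
  | .insLeft k x => .readChild .left x fun v =>
      if v = none then .insNew k .left x else .insKey2 k x
  --   else if (k > x.key ∧ x.right = null)  x.right ← new N(k);  else restart
  | .insKey2 k x => .readKey x fun q =>
      if q < k then .insRight k x else .finish [x] (.restart (.insert k))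
  | .insRight k x => .readChild .right x fun v =>
      if v = none then .insNew k .right x else .finish [x] (.restart (.insert k))
  | .insNew k s x => .new (Node.fresh k) fun n => .insLink s x n
  --   return true
  | .insLink s x n => .writeChild s x (some n) (.finish [x] (.ret true))
  -- removeRight (s = right), removeLeft (s = left):  lock(z);  y ← z.s
  | .rmvLockZ s z => .lock z (.rmvY s z)
  | .rmvY s z => .readChild s z fun v =>
      match v with
      | .none => .finish [z] .done
      | .some y => .rmvRemZ s z y
  --   if (y = null ∨ z.rem) return
  | .rmvRemZ s z y => .readRem z fun b =>
      if b then .finish [z] .done else .rmvLockY s z y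
  --   lock(y);  if (¬ y.del) return
  | .rmvLockY s z y => .lock y (.rmvDel s z y)
  | .rmvDel s z y => .readDel y fun b =>
      if b then .rmvInner s z y else .finish [z, y] .done
  --   for s = right:  if (y.left = null)  z.right ← y.right
  | .rmvInner s z y => .readChild s.flip y fun v =>
      if v = none then .rmvGetOuter s z y else .rmvOuter s z y
  | .rmvGetOuter s z y => .readChild s y fun v => .rmvLink s z y v
  --   else if (y.right = null)  z.right ← y.left;  else return
  | .rmvOuter s z y => .readChild s y fun v =>
      if v = none then .rmvGetInner s z y else .finish [z, y] .done
  | .rmvGetInner s z y => .readChild s.flip y fun v => .rmvLink s z y v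
  | .rmvLink s z y v => .writeChild s z v (.rmvMark z y)
  --   y.rem ← true
  | .rmvMark z y => .writeRem y true (.finish [z, y] .done)
  -- rotateRightLeft (c = d = left) and its mirror images:  lock(p);  y ← p.c
  | .rotLockP c d p => .lock p (.rotY c d p)
  | .rotY c d p => .readChild c p fun v =>
      match v with
      | .none => .finish [p] .done
      | .some y => .rotRemP c d p y
  --   if (y = null ∨ p.rem) return
  | .rotRemP c d p y => .readRem p fun b =>
      if b then .finish [p] .done else .rotLockY c d p y
  --   lock(y);  x ← y.d;  if (x = null) return;  lock(x)
  | .rotLockY c d p y => .lock y (.rotX c d p y)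
  | .rotX c d p y => .readChild d y fun v =>
      match v with
      | .none => .finish [p, y] .done
      | .some x => .rotLockX c d p y x
  | .rotLockX c d p y x => .lock x (.dupKey c d p y x)
  --   z ← duplicate(y)
  | .dupKey c d p y x => .readKey y fun q => .dupLeft c d p y x q
  | .dupLeft c d p y x q => .readChild .left y fun l => .dupRight c d p y x q l
  | .dupRight c d p y x q l => .readChild .right y fun r => .dupDel c d p y x q l r
  | .dupDel c d p y x q l r => .readDel y fun b => .dupRem c d p y x q l r b
  | .dupRem c d p y x q l r b => .readRem y fun b' => .dupNew c d p y x q l r b b'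
  | .dupNew c d p y x q l r b b' =>
      .new { key := q, left := l, right := r, del := b, rem := b', lock := none }
        fun z => .rotGet c d p y x z
  --   for d = left:  z.left ← x.right;  x.right ← z
  | .rotGet c d p y x z => .readChild d.flip x fun v => .rotSetZ c d p y x z v
  | .rotSetZ c d p y x z v => .writeChild d z v (.rotSetX c d p y x z)
  | .rotSetX c d p y x z => .writeChild d.flip x (some z) (.rotSetP c p y x)
  --   p.c ← x;  y.rem ← true
  | .rotSetP c p y x => .writeChild c p (some x) (.rotMark p y x)
  | .rotMark p y x => .writeRem y true (.finish [p, y, x] .done)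

/-! ### Concurrent executions -/

/-- Execution of an atomic action by thread `t`: memory before, memory and control point after.
Acquiring a lock is possible only while the lock is free. -/
inductive Instr.Exec (t : T) : Instr T K → Heap T K → Heap T K → PC K → Prop
  | readKey {l next H} : Exec t (.readKey l next) H H (next (H.mem l).key)
  | readChild {s l next H} : Exec t (.readChild s l next) H H (next ((H.mem l).child s))
  | readDel {l next H} : Exec t (.readDel l next) H H (next (H.mem l).del)
  | readRem {l next H} : Exec t (.readRem l next) H H (next (H.mem l).rem)
  | writeChild {s l v next H} :
      Exec t (.writeChild s l v next) H (H.modify l fun n => n.setChild s v) next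
  | writeDel {l v next H} :
      Exec t (.writeDel l v next) H (H.modify l fun n => { n with del := v }) next
  | writeRem {l v next H} :
      Exec t (.writeRem l v next) H (H.modify l fun n => { n with rem := v }) next
  | lock {l next H} (free : (H.mem l).lock = .none) :
      Exec t (.lock l next) H (H.modify l fun n => { n with lock := some t }) next
  | unlock {held next H} (l : ℕ) (hl : l ∈ held) :
      Exec t (.unlock held next) H (H.modify l fun n => { n with lock := .none }) (next l)
  | new {n next H} (l : ℕ) (hl : l ∉ H.alloc) :
      Exec t (.new n next) H (H.place l n) (next l)

/-- A global state: the memory and the control point of every thread. -/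
structure State (T K : Type*) where
  heap : Heap T K
  pc : T → PC K

/-- The initial state: the empty tree, all threads idle. -/
def State.init : State T K := { heap := Heap.init, pc := fun _ => .idle }

/-- The events of a history: invocations of set operations and their responses. -/
inductive Event (T K : Type*)
  | inv (t : T) (o : SetOp K)
  | res (t : T) (b : Bool)

/-- One step of one thread, with the event (if any) that it contributes to the history.  An idle
thread may at any time invoke a set operation or an auxiliary method. -/
inductive Step [LinearOrder K] [DecidableEq T] :
    State T K → List (Event T K) → State T K → Prop
  | invoke {σ} (t : T) (o : SetOp K) (h : σ.pc t = .idle) :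
      Step σ [.inv t o] { σ with pc := Function.update σ.pc t (.start (.op o)) }
  | maintain {σ} (t : T) (a : Aux) (k : K) (h : σ.pc t = .idle) :
      Step σ [] { σ with pc := Function.update σ.pc t (.start (.aux a k)) }
  | respond {σ} (t : T) (b : Bool) (h : σ.pc t = .ret b) :
      Step σ [.res t b] { σ with pc := Function.update σ.pc t .idle }
  | act {σ} (t : T) {H' : Heap T K} {q : PC K} (h : (code (σ.pc t)).Exec t σ.heap H' q) :
      Step σ [] { heap := H', pc := Function.update σ.pc t q }

/-- `Reaches h σ`: some concurrent execution from the initial state has history `h` and ends in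
the state `σ`. -/
inductive Reaches [LinearOrder K] [DecidableEq T] : List (Event T K) → State T K → Prop
  | init : Reaches [] State.init
  | step {h σ e σ'} : Reaches h σ → Step σ e σ' → Reaches (h ++ e) σ'

/-! ### Linearizability -/

/-- The abstract set after an operation. -/
def SetOp.apply : SetOp K → Set K → Set K
  | .contains _, S => S
  | .insert k, S => S ∪ {k}
  | .delete k, S => S \ {k}

/-- The sequential specification of return values: `contains` and `delete` report whether the
key is present before the operation, `insert` reports whether it is absent. -/
def SetOp.Returns : SetOp K → Set K → Bool → Prop
  | .contains k, S, b => b = true ↔ k ∈ S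
  | .insert k, S, b => b = true ↔ k ∉ S
  | .delete k, S, b => b = true ↔ k ∈ S

/-- `Legal S L S'`: executed one after the other on a set object with contents `S`, the
operations of `L` (with their return values) meet the sequential specification and leave
contents `S'`. -/
inductive Legal : Set K → List (SetOp K × Bool) → Set K → Prop
  | nil {S} : Legal S [] S
  | cons {S o b L S'} : o.Returns S b → Legal (o.apply S) L S' → Legal S ((o, b) :: L) S'

/-- In the history `h`, the operation invoked at position `i` is `o`, and it returns `b` by the
response at position `j` (the next response of the same thread). -/
def Completes (h : List (Event T K)) (i j : ℕ) (o : SetOp K) (b : Bool) : Prop :=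
  ∃ t, h[i]? = some (.inv t o) ∧ i < j ∧ h[j]? = some (.res t b) ∧
    ∀ m, i < m → m < j → ∀ b', h[m]? ≠ some (.res t b')

/-- In the history `h`, the operation invoked at position `i` has returned before the
operation at position `i'` is invoked. -/
def Precedes (h : List (Event T K)) (i i' : ℕ) : Prop :=
  ∃ j o b, Completes h i j o b ∧ j < i'

/-- `L` is a linearization of the history `h`, ending with contents `S`.  Operations are
identified with the positions of their invocations in `h`.  `L` lists all completed operations
with the values they returned, and possibly some pending ones with arbitrary return values; it
respects the real-time order of `h`, and it is legal for a set object that is initially empty. -/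
structure IsLinearization (h : List (Event T K)) (L : List (ℕ × SetOp K × Bool)) (S : Set K) :
    Prop where
  nodup : (L.map Prod.fst).Nodup
  invoked : ∀ i o b, (i, o, b) ∈ L → ∃ t, h[i]? = some (.inv t o)
  completed : ∀ i j o b, Completes h i j o b → (i, o, b) ∈ L
  realTime : L.Pairwise fun a a' => ¬ Precedes h a'.1 a.1
  legal : Legal ∅ (L.map Prod.snd) S

/-- The history `h` is linearizable with respect to the sequential specification of a set. -/
def Linearizable (h : List (Event T K)) : Prop :=
  ∃ L S, IsLinearization h L S

/-! ### The abstraction function -/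

/-- One step of a search for `k`, from `o` to `o'`. -/
def NextChild [LinearOrder K] (H : Heap T K) (k : K) (o o' : ℕ) : Prop :=
  ((H.mem o).key > k ∧ (H.mem o).left = some o') ∨
    ((H.mem o).key < k ∧ (H.mem o).right = some o')

/-- There is a search path for `k` from `o` to `o'`. -/
def SearchPath [LinearOrder K] (H : Heap T K) (k : K) : ℕ → ℕ → Prop :=
  Relation.ReflTransGen (NextChild H k)

/-- The abstract set: the keys of the nodes that lie on a valid search path for their key from
the root and are not logically deleted. -/
def absSet [LinearOrder K] (H : Heap T K) : Set K :=
  { k | ∃ x, SearchPath H k root x ∧ (H.mem x).key = k ∧ (H.mem x).del = false }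

end CFTree

/-!
Searches take no locks, so the proof has to explain what a search may conclude from pointers that
other threads are changing.

*The logical tree.*  Auxiliary state (`Ghost`) classifies the allocated nodes as private, live or
gone.  The live nodes form a binary search tree, in which a rotation happens in a single step, at the
write that makes the copy `z` of `y` a child of `x`.  From then on `y` is gone, although `p` still
points to it.  A *virtual edge* from `p` to `x` records that this pointer is about to be redirected.
The invariant of the search graph (`Graph.Inv`) says that searches which start at the same live node
agree, whether they follow pointers or virtual edges: if one that follows pointers visits a live node,
then all visit it (`hits_of_path`), and all give the same answer (`outcome`).  Each write to the tree
preserves this invariant: `Graph.Inv.setDel`, `Graph.AddLeaf.inv`, `Graph.Unlink.inv`,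
`Graph.Rotate.inv` and `Graph.Commit.inv`, where the last two are the two visible writes of a rotation.
Removals and rotations preserve the answers of searches from the root as well, hence the abstract set.

*Traversals.*  A search may be at a node that is gone.  What it can rely on is `Graph.Good`: live nodes
ahead of it are on the search path from the root, and if it ended at a node ahead, its answer would
have been right at some moment since its invocation.  This property is stable because a write
changes the pointers or the flag of a live node `w` only, which, if ahead, is on the search path from
the root both before and after the write (`Graph.Good.transfer`).

*Linearization points.*  A node that is locked and not marked as removed is live, so when an operation
that has locked the node which its search found writes to it, the write takes effect on the search path
for its key, and the operation is linearized there.  A `contains`, or a `delete` that finds no node,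
only knows that its answer was right at some moment since its invocation (`Slot`); as it leaves the set
unchanged, it can be inserted at the corresponding place of the linearization built so far
(`LinInv.insert`).

The invariant `ExecInv` of executions combines the invariant of the memory (`HInv`), that of each
thread at its control point (`TInv`), and a linearization of the history that ends with the current
abstract set (`LinInv`).  `exec_effect` shows that a thread preserves its own invariant, and
`TInv.stable` that it preserves those of the others.
-/

set_option linter.unusedSectionVars false

namespace CFTree

open Relation

section

variable {T K : Type*} [LinearOrder K]

/-! ### Sides of a key -/

/-- `s.Of a b`: the key `a` belongs on side `s` of a node with key `b`. -/
def Side.Of : Side → WithTop K → WithTop K → Prop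
  | .left, a, b => a < b
  | .right, a, b => b < a

@[simp] theorem Side.flip_flip (s : Side) : s.flip.flip = s := by cases s <;> rfl

theorem Side.flip_ne (s : Side) : s.flip ≠ s := by cases s <;> simp [Side.flip]

theorem Side.eq_or_eq_flip (s t : Side) : s = t ∨ s = t.flip := by
  cases s <;> cases t <;> simp [Side.flip]

theorem Side.of_flip {s : Side} {a b : WithTop K} : s.flip.Of a b ↔ s.Of b a := by
  cases s <;> rfl

theorem Side.Of.irrefl {s : Side} {a : WithTop K} (h : s.Of a a) : False := by
  cases s <;> exact lt_irrefl _ h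

theorem Side.Of.trans {s : Side} {a b c : WithTop K} (h : s.Of a b) (h' : s.Of b c) :
    s.Of a c := by
  cases s
  · exact lt_trans h h'
  · exact lt_trans h' h

theorem Side.Of.asymm {s : Side} {a b : WithTop K} (h : s.Of a b) (h' : s.Of b a) : False :=
  (h.trans h').irrefl

theorem Side.Of.ne {s : Side} {a b : WithTop K} (h : s.Of a b) : a ≠ b := by
  rintro rfl; exact h.irrefl

theorem Side.Of.side_unique {s s' : Side} {a b : WithTop K} (h : s.Of a b) (h' : s'.Of a b) :
    s = s' := by
  rcases s.eq_or_eq_flip s' with e | rfl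
  · exact e
  · exact (h'.asymm (Side.of_flip.1 h)).elim

theorem Side.of_or (s : Side) (a b : WithTop K) : a = b ∨ s.Of a b ∨ s.flip.Of a b := by
  rcases lt_trichotomy a b with h | h | h <;> cases s <;> simp [Side.Of, Side.flip, h]

theorem Side.exists_of {a b : WithTop K} (h : a ≠ b) : ∃ s : Side, s.Of a b := by
  rcases Side.left.of_or a b with h' | h' | h'
  · exact (h h').elim
  · exact ⟨_, h'⟩
  · exact ⟨_, h'⟩

/-! ### Search graphs -/

/-- The shape of a shared memory.  A node is `live` when it belongs to the logical tree.
A virtual edge `virt m s = some x` announces a write of `x` to the child pointer on side `s` of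
`m`: the logical tree already has `x` there, while searches still read the old pointer `child m s`. -/
structure Graph (K : Type*) where
  key : ℕ → WithTop K
  child : ℕ → Side → Option ℕ
  del : ℕ → Bool
  live : Set ℕ
  virt : ℕ → Side → Option ℕ

namespace Graph

variable {G G' : Graph K} {k : K}

/-- A step of a search for `k` along the pointers in memory. -/
def PStep (G : Graph K) (k : K) (m n : ℕ) : Prop :=
  ∃ s : Side, s.Of k (G.key m) ∧ G.child m s = some n

/-- A step of a search for `k` that may also follow a virtual edge. -/
def GStep (G : Graph K) (k : K) (m n : ℕ) : Prop :=
  ∃ s : Side, s.Of k (G.key m) ∧ (G.child m s = some n ∨ G.virt m s = some n)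

/-- The child pointers of the logical tree, in which virtual edges replace pointers. -/
def star (G : Graph K) (m : ℕ) (s : Side) : Option ℕ := (G.virt m s).or (G.child m s)

/-- The edges of the logical tree. -/
def Edge (G : Graph K) (s : Side) (m n : ℕ) : Prop := m ∈ G.live ∧ G.star m s = some n

/-- A step of a search for `k` in the logical tree. -/
def SStep (G : Graph K) (k : K) (m n : ℕ) : Prop :=
  ∃ s : Side, s.Of k (G.key m) ∧ G.Edge s m n

/-- Search paths in memory. -/
abbrev Path (G : Graph K) (k : K) : ℕ → ℕ → Prop := ReflTransGen (G.PStep k)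

/-- Search paths that may follow virtual edges. -/
abbrev Gen (G : Graph K) (k : K) : ℕ → ℕ → Prop := ReflTransGen (G.GStep k)

/-- Search paths in the logical tree. -/
abbrev Star (G : Graph K) (k : K) : ℕ → ℕ → Prop := ReflTransGen (G.SStep k)

/-- Descendants in the logical tree. -/
abbrev Desc (G : Graph K) : ℕ → ℕ → Prop := ReflTransGen fun m n => ∃ s, G.Edge s m n

/-- `G.Inev k P o`: every search for `k` from the pointer `o`, whichever virtual edges it follows,
comes to a pointer with property `P`. -/
inductive Inev (G : Graph K) (k : K) (P : Option ℕ → Prop) : Option ℕ → Prop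
  | now {o} : P o → Inev G k P o
  | step {m : ℕ} {s : Side} : s.Of k (G.key m) → Inev G k P (G.child m s) →
      (∀ x, G.virt m s = some x → Inev G k P (some x)) → Inev G k P (some m)

/-- Every search for `k` from `v` visits `n`. -/
abbrev Hits (G : Graph K) (k : K) (n v : ℕ) : Prop := G.Inev k (fun o => o = some n) (some v)

/-- A search for `k` ends at the pointer `o`, and `b` tells whether it finds `k` there. -/
def Fin (G : Graph K) (k : K) (b : Bool) (o : Option ℕ) : Prop :=
  (o = none ∧ b = false) ∨ ∃ m, o = some m ∧ G.key m = k ∧ b = !G.del m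

/-- Every search for `k` from `o` has the outcome `b`. -/
abbrev Res (G : Graph K) (k : K) (b : Bool) (o : Option ℕ) : Prop := G.Inev k (G.Fin k b) o

/-- The invariant of the search graph.  The live nodes form a search tree, with the edges `Edge`.
Virtual edges only let searches meet more live nodes, and searches for `k` from a live node
agree about `k`, whichever virtual edges they follow. -/
structure Inv (G : Graph K) : Prop where
  root_live : root ∈ G.live
  root_edge : ∀ {s m}, ¬ G.Edge s m root
  edge_live : ∀ {s m n}, G.Edge s m n → n ∈ G.live
  edge_inj : ∀ {s m s' m' n}, G.Edge s m n → G.Edge s' m' n → m = m' ∧ s = s'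
  order : ∀ {s m n n'}, G.Edge s m n → G.Desc n n' → s.Of (G.key n') (G.key m)
  virt_live : ∀ {m s x}, G.virt m s = some x → m ∈ G.live
  star_of_gen : ∀ {k v n}, v ∈ G.live → n ∈ G.live → G.Gen k v n → G.Star k v n
  hits_of_path : ∀ {k v n}, v ∈ G.live → n ∈ G.live → G.Path k v n → G.Hits k n v
  outcome : ∀ k {v}, v ∈ G.live → ∃ b, G.Res k b (some v)

theorem PStep.gstep {m n : ℕ} (h : G.PStep k m n) : G.GStep k m n :=
  h.imp fun _ h => ⟨h.1, .inl h.2⟩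

theorem Path.gen {m n : ℕ} (h : G.Path k m n) : G.Gen k m n :=
  ReflTransGen.mono (fun _ _ h => PStep.gstep h) _ _ h

theorem SStep.gstep {m n : ℕ} (h : G.SStep k m n) : G.GStep k m n := by
  obtain ⟨s, hs, -, h⟩ := h
  refine ⟨s, hs, ?_⟩
  unfold star at h
  cases hv : G.virt m s with
  | none => rw [hv] at h; exact .inl h
  | some x => rw [hv] at h; exact .inr h

theorem Star.gen {m n : ℕ} (h : G.Star k m n) : G.Gen k m n :=
  ReflTransGen.mono (fun _ _ h => SStep.gstep h) _ _ h

theorem Star.desc {m n : ℕ} (h : G.Star k m n) : G.Desc m n :=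
  ReflTransGen.mono (fun _ _ ⟨s, _, h⟩ => ⟨s, h⟩) _ _ h

theorem star_of_virt {m x : ℕ} {s : Side} (h : G.virt m s = some x) : G.star m s = some x := by
  simp [star, h]

theorem star_of_none {m : ℕ} {s : Side} (h : G.virt m s = none) : G.star m s = G.child m s := by
  simp [star, h]

namespace Inev

variable {P Q : Option ℕ → Prop} {o : Option ℕ}

theorem bind (h : G.Inev k P o) (hPQ : ∀ o, P o → G.Inev k Q o) : G.Inev k Q o := by
  induction h with
  | now h => exact hPQ _ h
  | step hs _ _ ih ih' => exact .step hs ih ih'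

/-- The step to a child when there is no virtual edge. -/
theorem step' {m : ℕ} {s : Side} (hs : s.Of k (G.key m)) (hv : G.virt m s = none)
    (h : G.Inev k P (G.child m s)) : G.Inev k P (some m) :=
  .step hs h fun x hx => by simp [hv] at hx

theorem exists_path {v : ℕ} (h : G.Inev k P o) (ho : o = some v) :
    (∃ n, G.Path k v n ∧ P (some n)) ∨
      ∃ n s, G.Path k v n ∧ s.Of k (G.key n) ∧ G.child n s = none ∧ P none := by
  induction h generalizing v with
  | now h => subst ho; exact .inl ⟨v, .refl, h⟩
  | @step m s hs h _ ih _ =>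
    obtain rfl : m = v := Option.some.inj ho
    cases hc : G.child m s with
    | none =>
      rw [hc] at h
      refine .inr ⟨m, s, .refl, hs, hc, ?_⟩
      cases h with | now h => exact h
    | some w =>
      have hp : G.PStep k m w := ⟨s, hs, hc⟩
      rcases ih (v := w) hc with ⟨n, h1, h2⟩ | ⟨n, s', h1, h2⟩
      · exact .inl ⟨n, .head hp h1, h2⟩
      · exact .inr ⟨n, s', .head hp h1, h2⟩

/-- A search passes a pointer with property `P` or is still bound to come to one. -/
theorem along {v w : ℕ} (h : G.Inev k P (some v)) (hg : G.Gen k v w) :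
    G.Inev k P (some w) ∨ ∃ n, P (some n) ∧ G.Gen k v n ∧ G.Gen k n w := by
  induction hg with
  | refl => exact .inl h
  | @tail m n hg hs ih =>
    rcases ih with ih | ⟨a, h1, h2, h3⟩
    · cases ih with
      | now h => exact .inr ⟨m, h, hg, .single hs⟩
      | step hs' hc hv =>
        obtain ⟨s', hs, hn⟩ := hs
        obtain rfl := hs.side_unique hs'
        rcases hn with hn | hn
        · rw [hn] at hc; exact .inl hc
        · exact .inl (hv _ hn)
    · exact .inr ⟨a, h1, h2, h3.tail hs⟩

/-- Nothing changes for a search that does not meet a modified node. -/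
theorem frame (h : G.Inev k P o)
    (hG : ∀ u m, o = some u → G.Gen k u m →
      G'.key m = G.key m ∧ G'.child m = G.child m ∧ G'.virt m = G.virt m)
    (hP : ∀ u m, o = some u → G.Gen k u m → P (some m) → Q (some m)) (hP' : P none → Q none) :
    G'.Inev k Q o := by
  induction h with
  | @now o h =>
    cases o with
    | none => exact .now (hP' h)
    | some m => exact .now (hP m m rfl .refl h)
  | @step m s hs h1 h2 ih1 ih2 =>
    obtain ⟨e1, e2, e3⟩ := hG m m rfl .refl
    refine .step (s := s) (by rwa [e1]) ?_ ?_
    · rw [e2]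
      exact ih1 (fun u n hu hn => hG m n rfl (.head ⟨s, hs, .inl hu⟩ hn))
        (fun u n hu hn => hP m n rfl (.head ⟨s, hs, .inl hu⟩ hn))
    · intro x hx
      rw [e3] at hx
      refine ih2 x hx (fun u n hu hn => hG m n rfl (.head ⟨s, hs, .inr ?_⟩ hn))
        (fun u n hu hn => hP m n rfl (.head ⟨s, hs, .inr ?_⟩ hn)) <;> rw [hx, hu]

end Inev

theorem Hits.path {v n : ℕ} (h : G.Hits k n v) : G.Path k v n := by
  rcases h.exists_path rfl with ⟨m, h, e⟩ | ⟨m, s, h, -, -, e⟩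
  · cases e; exact h
  · cases e

theorem Fin.not_gstep {b : Bool} {m n : ℕ} (h : G.Fin k b (some m)) : ¬ G.GStep k m n := by
  rintro ⟨s, hs, -⟩
  rcases h with ⟨h, -⟩ | ⟨m', h, h', -⟩
  · cases h
  · cases h; exact hs.ne h'.symm

/-- The outcome of a search is well defined. -/
theorem Res.unique {b b' : Bool} {o : Option ℕ} (h : G.Res k b o) (h' : G.Res k b' o) : b = b' := by
  induction h with
  | @now o h =>
    cases h' with
    | now h' =>
      rcases h with ⟨rfl, rfl⟩ | ⟨m, rfl, h1, rfl⟩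
      · rcases h' with ⟨-, rfl⟩ | ⟨m, h, -⟩
        · rfl
        · cases h
      · rcases h' with ⟨h, -⟩ | ⟨m', h, h1, rfl⟩
        · cases h
        · cases h; rfl
    | step hs hc hv =>
      rcases h with ⟨h, -⟩ | ⟨m', h, h', -⟩
      · cases h
      · cases h; exact (hs.ne h'.symm).elim
  | @step m s hs h1 h2 ih1 ih2 =>
    cases h' with
    | now h =>
      rcases h with ⟨h, -⟩ | ⟨m', h, h', -⟩
      · cases h
      · cases h; exact (hs.ne h'.symm).elim
    | step hs' hc hv =>
      obtain rfl := hs.side_unique hs'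
      exact ih1 hc

/-- A search that is under way has the outcome that it had at its start. -/
theorem Res.along {b : Bool} {v w : ℕ} (h : G.Res k b (some v)) (hg : G.Gen k v w) :
    G.Res k b (some w) := by
  rcases Inev.along h hg with h | ⟨n, hn, -, hg⟩
  · exact h
  · rcases hg.cases_head with rfl | ⟨m, hm, -⟩
    · exact .now hn
    · exact (hn.not_gstep hm).elim

theorem Res.eq_del {b : Bool} {m : ℕ} (h : G.Res k b (some m)) (hk : G.key m = k) :
    b = !G.del m :=
  h.unique (.now (.inr ⟨m, rfl, hk, rfl⟩))

theorem Res.child {b : Bool} {m : ℕ} {s : Side} (h : G.Res k b (some m)) (hk : s.Of k (G.key m)) :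
    G.Res k b (G.child m s) := by
  cases h with
  | now h =>
    rcases h with ⟨h, -⟩ | ⟨m', h, h', -⟩
    · cases h
    · cases h; exact (hk.ne h'.symm).elim
  | step hs' hc hv =>
    obtain rfl := hk.side_unique hs'
    exact hc

theorem Res.of_none {b : Bool} (h : G.Res k b none) : b = false := by
  cases h with
  | now h =>
    rcases h with ⟨-, h⟩ | ⟨m', h, -⟩
    · exact h
    · cases h

theorem res_none : G.Res k false none := .now (.inl ⟨rfl, rfl⟩)

/-- Whether a search from `v` finds `k`. -/
theorem Res.true_iff {b : Bool} {v : ℕ} (h : G.Res k b (some v)) :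
    b = true ↔ ∃ n, G.Path k v n ∧ G.key n = k ∧ G.del n = false := by
  constructor
  · rintro rfl
    rcases h.exists_path rfl with ⟨n, h1, h2⟩ | ⟨n, s, -, -, -, h2⟩
    · rcases h2 with ⟨h, -⟩ | ⟨m, h, h', h''⟩
      · cases h
      · cases h; exact ⟨n, h1, h', by simpa using h''⟩
    · rcases h2 with ⟨-, h⟩ | ⟨m, h, -⟩ <;> cases h
  · rintro ⟨n, h1, h2, h3⟩
    rw [(h.along h1.gen).eq_del h2, h3]; rfl

/-! ### Consequences of the graph invariant -/

namespace Inv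

variable (hG : G.Inv)
include hG

theorem edge_of_child {m n : ℕ} {s : Side} (hm : m ∈ G.live) (hv : G.virt m s = none)
    (h : G.child m s = some n) : G.Edge s m n :=
  ⟨hm, by rw [star_of_none hv, h]⟩

theorem not_edge_desc {m n : ℕ} {s : Side} (h : G.Edge s m n) (h' : G.Desc n m) : False :=
  (hG.order h h').irrefl

theorem desc_antisymm {m n : ℕ} (h : G.Desc m n) (h' : G.Desc n m) : m = n := by
  rcases h.cases_head with h | ⟨a, ⟨s, h1⟩, h2⟩
  · exact h
  · exact (hG.not_edge_desc h1 (h2.trans h')).elim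

theorem star_to_root {v : ℕ} (h : G.Star k v root) : v = root := by
  rcases h.cases_tail with h | ⟨m, -, s, -, h⟩
  · exact h.symm
  · exact (hG.root_edge h).elim

/-- The last step of a search between live nodes is made at the parent. -/
theorem gen_parent {v y n : ℕ} {s : Side} (hv : v ∈ G.live) (h : G.Gen k v n) (hvn : v ≠ n)
    (he : G.Edge s y n) : s.Of k (G.key y) ∧ G.Star k v y := by
  rcases (hG.star_of_gen hv (hG.edge_live he) h).cases_tail with h | ⟨m, h1, s', h2, h3⟩
  · exact (hvn h.symm).elim
  · obtain ⟨rfl, rfl⟩ := hG.edge_inj h3 he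
    exact ⟨h2, h1⟩

theorem star_comparable {v w n : ℕ} (h : G.Star k v n) (h' : G.Star k w n) :
    G.Star k v w ∨ G.Star k w v := by
  induction h with
  | refl => exact .inr h'
  | @tail a b h1 h2 ih =>
    rcases h'.cases_tail with h | ⟨m, h3, s, h4, h5⟩
    · subst h; exact .inl (h1.tail h2)
    · obtain ⟨s', h6, h7⟩ := h2
      obtain ⟨rfl, rfl⟩ := hG.edge_inj h5 h7
      exact ih h3

/-- A search for `k` from the root in the logical tree takes the turns that lead to its end. -/
theorem of_star_root {m n x : ℕ} {s : Side} (h : G.Star k root x) (he : G.Edge s m n)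
    (hd : G.Desc n x) : s.Of k (G.key m) := by
  have last : ∀ {t a b}, G.Star k root b → G.Edge t a b → G.Star k root a ∧ t.Of k (G.key a) := by
    intro t a b h he
    rcases h.cases_tail with e | ⟨a', h1, t', h2, h3⟩
    · subst e; exact (hG.root_edge he).elim
    · obtain ⟨rfl, rfl⟩ := hG.edge_inj h3 he
      exact ⟨h1, h2⟩
  induction hd with
  | refl => exact (last h he).2
  | tail _ h2 ih =>
    obtain ⟨t, h2⟩ := h2
    exact ih (last h h2).1

/-- A live node on the search path for `k` in memory is visited by every search for `k` that could
meet it. -/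
theorem hits_of_gen {v n : ℕ} (hn : n ∈ G.live) (hp : G.Path k root n) (hv : v ∈ G.live)
    (h : G.Gen k v n) : G.Hits k n v := by
  have h1 := hG.star_of_gen hv hn h
  have h2 := hG.star_of_gen hG.root_live hn (Path.gen hp)
  have h3 : G.Star k root v := by
    rcases hG.star_comparable h1 h2 with h | h
    · rw [hG.star_to_root h]
    · exact h
  rcases Inev.along (hG.hits_of_path hG.root_live hn hp) (Star.gen h3) with h | ⟨m, hm, -, h5⟩
  · exact h
  · cases hm
    have h6 := hG.star_of_gen hn hv h5
    rw [hG.desc_antisymm (Star.desc h1) (Star.desc h6)]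
    exact .now rfl

/-- What a search from a live node finds lies below that node in the logical tree. -/
theorem eq_false_or_exists_desc {v : ℕ} {b : Bool} (hv : v ∈ G.live) (h : G.Res k b (some v)) :
    b = false ∨ ∃ n, G.Desc v n ∧ G.key n = k := by
  generalize ho : some v = o at h
  induction h generalizing v with
  | now h =>
    subst ho
    rcases h with ⟨h, -⟩ | ⟨m, h, h', -⟩
    · cases h
    · cases h; exact .inr ⟨v, .refl, h'⟩
  | @step m s hs h1 h2 ih1 ih2 =>
    obtain rfl : v = m := Option.some.inj ho
    have key : ∀ w, G.star v s = some w → (b = false ∨ ∃ n, G.Desc w n ∧ G.key n = k) →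
        b = false ∨ ∃ n, G.Desc v n ∧ G.key n = k := by
      rintro w hw (h | ⟨n, h, h'⟩)
      · exact .inl h
      · exact .inr ⟨n, .head ⟨s, hv, hw⟩ h, h'⟩
    cases hx : G.virt v s with
    | some x => exact key x (star_of_virt hx) (ih2 x hx (hG.edge_live ⟨hv, star_of_virt hx⟩) rfl)
    | none =>
      cases hc : G.child v s with
      | none => rw [hc] at h1; exact .inl (Res.of_none h1)
      | some w =>
        have hw : G.star v s = some w := by rw [star_of_none hx, hc]
        exact key w hw (ih1 (hG.edge_live ⟨hv, hw⟩) hc.symm)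

/-- A search for `k` below a live node on the side where `k` does not belong finds nothing. -/
theorem res_child_false {y : ℕ} {s : Side} (hy : y ∈ G.live) (hv : G.virt y s = none)
    (hk : ¬ s.Of k (G.key y)) : G.Res k false (G.child y s) := by
  cases hc : G.child y s with
  | none => exact res_none
  | some v =>
    have he := hG.edge_of_child hy hv hc
    obtain ⟨b, hb⟩ := hG.outcome k (hG.edge_live he)
    rcases hG.eq_false_or_exists_desc (hG.edge_live he) hb with rfl | ⟨n, h1, h2⟩
    · exact hb
    · exact (hk (h2 ▸ hG.order he h1)).elim

end Inv

/-! ### Traversals -/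

/-- What a traversal for `k` that has reached `n` may rely on: the live nodes ahead are on the
search path from the root, and if the traversal ended at a node ahead, its answer would be one that
`P` allows. -/
def Good (G : Graph K) (k : K) (P : Bool → Prop) (n : ℕ) : Prop :=
  ∀ m, G.Path k n m → (m ∈ G.live → G.Path k root m) ∧ (G.key m = k → P (!G.del m)) ∧
    ∀ s : Side, s.Of k (G.key m) → G.child m s = none → P false

theorem Good.step {P : Bool → Prop} {n m : ℕ} (h : G.Good k P n) (hs : G.PStep k n m) :
    G.Good k P m :=
  fun a ha => h a (.head hs ha)

theorem Good.mono {P Q : Bool → Prop} {n : ℕ} (h : G.Good k P n) (hPQ : ∀ b, P b → Q b) :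
    G.Good k Q n :=
  fun a ha => ⟨(h a ha).1, fun e => hPQ _ ((h a ha).2.1 e), fun s hs e => hPQ _ ((h a ha).2.2 s hs e)⟩

/-- A traversal that is on the search path from the root will give the present answer. -/
theorem Inv.good_of_path (hG : G.Inv) {P : Bool → Prop} {n : ℕ} (hn : G.Path k root n)
    (hP : ∀ b, G.Res k b (some root) → P b) : G.Good k P n := by
  intro m hm
  have hm := hn.trans hm
  obtain ⟨b, hb⟩ := hG.outcome k hG.root_live
  have h1 := hb.along (Path.gen hm)
  refine ⟨fun _ => hm, fun e => ?_, fun s hs e => ?_⟩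
  · rw [← h1.eq_del e]; exact hP b hb
  · have := h1.child hs
    rw [e] at this
    rw [← this.of_none]; exact hP b hb

/-- A traversal inside a closed set `A` survives a change of the pointers or the flag of a single
live node `w`. -/
theorem Good.transfer {P : Bool → Prop} {n w : ℕ} (A : Set ℕ) (h : G.Good k P n) (hG' : G'.Inv)
    (hP : ∀ b, G'.Res k b (some root) → P b) (hw : w ∈ G.live) (hw' : w ∈ G'.live)
    (hA : ∀ m s m', m ∈ A → G.child m s = some m' → m' ∈ A) (hn : n ∈ A)
    (hsame : ∀ m ∈ A, m ≠ w →
      G'.key m = G.key m ∧ G'.child m = G.child m ∧ G'.del m = G.del m)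
    (hlive : ∀ m ∈ A, m ∈ G'.live → m ∈ G.live)
    (hroot : ∀ m, m ∈ G.live → m ∈ G'.live → G.Path k root m → G'.Path k root m) :
    G'.Good k P n := by
  intro m hm
  -- a path that passes `w` is from there on part of the search path from the root
  have key : ∀ m, G'.Path k n m → (G.Path k n m ∧ m ∈ A ∧ m ≠ w) ∨ G'.Path k root m := by
    intro m hm
    induction hm with
    | refl =>
      by_cases e : n = w
      · subst e; exact .inr (hroot n hw hw' ((h n .refl).1 hw))
      · exact .inl ⟨.refl, hn, e⟩
    | @tail a b hab hs ih =>
      rcases ih with ⟨h1, h2, h3⟩ | h1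
      · obtain ⟨s, hs, hc⟩ := hs
        rw [(hsame a h2 h3).1] at hs
        rw [(hsame a h2 h3).2.1] at hc
        have hb := h1.tail ⟨s, hs, hc⟩
        by_cases e : b = w
        · subst e; exact .inr (hroot b hw hw' ((h b hb).1 hw))
        · exact .inl ⟨hb, hA a s b h2 hc, e⟩
      · exact .inr (h1.tail hs)
  rcases key m hm with ⟨h1, h2, h3⟩ | h1
  · obtain ⟨e1, e2, e3⟩ := hsame m h2 h3
    obtain ⟨g1, g2, g3⟩ := h m h1
    refine ⟨fun hl => hroot m (hlive m h2 hl) hl (g1 (hlive m h2 hl)), ?_, ?_⟩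
    · rw [e1, e3]; exact g2
    · rw [e1, e2]; exact g3
  · exact hG'.good_of_path h1 hP m .refl

/-! ### Changing the flag of a node -/

/-- Searches that come to `n` all come there, and give the new answer. -/
theorem exists_res_setDel {n : ℕ} {d : Bool} {k₀ : K} (hG : G.Inv) (hn : n ∈ G.live)
    (hk : G.key n = k₀) (hp : G.Path k₀ root n) {v : ℕ} (hv : v ∈ G.live) :
    ∃ b, ({ G with del := Function.update G.del n d } : Graph K).Res k b (some v) := by
  by_cases hg : G.Gen k v n ∧ k = k₀
  · obtain ⟨hg, rfl⟩ := hg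
    refine ⟨!d, Inev.bind (P := fun o => o = some n)
      (Inev.frame (hG.hits_of_gen hn hp hv hg) (fun _ _ _ _ => ⟨rfl, rfl, rfl⟩)
        (fun _ _ _ _ h => h) (fun h => h)) ?_⟩
    rintro _ rfl
    exact .now (.inr ⟨n, rfl, hk, by simp⟩)
  · obtain ⟨b, hb⟩ := hG.outcome k hv
    refine ⟨b, Inev.frame hb (fun _ _ _ _ => ⟨rfl, rfl, rfl⟩) ?_ ?_⟩
    · rintro u m hu hm (⟨h, -⟩ | ⟨m', h, h1, h2⟩)
      · cases h
      · cases h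
        cases hu
        refine .inr ⟨m, rfl, h1, ?_⟩
        have : m ≠ n := by
          rintro rfl
          exact hg ⟨hm, WithTop.coe_injective (h1.symm.trans hk)⟩
        simpa [this] using h2
    · rintro (⟨-, h⟩ | ⟨m', h, -⟩)
      · exact .inl ⟨rfl, h⟩
      · cases h

/-- Writing the flag of a live node with key `k₀` that lies on the search path for `k₀`. -/
theorem Inv.setDel {n : ℕ} {d : Bool} {k₀ : K} (hG : G.Inv) (hn : n ∈ G.live)
    (hk : G.key n = k₀) (hp : G.Path k₀ root n) :
    ({ G with del := Function.update G.del n d } : Graph K).Inv where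
  root_live := hG.root_live
  root_edge := hG.root_edge
  edge_live := hG.edge_live
  edge_inj := hG.edge_inj
  order := hG.order
  virt_live := hG.virt_live
  star_of_gen := hG.star_of_gen
  hits_of_path hv hn h := Inev.frame (hG.hits_of_path hv hn h) (fun _ _ _ _ => ⟨rfl, rfl, rfl⟩)
        (fun _ _ _ _ h => h) (fun h => h)
  outcome _ _ hv := exists_res_setDel hG hn hk hp hv

theorem Good.setDel {n : ℕ} {d : Bool} {k₀ : K} (hG : G.Inv) (hn : n ∈ G.live)
    (hk : G.key n = k₀) (hp : G.Path k₀ root n) {P : Bool → Prop} {a : ℕ} (h : G.Good k P a)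
    (hP : ∀ b, ({ G with del := Function.update G.del n d } : Graph K).Res k b (some root) → P b) :
    ({ G with del := Function.update G.del n d } : Graph K).Good k P a := by
  intro m hm
  obtain ⟨g1, g2, g3⟩ := h m hm
  by_cases e : m = n
  · subst e
    exact (hG.setDel hn hk hp).good_of_path (g1 hn) hP m .refl
  · exact ⟨g1, fun e' => by simpa [e] using g2 e', g3⟩

theorem Res.setDel_of_ne {n : ℕ} {d : Bool} {k₀ : K} {b : Bool} {o : Option ℕ}
    (hk : G.key n = k₀) (hne : k ≠ k₀) (h : G.Res k b o) :
    ({ G with del := Function.update G.del n d } : Graph K).Res k b o := by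
  refine Inev.frame h (fun _ _ _ _ => ⟨rfl, rfl, rfl⟩) ?_ ?_
  · rintro u m hu hm (⟨h, -⟩ | ⟨m', h, h1, h2⟩)
    · cases h
    · cases h
      refine .inr ⟨m, rfl, h1, ?_⟩
      have : m ≠ n := by
        rintro rfl
        exact hne (WithTop.coe_injective (h1.symm.trans hk))
      simpa [this] using h2
  · rintro (⟨-, h⟩ | ⟨m', h, -⟩)
    · exact .inl ⟨rfl, h⟩
    · cases h

theorem Res.setDel_self {n : ℕ} {d : Bool} {k₀ : K} (hG : G.Inv) (hn : n ∈ G.live)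
    (hk : G.key n = k₀) (hp : G.Path k₀ root n) :
    ({ G with del := Function.update G.del n d } : Graph K).Res k₀ (!d) (some root) := by
  obtain ⟨b, hb⟩ := (hG.setDel (d := d) hn hk hp).outcome k₀ hG.root_live
  have h1 := hb.along (Path.gen hp)
  have h2 := h1.eq_del hk
  have : b = !d := by simpa using h2
  rwa [← this]

/-! ### Adding a leaf -/

/-- `G'` arises from `G` by adding the new leaf `z` with key `k₀` as the child of `x` on side `s`. -/
structure AddLeaf (G G' : Graph K) (k₀ : K) (s : Side) (x z : ℕ) : Prop where
  live_x : x ∈ G.live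
  virt_x : G.virt x s = none
  child_x : G.child x s = none
  of_x : s.Of k₀ (G.key x)
  not_live : z ∉ G.live
  child_ne : ∀ m t, G.child m t ≠ some z
  virt_ne : ∀ m t, G.virt m t ≠ some z
  key_z : G'.key z = k₀
  del_z : G'.del z = false
  child_z : ∀ t, G'.child z t = none
  key' : ∀ m, m ≠ z → G'.key m = G.key m
  del' : ∀ m, m ≠ z → G'.del m = G.del m
  child_x' : G'.child x s = some z
  child' : ∀ m t, m ≠ z → ¬ (m = x ∧ t = s) → G'.child m t = G.child m t
  live' : G'.live = insert z G.live
  virt' : G'.virt = G.virt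

namespace AddLeaf

variable {k₀ : K} {s : Side} {x z : ℕ} (hG : G.Inv) (h : AddLeaf G G' k₀ s x z)
include hG h

theorem x_ne : x ≠ z := by
  rintro rfl; exact h.not_live h.live_x

theorem virt_z (t : Side) : G.virt z t = none := by
  cases e : G.virt z t with
  | none => rfl
  | some y => exact (h.not_live (hG.virt_live e)).elim

theorem edge_iff {t : Side} {m n : ℕ} :
    G'.Edge t m n ↔ (G.Edge t m n ∧ m ≠ z ∧ n ≠ z) ∨ (m = x ∧ t = s ∧ n = z) := by
  have hx := h.x_ne hG
  unfold Edge star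
  rw [h.live', h.virt']
  constructor
  · rintro ⟨h1, h2⟩
    by_cases hm : m = z
    · subst hm; rw [h.child_z, h.virt_z hG] at h2; cases h2
    · by_cases e : m = x ∧ t = s
      · obtain ⟨rfl, rfl⟩ := e
        rw [h.virt_x, h.child_x'] at h2
        cases h2; exact .inr ⟨rfl, rfl, rfl⟩
      · rw [h.child' m t hm e] at h2
        refine .inl ⟨⟨h1.resolve_left hm, h2⟩, hm, ?_⟩
        rintro rfl
        exact h.not_live (hG.edge_live ⟨h1.resolve_left hm, h2⟩)
  · rintro (⟨⟨h1, h2⟩, hm, hn⟩ | ⟨rfl, rfl, rfl⟩)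
    · refine ⟨.inr h1, ?_⟩
      by_cases e : m = x ∧ t = s
      · obtain ⟨rfl, rfl⟩ := e
        rw [h.virt_x, h.child_x] at h2; cases h2
      · rwa [h.child' m t hm e]
    · exact ⟨.inr h.live_x, by rw [h.virt_x, h.child_x']; rfl⟩

theorem gstep {m n : ℕ} (hs : G'.GStep k m n) :
    m ≠ z ∧ (G.GStep k m n ∧ n ≠ z ∨ m = x ∧ n = z ∧ s.Of k (G.key x)) := by
  obtain ⟨t, ht, hn⟩ := hs
  rw [h.virt'] at hn
  have hm : m ≠ z := by
    rintro rfl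
    rw [h.child_z, h.virt_z hG] at hn
    rcases hn with hn | hn <;> cases hn
  rw [h.key' m hm] at ht
  refine ⟨hm, ?_⟩
  by_cases e : m = x ∧ t = s
  · obtain ⟨rfl, rfl⟩ := e
    rw [h.virt_x, h.child_x'] at hn
    rcases hn with hn | hn <;> cases hn
    exact .inr ⟨rfl, rfl, ht⟩
  · rw [h.child' m t hm e] at hn
    refine .inl ⟨⟨t, ht, hn⟩, ?_⟩
    rintro rfl
    exact hn.elim (h.child_ne _ _) (h.virt_ne _ _)

theorem pstep {m n : ℕ} (hs : G'.PStep k m n) :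
    m ≠ z ∧ (G.PStep k m n ∧ n ≠ z ∨ m = x ∧ n = z ∧ s.Of k (G.key x)) := by
  obtain ⟨t, ht, hn⟩ := hs
  have hm : m ≠ z := by
    rintro rfl
    rw [h.child_z] at hn
    cases hn
  rw [h.key' m hm] at ht
  refine ⟨hm, ?_⟩
  by_cases e : m = x ∧ t = s
  · obtain ⟨rfl, rfl⟩ := e
    rw [h.child_x'] at hn
    cases hn
    exact .inr ⟨rfl, rfl, ht⟩
  · rw [h.child' m t hm e] at hn
    refine .inl ⟨⟨t, ht, hn⟩, ?_⟩
    rintro rfl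
    exact h.child_ne _ _ hn

omit [LinearOrder K] hG h in
/-- A path in a graph with the new leaf `z` either avoids `z` or ends with the edge from `x` to `z`. -/
theorem reach_leaf {r r' : ℕ → ℕ → Prop} {c : Prop}
    (h : ∀ m n, r' m n → m ≠ z ∧ (r m n ∧ n ≠ z ∨ m = x ∧ n = z ∧ c)) {v n : ℕ} (hv : v ≠ z)
    (hr : ReflTransGen r' v n) :
    (n ≠ z ∧ ReflTransGen r v n) ∨ (n = z ∧ ReflTransGen r v x ∧ c) := by
  induction hr with
  | refl => exact .inl ⟨hv, .refl⟩
  | @tail a b h1 h2 ih =>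
    obtain ⟨ha, h2⟩ := h _ _ h2
    rcases ih with ⟨-, ih⟩ | ⟨e, -⟩
    · rcases h2 with ⟨h2, hb⟩ | ⟨rfl, hb, hc⟩
      · exact .inl ⟨hb, ih.tail h2⟩
      · exact .inr ⟨hb, ih, hc⟩
    · exact (ha e).elim

/-- A search in the extended graph behaves as before, except that it may come to `z` where it ended at a
null pointer. -/
theorem inev {P Q : Option ℕ → Prop} {o : Option ℕ} (ho : o ≠ some z) (hi : G.Inev k P o)
    (hz : P none → s.Of k (G.key x) → G'.Inev k Q (some z))
    (hPQ : ∀ o, o ≠ some z → P o → Q o) : G'.Inev k Q o := by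
  induction hi with
  | now hp => exact .now (hPQ _ ho hp)
  | @step m t ht h1 h2 ih1 ih2 =>
    have hm : m ≠ z := fun e => ho (e ▸ rfl)
    refine .step (s := t) (by rwa [h.key' m hm]) ?_ ?_
    · by_cases e : m = x ∧ t = s
      · obtain ⟨rfl, rfl⟩ := e
        rw [h.child_x']
        rw [h.child_x] at h1
        cases h1 with | now h1 => exact hz h1 ht
      · rw [h.child' m t hm e]
        exact ih1 (h.child_ne _ _)
    · intro y hy
      rw [h.virt'] at hy
      exact ih2 y hy (hy ▸ h.virt_ne m t)

theorem hits {n v : ℕ} (hv : v ≠ z) (hi : G.Hits k n v) : G'.Hits k n v :=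
  h.inev hG (by simpa using hv) hi (fun e => by cases e) (fun _ _ e => e)

theorem path {v n : ℕ} (hv : v ∈ G.live) (hn : n ∈ G.live) (hp : G.Path k v n) : G'.Path k v n :=
  (h.hits hG (by rintro rfl; exact h.not_live hv) (hG.hits_of_path hv hn hp)).path

theorem res_of_ne {v : ℕ} {b : Bool} (hv : v ≠ z) (hk : k ≠ k₀) (hi : G.Res k b (some v)) :
    G'.Res k b (some v) := by
  refine h.inev hG (by simpa using hv) hi ?_ ?_
  · rintro (⟨-, rfl⟩ | ⟨m, e, -⟩) ht
    · obtain ⟨t, ht⟩ := Side.exists_of (a := (k : WithTop K)) (b := G'.key z)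
        (by rw [h.key_z]; simpa using hk)
      refine .step' ht (by rw [h.virt', h.virt_z hG]) ?_
      rw [h.child_z]; exact res_none
    · cases e
  · rintro o ho (⟨rfl, rfl⟩ | ⟨m, rfl, e1, e2⟩)
    · exact .inl ⟨rfl, rfl⟩
    · have hm : m ≠ z := by simpa using ho
      exact .inr ⟨m, rfl, by rw [h.key' m hm, e1], by rw [h.del' m hm, e2]⟩

theorem res_leaf : G'.Res k₀ true (some z) :=
  .now (.inr ⟨z, rfl, h.key_z, by rw [h.del_z]; rfl⟩)

theorem res_of_hits {v : ℕ} (hv : v ≠ z) (hi : G.Hits k₀ x v) : G'.Res k₀ true (some v) := by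
  refine (h.hits hG hv hi).bind ?_
  rintro _ rfl
  refine .step' (s := s) ?_ ?_ ?_
  · rw [h.key' _ (h.x_ne hG)]; exact h.of_x
  · rw [h.virt', h.virt_x]
  · rw [h.child_x']; exact h.res_leaf hG

theorem outcome (hp : G.Path k₀ root x) {v : ℕ} (hv : v ∈ G'.live) : ∃ b, G'.Res k b (some v) := by
  rw [h.live'] at hv
  rcases hv with rfl | hv
  · by_cases hk : k = k₀
    · subst hk; exact ⟨true, h.res_leaf hG⟩
    · obtain ⟨t, ht⟩ := Side.exists_of (a := (k : WithTop K)) (b := G'.key v)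
        (by rw [h.key_z]; simpa using hk)
      refine ⟨false, .step' ht (by rw [h.virt', h.virt_z hG]) ?_⟩
      rw [h.child_z]; exact res_none
  · have hvz : v ≠ z := by rintro rfl; exact h.not_live hv
    by_cases hk : k = k₀
    · subst hk
      by_cases hg : G.Gen k v x
      · exact ⟨true, h.res_of_hits hG hvz (hG.hits_of_gen h.live_x hp hv hg)⟩
      -- a search that cannot meet `x` does not meet `z` either
      · obtain ⟨b, hb⟩ := hG.outcome k hv
        have hne : ∀ m, G.Gen k v m → m ≠ z ∧ m ≠ x := by
          refine fun m hm => ⟨?_, fun e => hg (e ▸ hm)⟩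
          rintro rfl
          rcases hm.cases_tail with e | ⟨a, -, t, -, e | e⟩
          · exact hvz e.symm
          · exact h.child_ne _ _ e
          · exact h.virt_ne _ _ e
        refine ⟨b, Inev.frame hb ?_ ?_ ?_⟩
        · rintro u m ⟨⟩ hm
          obtain ⟨h1, h2⟩ := hne m hm
          refine ⟨h.key' m h1, funext fun t => h.child' m t h1 (fun e => h2 e.1), by rw [h.virt']⟩
        · rintro u m ⟨⟩ hm (⟨e, -⟩ | ⟨m', e, e1, e2⟩)
          · cases e
          · cases e
            obtain ⟨h1, h2⟩ := hne m hm
            exact .inr ⟨m, rfl, by rw [h.key' m h1, e1], by rw [h.del' m h1, e2]⟩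
        · rintro (⟨-, e⟩ | ⟨m', e, -⟩)
          · exact .inl ⟨rfl, e⟩
          · cases e
    · obtain ⟨b, hb⟩ := hG.outcome k hv
      exact ⟨b, h.res_of_ne hG hvz hk hb⟩

theorem inv (hp : G.Path k₀ root x) : G'.Inv := by
  have hxz := h.x_ne hG
  have hlz : ∀ {v}, v ∈ G.live → v ≠ z := fun hv e => h.not_live (e ▸ hv)
  have fromz : ∀ {k n}, G'.Gen k z n → n = z := by
    intro k n hn
    rcases hn.cases_head with e | ⟨a, ha, -⟩
    · exact e.symm
    · exact ((h.gstep hG ha).1 rfl).elim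
  refine ⟨?_, ?_, ?_, ?_, ?_, ?_, ?_, ?_, fun k v hv => h.outcome hG hp hv⟩
  · rw [h.live']; exact .inr hG.root_live
  · intro t m he
    rcases (h.edge_iff hG).1 he with ⟨he, -⟩ | ⟨-, -, e⟩
    · exact hG.root_edge he
    · exact h.not_live (e ▸ hG.root_live)
  · intro t m n he
    rw [h.live']
    rcases (h.edge_iff hG).1 he with ⟨he, -⟩ | ⟨-, -, e⟩
    · exact .inr (hG.edge_live he)
    · exact .inl e
  · intro t m t' m' n he he'
    rcases (h.edge_iff hG).1 he with ⟨he, -, h1⟩ | ⟨e1, e2, e3⟩ <;>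
      rcases (h.edge_iff hG).1 he' with ⟨he', -, h1'⟩ | ⟨e1', e2', e3'⟩
    · exact hG.edge_inj he he'
    · exact (h1 e3').elim
    · exact (h1' e3).elim
    · exact ⟨e1.trans e1'.symm, e2.trans e2'.symm⟩
  · intro t m n n' he hd
    have hstep : ∀ a b, (∃ s, G'.Edge s a b) →
        a ≠ z ∧ ((∃ s, G.Edge s a b) ∧ b ≠ z ∨ a = x ∧ b = z ∧ True) := by
      rintro a b ⟨t, he⟩
      rcases (h.edge_iff hG).1 he with ⟨he, h1, h2⟩ | ⟨e1, e2, e3⟩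
      · exact ⟨h1, .inl ⟨⟨t, he⟩, h2⟩⟩
      · exact ⟨e1 ▸ hxz, .inr ⟨e1, e3, trivial⟩⟩
    rcases (h.edge_iff hG).1 he with ⟨he, h1, h2⟩ | ⟨rfl, rfl, rfl⟩
    · rw [h.key' m h1]
      rcases reach_leaf hstep h2 hd with ⟨hn', hd⟩ | ⟨rfl, hd, -⟩
      · rw [h.key' _ hn']; exact hG.order he hd
      · rw [h.key_z]
        exact hG.of_star_root (hG.star_of_gen hG.root_live h.live_x (Path.gen hp)) he hd
    · have : n' = n := by
        rcases hd.cases_head with e | ⟨a, ha, -⟩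
        · exact e.symm
        · exact ((hstep _ _ ha).1 rfl).elim
      subst this
      rw [h.key_z, h.key' _ hxz]; exact h.of_x
  · intro m t y hy
    rw [h.virt'] at hy
    rw [h.live']; exact .inr (hG.virt_live hy)
  · intro k v n hv hn hg
    rw [h.live'] at hv
    have hstar : ∀ {v n}, v ≠ z → G.Star k v n → G'.Star k v n := by
      intro v n hv hs
      induction hs with
      | refl => exact .refl
      | @tail a b h1 h2 ih =>
        obtain ⟨t, ht, he⟩ := h2
        refine ih.tail ⟨t, ?_, (h.edge_iff hG).2 (.inl ⟨he, hlz he.1, hlz (hG.edge_live he)⟩)⟩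
        rwa [h.key' a (hlz he.1)]
    rcases hv with rfl | hv
    · rw [fromz hg]
    · rcases reach_leaf (fun m n => h.gstep hG) (hlz hv) hg with ⟨h1, hg⟩ | ⟨rfl, hg, hc⟩
      · rw [h.live'] at hn
        exact hstar (hlz hv) (hG.star_of_gen hv (hn.resolve_left h1) hg)
      · refine (hstar (hlz hv) (hG.star_of_gen hv h.live_x hg)).tail
          ⟨s, ?_, (h.edge_iff hG).2 (.inr ⟨rfl, rfl, rfl⟩)⟩
        rwa [h.key' _ hxz]
  · intro k v n hv hn hg
    rw [h.live'] at hv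
    rcases hv with rfl | hv
    · rw [fromz (Path.gen hg)]; exact .now rfl
    · rcases reach_leaf (fun m n => h.pstep hG) (hlz hv) hg with ⟨h1, hg⟩ | ⟨rfl, hg, hc⟩
      · rw [h.live'] at hn
        exact h.hits hG (hlz hv) (hG.hits_of_path hv (hn.resolve_left h1) hg)
      · refine (h.hits hG (hlz hv) (hG.hits_of_path hv h.live_x hg)).bind ?_
        rintro _ rfl
        refine .step' (s := s) ?_ ?_ ?_
        · rwa [h.key' _ hxz]
        · rw [h.virt', h.virt_x]
        · rw [h.child_x']; exact .now rfl

theorem good (hp : G.Path k₀ root x) {P : Bool → Prop} {n : ℕ} (hg : G.Good k P n) (hn : n ≠ z)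
    (hP : ∀ b, G'.Res k b (some root) → P b) : G'.Good k P n := by
  refine hg.transfer (w := x) {m | m ≠ z} (h.inv hG hp) hP h.live_x ?_
    (fun m t _ _ e e' => h.child_ne m t (e' ▸ e)) hn ?_ ?_ ?_
  · rw [h.live']; exact .inr h.live_x
  · exact fun m h2 h1 => ⟨h.key' m h2, funext fun t => h.child' m t h2 (fun e => h1 e.1), h.del' m h2⟩
  · intro m hm hl
    rw [h.live'] at hl
    exact hl.resolve_left hm
  · exact fun m hm _ hpm => h.path hG hG.root_live hm hpm

theorem res_root_of_ne {b : Bool} (hk : k ≠ k₀) (hi : G.Res k b (some root)) :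
    G'.Res k b (some root) :=
  h.res_of_ne hG (fun e => h.not_live (e ▸ hG.root_live)) hk hi

theorem res_root (hp : G.Path k₀ root x) : G'.Res k₀ true (some root) :=
  h.res_of_hits hG (fun e => h.not_live (e ▸ hG.root_live)) (hG.hits_of_path hG.root_live h.live_x hp)

end AddLeaf

/-! ### Turning a virtual edge into a pointer -/

/-- `G'` arises from `G` by the write that the virtual edge from `p` to `x` announces. -/
structure Commit (G G' : Graph K) (c : Side) (p x : ℕ) : Prop where
  virt_p : G.virt p c = some x
  key' : G'.key = G.key
  del' : G'.del = G.del
  live' : G'.live = G.live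
  child_p' : G'.child p c = some x
  child' : ∀ m t, ¬ (m = p ∧ t = c) → G'.child m t = G.child m t
  virt_p' : G'.virt p c = none
  virt' : ∀ m t, ¬ (m = p ∧ t = c) → G'.virt m t = G.virt m t

namespace Commit

variable {c : Side} {p x : ℕ} (hG : G.Inv) (h : Commit G G' c p x)
include hG h

theorem edge_iff {t : Side} {m n : ℕ} : G'.Edge t m n ↔ G.Edge t m n := by
  unfold Edge star
  rw [h.live']
  by_cases e : m = p ∧ t = c
  · obtain ⟨rfl, rfl⟩ := e
    rw [h.virt_p, h.virt_p', h.child_p']; rfl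
  · rw [h.child' m t e, h.virt' m t e]

theorem gstep {m n : ℕ} (hs : G'.GStep k m n) : G.GStep k m n := by
  obtain ⟨t, ht, hn⟩ := hs
  rw [h.key'] at ht
  refine ⟨t, ht, ?_⟩
  by_cases e : m = p ∧ t = c
  · obtain ⟨rfl, rfl⟩ := e
    rw [h.virt_p', h.child_p'] at hn
    rw [h.virt_p]
    rcases hn with hn | hn
    · exact .inr hn
    · cases hn
  · rwa [h.child' m t e, h.virt' m t e] at hn

theorem inev {P : Option ℕ → Prop} {o : Option ℕ} (hi : G.Inev k P o) : G'.Inev k P o := by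
  induction hi with
  | now hp => exact .now hp
  | @step m t ht h1 h2 ih1 ih2 =>
    refine .step (s := t) (by rwa [h.key']) ?_ ?_
    · by_cases e : m = p ∧ t = c
      · obtain ⟨rfl, rfl⟩ := e
        rw [h.child_p']; exact ih2 x h.virt_p
      · rwa [h.child' m t e]
    · intro y hy
      by_cases e : m = p ∧ t = c
      · obtain ⟨rfl, rfl⟩ := e
        rw [h.virt_p'] at hy; cases hy
      · rw [h.virt' m t e] at hy; exact ih2 y hy

theorem fin_eq {b : Bool} : G'.Fin k b = G.Fin k b := by
  unfold Fin; rw [h.key', h.del']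

theorem res {b : Bool} {o : Option ℕ} (hi : G.Res k b o) : G'.Res k b o := by
  have := h.inev hG hi
  rwa [← h.fin_eq hG] at this

theorem edge_p : G.Edge c p x := ⟨hG.virt_live h.virt_p, star_of_virt h.virt_p⟩

/-- A path in the new memory uses the new pointer or existed before. -/
theorem path_split {v n : ℕ} (hp : G'.Path k v n) :
    G.Path k v n ∨ (G.Path k v p ∧ c.Of k (G.key p) ∧ G'.Path k x n) := by
  induction hp using ReflTransGen.head_induction_on with
  | refl => exact .inl .refl
  | @head a b hs hp ih =>
    obtain ⟨t, ht, hb⟩ := hs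
    rw [h.key'] at ht
    by_cases e : a = p ∧ t = c
    · obtain ⟨rfl, rfl⟩ := e
      rw [h.child_p'] at hb
      cases hb
      exact .inr ⟨.refl, ht, hp⟩
    · rw [h.child' a t e] at hb
      rcases ih with ih | ⟨h1, h2⟩
      · exact .inl (.head ⟨t, ht, hb⟩ ih)
      · exact .inr ⟨.head ⟨t, ht, hb⟩ h1, h2⟩

theorem inv : G'.Inv := by
  have hE : G'.Edge = G.Edge := by
    funext t m n; exact propext (h.edge_iff hG)
  have hD : G'.Desc = G.Desc := by unfold Desc; rw [hE]
  have hS : ∀ k, G'.Star k = G.Star k := by intro k; unfold Star SStep; rw [hE, h.key']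
  refine ⟨?_, ?_, ?_, ?_, ?_, ?_, ?_, ?_, ?_⟩
  · rw [h.live']; exact hG.root_live
  · rw [hE]; exact hG.root_edge
  · rw [hE, h.live']; exact hG.edge_live
  · rw [hE]; exact hG.edge_inj
  · rw [hE, hD, h.key']; exact hG.order
  · intro m t y hy
    rw [h.live']
    by_cases e : m = p ∧ t = c
    · obtain ⟨rfl, rfl⟩ := e
      rw [h.virt_p'] at hy; cases hy
    · rw [h.virt' m t e] at hy; exact hG.virt_live hy
  · intro k v n hv hn hg
    rw [h.live'] at hv hn
    rw [hS]
    exact hG.star_of_gen hv hn (ReflTransGen.mono (fun _ _ => h.gstep hG) _ _ hg)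
  · intro k v n hv hn hp
    rw [h.live'] at hv hn
    rcases h.path_split hG hp with hp | ⟨h1, h2, h3⟩
    · exact h.inev hG (hG.hits_of_path hv hn hp)
    · refine (h.inev hG (hG.hits_of_path hv (hG.virt_live h.virt_p) h1)).bind ?_
      rintro _ rfl
      have hx := hG.edge_live (h.edge_p hG)
      have h4 : G.Path k x n := by
        rcases h.path_split hG h3 with h4 | ⟨h4, -⟩
        · exact h4
        · have := hG.star_of_gen hx (hG.virt_live h.virt_p) (Path.gen h4)
          exact (hG.not_edge_desc (h.edge_p hG) (Star.desc this)).elim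
      refine .step' (s := c) (by rwa [h.key']) h.virt_p' ?_
      rw [h.child_p']
      exact h.inev hG (hG.hits_of_path hx hn h4)
  · intro k v hv
    rw [h.live'] at hv
    obtain ⟨b, hb⟩ := hG.outcome k hv
    exact ⟨b, h.res hG hb⟩

theorem good {P : Bool → Prop} {n : ℕ} (hg : G.Good k P n)
    (hP : ∀ b, G'.Res k b (some root) → P b) : G'.Good k P n := by
  refine hg.transfer (w := p) Set.univ (h.inv hG) hP (hG.virt_live h.virt_p) ?_
    (fun _ _ _ _ _ => trivial) trivial ?_ ?_ ?_
  · rw [h.live']; exact hG.virt_live h.virt_p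
  · exact fun m _ h1 => ⟨by rw [h.key'], funext fun t => h.child' m t (fun e => h1 e.1), by rw [h.del']⟩
  · intro m _ hl
    rwa [h.live'] at hl
  · exact fun m hm _ hpm => Hits.path (h.inev hG (hG.hits_of_path hG.root_live hm hpm))

end Commit

/-! ### Unlinking a node -/

/-- `G'` arises from `G` by unlinking the deleted node `y`, which has no child on side `e`, from its
parent `z`. -/
structure Unlink (G G' : Graph K) (s e : Side) (z y : ℕ) : Prop where
  live_z : z ∈ G.live
  live_y : y ∈ G.live
  ne : y ≠ z
  child_z : G.child z s = some y
  virt_z : G.virt z s = none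
  virt_y : ∀ t, G.virt y t = none
  child_y : G.child y e = none
  del_y : G.del y = true
  key' : G'.key = G.key
  del' : G'.del = G.del
  live' : G'.live = G.live \ {y}
  child_z' : G'.child z s = G.child y e.flip
  child' : ∀ m t, ¬ (m = z ∧ t = s) → G'.child m t = G.child m t
  virt' : G'.virt = G.virt

namespace Unlink

variable {s e : Side} {z y : ℕ} (hG : G.Inv) (h : Unlink G G' s e z y)
include hG h

theorem edge_zy : G.Edge s z y := hG.edge_of_child h.live_z h.virt_z h.child_z

theorem edge_y {t : Side} {n : ℕ} (he : G.Edge t y n) : t = e.flip ∧ G.child y e.flip = some n := by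
  obtain ⟨-, hn⟩ := he
  rw [star_of_none (h.virt_y t)] at hn
  rcases t.eq_or_eq_flip e with rfl | rfl
  · rw [h.child_y] at hn; cases hn
  · exact ⟨rfl, hn⟩

theorem edge_iff {t : Side} {m n : ℕ} :
    G'.Edge t m n ↔ (G.Edge t m n ∧ m ≠ y ∧ n ≠ y) ∨ (m = z ∧ t = s ∧ G.Edge e.flip y n) := by
  unfold Edge
  rw [h.live']
  by_cases e' : m = z ∧ t = s
  · obtain ⟨rfl, rfl⟩ := e'
    rw [star_of_none (G := G') (by rw [h.virt', h.virt_z]), h.child_z', star_of_none h.virt_z,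
      h.child_z, star_of_none (h.virt_y _)]
    have := h.ne
    constructor
    · rintro ⟨-, h1⟩; exact .inr ⟨rfl, rfl, h.live_y, h1⟩
    · rintro (⟨⟨-, h1⟩, -, h2⟩ | ⟨-, -, -, h1⟩)
      · cases h1; exact (h2 rfl).elim
      · exact ⟨⟨h.live_z, this.symm⟩, h1⟩
  · have : G'.star m t = G.star m t := by unfold star; rw [h.virt', h.child' m t e']
    rw [this]
    constructor
    · rintro ⟨⟨h1, h2⟩, h3⟩
      refine .inl ⟨⟨h1, h3⟩, h2, ?_⟩
      rintro rfl
      exact e' (hG.edge_inj ⟨h1, h3⟩ (h.edge_zy hG))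
    · rintro (⟨⟨h1, h2⟩, h3, -⟩ | ⟨h1, h2, -⟩)
      · exact ⟨⟨h1, h3⟩, h2⟩
      · exact (e' ⟨h1, h2⟩).elim

theorem desc {m n : ℕ} (hd : G'.Desc m n) : G.Desc m n := by
  induction hd with
  | refl => exact .refl
  | tail _ h2 ih =>
    obtain ⟨t, h2⟩ := h2
    rcases (h.edge_iff hG).1 h2 with ⟨h2, -⟩ | ⟨rfl, rfl, h2⟩
    · exact ih.tail ⟨t, h2⟩
    · exact (ih.tail ⟨_, h.edge_zy hG⟩).tail ⟨_, h2⟩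

/-- The subtrees of `G'` are contained in those of `G`. -/
theorem sdesc {t : Side} {m m' n : ℕ} (he : G'.Edge t m m') (hd : G'.Desc m' n) :
    ∃ m'', G.Edge t m m'' ∧ G.Desc m'' n := by
  rcases (h.edge_iff hG).1 he with ⟨he, -⟩ | ⟨rfl, rfl, he⟩
  · exact ⟨m', he, h.desc hG hd⟩
  · exact ⟨y, h.edge_zy hG, .head ⟨_, he⟩ (h.desc hG hd)⟩

/-- A search that starts below `y` does not come to the parent of `y`. -/
theorem child_not_gen {v : ℕ} (hv : G.child y e.flip = some v) : ¬ G.Gen k v z := by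
  intro hg
  have he := hG.edge_of_child h.live_y (h.virt_y _) hv
  have hs := hG.star_of_gen (hG.edge_live he) h.live_z hg
  exact hG.not_edge_desc he ((Star.desc hs).tail ⟨_, h.edge_zy hG⟩)

/-- A search that does not meet the parent of the unlinked node is not affected. -/
theorem frame {P : Option ℕ → Prop} {o : Option ℕ} (hi : G.Inev k P o)
    (ho : ∀ m, o = some m → ¬ G.Gen k m z) : G'.Inev k P o := by
  refine Inev.frame hi (fun u m hu hm => ⟨by rw [h.key'], funext fun t => h.child' m t ?_, by rw [h.virt']⟩)
    (fun _ _ _ _ h => h) (fun h => h)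
  rintro ⟨rfl, -⟩
  exact ho u hu hm

/-- A search that used to visit `y` now goes on at the remaining child of `y`.  This makes a difference
where it stopped at `y`, or at the null pointer on side `e` of `y`. -/
theorem inev {P : Option ℕ → Prop} {o : Option ℕ} (hi : G.Inev k P o)
    (hy : P (some y) → G'.Inev k P (G.child y e.flip))
    (hn : P none → e.Of k (G.key y) → G'.Inev k P (G.child y e.flip)) : G'.Inev k P o := by
  induction hi with
  | now hp => exact .now hp
  | @step m t ht h1 h2 ih1 ih2 =>
    refine .step (s := t) (by rwa [h.key']) ?_ (fun v hv => ih2 v (by rwa [h.virt'] at hv))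
    by_cases e' : m = z ∧ t = s
    · obtain ⟨rfl, rfl⟩ := e'
      rw [h.child_z']
      rw [h.child_z] at ih1
      cases ih1 with
      | now h3 => exact hy h3
      | @step _ t' ht' h3 _ =>
        rw [h.child' y t' (fun e => h.ne e.1)] at h3
        rw [h.key'] at ht'
        rcases t'.eq_or_eq_flip e with rfl | rfl
        · rw [h.child_y] at h3
          cases h3 with | now h3 => exact hn h3 ht'
        · exact h3
    · rwa [h.child' m t e']

theorem hits {n : ℕ} {o : Option ℕ} (hn : n ≠ y) (hi : G.Inev k (fun o => o = some n) o) :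
    G'.Inev k (fun o => o = some n) o :=
  h.inev hG hi (fun e => (hn (Option.some.inj e).symm).elim) (fun e => by cases e)

theorem fin_eq {b : Bool} : G'.Fin k b = G.Fin k b := by
  unfold Fin; rw [h.key', h.del']

theorem res {b : Bool} {o : Option ℕ} (hi : G.Res k b o) : G'.Res k b o := by
  -- keys that are not on the side of the remaining child are not found below it
  have hv : ¬ e.flip.Of k (G.key y) → G'.Inev k (G.Fin k false) (G.child y e.flip) := fun hk =>
    h.frame hG (hG.res_child_false h.live_y (h.virt_y _) hk) fun m hm => h.child_not_gen hG hm
  have := h.inev hG hi ?_ ?_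
  · rwa [← h.fin_eq hG] at this
  · rintro (⟨e, -⟩ | ⟨m, e, e1, e2⟩)
    · cases e
    · cases e
      rw [h.del_y] at e2
      subst e2
      exact hv fun hk => hk.ne e1.symm
  · rintro (⟨-, rfl⟩ | ⟨m, e, -⟩) hk
    · exact hv fun hk' => hk.asymm (Side.of_flip.1 hk')
    · cases e

/-- A path in the new graph uses the new pointer from `z` or existed before. -/
theorem step_split {r r' : ℕ → ℕ → Prop} {c : Prop} {v n : ℕ}
    (hr : ∀ a b, r' a b → r a b ∨ (a = z ∧ c ∧ G.child y e.flip = some b))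
    (hp : ReflTransGen r' v n) :
    ReflTransGen r v n ∨ (ReflTransGen r v z ∧ c ∧
      ∃ w, G.child y e.flip = some w ∧ ReflTransGen r' w n) := by
  induction hp using ReflTransGen.head_induction_on with
  | refl => exact .inl .refl
  | @head a b hs hp ih =>
    rcases hr a b hs with hs | ⟨rfl, hc, hb⟩
    · rcases ih with ih | ⟨h1, h2⟩
      · exact .inl (.head hs ih)
      · exact .inr ⟨.head hs h1, h2⟩
    · exact .inr ⟨.refl, hc, b, hb, hp⟩

theorem pstep {m n : ℕ} (hs : G'.PStep k m n) :
    G.PStep k m n ∨ (m = z ∧ s.Of k (G.key z) ∧ G.child y e.flip = some n) := by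
  obtain ⟨t, ht, hn⟩ := hs
  rw [h.key'] at ht
  by_cases e' : m = z ∧ t = s
  · obtain ⟨rfl, rfl⟩ := e'
    rw [h.child_z'] at hn
    exact .inr ⟨rfl, ht, hn⟩
  · rw [h.child' m t e'] at hn
    exact .inl ⟨t, ht, hn⟩

theorem gstep {m n : ℕ} (hs : G'.GStep k m n) :
    G.GStep k m n ∨ (m = z ∧ s.Of k (G.key z) ∧ G.child y e.flip = some n) := by
  obtain ⟨t, ht, hn⟩ := hs
  rw [h.key'] at ht
  rw [h.virt'] at hn
  by_cases e' : m = z ∧ t = s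
  · obtain ⟨rfl, rfl⟩ := e'
    rw [h.child_z', h.virt_z] at hn
    rcases hn with hn | hn
    · exact .inr ⟨rfl, ht, hn⟩
    · cases hn
  · rw [h.child' m t e'] at hn
    exact .inl ⟨t, ht, hn⟩

/-- The search paths of the logical tree bypass `y`. -/
theorem star {v n : ℕ} (hs : G.Star k v n) (hv : v ≠ y) :
    (n ≠ y → G'.Star k v n) ∧ (n = y → G'.Star k v z ∧ s.Of k (G.key z)) := by
  induction hs with
  | refl => exact ⟨fun _ => .refl, fun e => (hv e).elim⟩
  | @tail a b h1 h2 ih =>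
    obtain ⟨t, ht, he⟩ := h2
    constructor
    · intro hb
      by_cases ha : a = y
      · subst ha
        obtain ⟨rfl, -⟩ := h.edge_y hG he
        obtain ⟨h3, h4⟩ := ih.2 rfl
        exact h3.tail ⟨s, by rwa [h.key'], (h.edge_iff hG).2 (.inr ⟨rfl, rfl, he⟩)⟩
      · exact (ih.1 ha).tail ⟨t, by rwa [h.key'], (h.edge_iff hG).2 (.inl ⟨he, ha, hb⟩)⟩
    · rintro rfl
      obtain ⟨rfl, rfl⟩ := hG.edge_inj he (h.edge_zy hG)
      exact ⟨ih.1 h.ne.symm, ht⟩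

theorem inv : G'.Inv := by
  have hlive : ∀ {v}, v ∈ G'.live → v ∈ G.live ∧ v ≠ y := by
    intro v hv; rw [h.live'] at hv; exact hv
  have hchild : ∀ {w}, G.child y e.flip = some w → w ∈ G.live ∧ w ≠ y := by
    intro w hw
    have he := hG.edge_of_child h.live_y (h.virt_y _) hw
    refine ⟨hG.edge_live he, ?_⟩
    rintro rfl
    exact hG.not_edge_desc he .refl
  refine ⟨?_, ?_, ?_, ?_, ?_, ?_, ?_, ?_, ?_⟩
  · rw [h.live']
    refine ⟨hG.root_live, ?_⟩
    rintro rfl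
    exact hG.root_edge (h.edge_zy hG)
  · intro t m he
    obtain ⟨m'', h1, h2⟩ := h.sdesc hG he .refl
    rcases h2.cases_tail with h2 | ⟨a, -, t', h2⟩
    · subst h2; exact hG.root_edge h1
    · exact hG.root_edge h2
  · intro t m n he
    rw [h.live']
    rcases (h.edge_iff hG).1 he with ⟨he, -, h1⟩ | ⟨-, -, he⟩
    · exact ⟨hG.edge_live he, h1⟩
    · exact hchild (h.edge_y hG he).2
  · intro t m t' m' n he he'
    rcases (h.edge_iff hG).1 he with ⟨he, h1, -⟩ | ⟨e1, e2, he⟩ <;>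
      rcases (h.edge_iff hG).1 he' with ⟨he', h1', -⟩ | ⟨e1', e2', he'⟩
    · exact hG.edge_inj he he'
    · exact (h1 (hG.edge_inj he he').1).elim
    · exact (h1' (hG.edge_inj he' he).1).elim
    · exact ⟨e1.trans e1'.symm, e2.trans e2'.symm⟩
  · intro t m n n' he hd
    obtain ⟨m'', h1, h2⟩ := h.sdesc hG he hd
    rw [h.key']; exact hG.order h1 h2
  · intro m t v hv
    rw [h.virt'] at hv
    rw [h.live']
    refine ⟨hG.virt_live hv, ?_⟩
    rintro rfl
    rw [h.virt_y] at hv; cases hv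
  · intro k v n hv hn hg
    obtain ⟨hv, hvy⟩ := hlive hv
    obtain ⟨hn, hny⟩ := hlive hn
    rcases h.step_split hG (fun a b => h.gstep hG) hg with hg | ⟨hg, hk, w, hw, hg'⟩
    · exact (h.star hG (hG.star_of_gen hv hn hg) hvy).1 hny
    · have h1 := (h.star hG (hG.star_of_gen hv h.live_z hg) hvy).1 h.ne.symm
      have hg'' : G.Gen k w n := by
        rcases h.step_split hG (fun a b => h.gstep hG) hg' with hg | ⟨hg, -⟩
        · exact hg
        · exact (h.child_not_gen hG hw hg).elim
      have h2 := (h.star hG (hG.star_of_gen (hchild hw).1 hn hg'') (hchild hw).2).1 hny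
      refine (h1.tail ⟨s, by rwa [h.key'], (h.edge_iff hG).2 (.inr ⟨rfl, rfl, ?_⟩)⟩).trans h2
      exact hG.edge_of_child h.live_y (h.virt_y _) hw
  · intro k v n hv hn hg
    obtain ⟨hv, hvy⟩ := hlive hv
    obtain ⟨hn, hny⟩ := hlive hn
    rcases h.step_split hG (fun a b => h.pstep hG) hg with hg | ⟨hg, hk, w, hw, hg'⟩
    · exact h.hits hG hny (hG.hits_of_path hv hn hg)
    · refine (h.hits hG h.ne.symm (hG.hits_of_path hv h.live_z hg)).bind ?_
      rintro _ rfl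
      have hg'' : G.Path k w n := by
        rcases h.step_split hG (fun a b => h.pstep hG) hg' with hg | ⟨hg, -⟩
        · exact hg
        · exact (h.child_not_gen hG hw (Path.gen hg)).elim
      refine .step' (s := s) (by rwa [h.key']) (by rw [h.virt', h.virt_z]) ?_
      rw [h.child_z', hw]
      exact h.hits hG hny (hG.hits_of_path (hchild hw).1 hn hg'')
  · intro k v hv
    obtain ⟨b, hb⟩ := hG.outcome k (hlive hv).1
    exact ⟨b, h.res hG hb⟩

theorem good {P : Bool → Prop} {n : ℕ} (hg : G.Good k P n)
    (hP : ∀ b, G'.Res k b (some root) → P b) : G'.Good k P n := by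
  have hlive : ∀ {v}, v ∈ G'.live → v ∈ G.live ∧ v ≠ y := by
    intro v hv; rw [h.live'] at hv; exact hv
  refine hg.transfer (w := z) Set.univ (h.inv hG) hP h.live_z ?_
    (fun _ _ _ _ _ => trivial) trivial ?_ ?_ ?_
  · rw [h.live']; exact ⟨h.live_z, h.ne.symm⟩
  · exact fun m _ h1 => ⟨by rw [h.key'], funext fun t => h.child' m t (fun e => h1 e.1), by rw [h.del']⟩
  · exact fun m _ hl => (hlive hl).1
  · exact fun m hm hl hpm =>
      Hits.path (h.hits hG (hlive hl).2 (hG.hits_of_path hG.root_live hm hpm))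

end Unlink

/-! ### Rotating -/

/-- `G'` arises from `G` by the write that makes the copy `z` of `y` a child of `x`, where `y` is the
child of `p` on side `c` and `x` the child of `y` on side `d`.  The logical tree is rotated at once:
`x` takes the place of `y`, although `p` still points to `y`. -/
structure Rotate (G G' : Graph K) (c d : Side) (p y x z : ℕ) : Prop where
  live_p : p ∈ G.live
  live_y : y ∈ G.live
  live_x : x ∈ G.live
  not_live : z ∉ G.live
  child_p : G.child p c = some y
  child_y : G.child y d = some x
  virt_p : ∀ t, G.virt p t = none
  virt_y : ∀ t, G.virt y t = none
  virt_x : ∀ t, G.virt x t = none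
  child_ne : ∀ m t, G.child m t ≠ some z
  virt_ne : ∀ m t, G.virt m t ≠ some z
  key_z : G'.key z = G.key y
  del_z : G'.del z = G.del y
  child_z : G'.child z d = G.child x d.flip
  child_z_flip : G'.child z d.flip = G.child y d.flip
  key' : ∀ m, m ≠ z → G'.key m = G.key m
  del' : ∀ m, m ≠ z → G'.del m = G.del m
  child_x' : G'.child x d.flip = some z
  child' : ∀ m t, m ≠ z → ¬ (m = x ∧ t = d.flip) → G'.child m t = G.child m t
  live' : ∀ m, m ∈ G'.live ↔ m = z ∨ (m ∈ G.live ∧ m ≠ y)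
  virt_p' : G'.virt p c = some x
  virt' : ∀ m t, ¬ (m = p ∧ t = c) → G'.virt m t = G.virt m t

namespace Rotate

variable {c d : Side} {p y x z : ℕ} (hG : G.Inv) (h : Rotate G G' c d p y x z)
include hG h

theorem ne_z {m : ℕ} (hm : m ∈ G.live) : m ≠ z := fun e => h.not_live (e ▸ hm)

theorem edge_p : G.Edge c p y := hG.edge_of_child h.live_p (h.virt_p _) h.child_p

theorem edge_y : G.Edge d y x := hG.edge_of_child h.live_y (h.virt_y _) h.child_y

theorem p_ne_y : p ≠ y := fun e => hG.not_edge_desc (h.edge_p hG) (e ▸ .refl)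

theorem y_ne_x : y ≠ x := fun e => hG.not_edge_desc (h.edge_y hG) (e ▸ .refl)

theorem p_ne_x : p ≠ x := fun e =>
  hG.not_edge_desc (h.edge_p hG) (e ▸ .single ⟨_, h.edge_y hG⟩)

theorem of_xy : d.Of (G.key x) (G.key y) := hG.order (h.edge_y hG) .refl

theorem virt_z (t : Side) : G.virt z t = none := by
  cases e : G.virt z t with
  | none => rfl
  | some y => exact (h.not_live (hG.virt_live e)).elim

theorem virt_z' (t : Side) : G'.virt z t = none := by
  rw [h.virt' z t fun e => h.ne_z hG h.live_p e.1.symm, h.virt_z hG]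

theorem virt_x' (t : Side) : G'.virt x t = none := by
  rw [h.virt' x t fun e => h.p_ne_x hG e.1.symm, h.virt_x]

theorem child_y' (t : Side) : G'.child y t = G.child y t :=
  h.child' y t (h.ne_z hG h.live_y) fun e => h.y_ne_x hG e.1

theorem key_x' : G'.key x = G.key x := h.key' x (h.ne_z hG h.live_x)
theorem key_y' : G'.key y = G.key y := h.key' y (h.ne_z hG h.live_y)
theorem key_p' : G'.key p = G.key p := h.key' p (h.ne_z hG h.live_p)

/-- Searches for keys that do not belong on the side of `x` at `y` come to `x` only when they start
there. -/
theorem not_gen_x {v : ℕ} (hv : v ∈ G.live) (hvx : v ≠ x) (hk : ¬ d.Of k (G.key y)) :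
    ¬ G.Gen k v x :=
  fun hg => hk (hG.gen_parent hv hg hvx (h.edge_y hG)).1

/-- The children of `x` on sides `d.flip` and `d` are called `a` and `w` here, and the child of `y` on
side `d.flip` is called `b`.  The copy `z` of `y` has the children `a` and `b`. -/
theorem edge_a {a : ℕ} (ha : G.child x d.flip = some a) : G.Edge d.flip x a :=
  hG.edge_of_child h.live_x (h.virt_x _) ha

theorem edge_b {b : ℕ} (hb : G.child y d.flip = some b) : G.Edge d.flip y b :=
  hG.edge_of_child h.live_y (h.virt_y _) hb

theorem edge_w {w : ℕ} (hw : G.child x d = some w) : G.Edge d x w :=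
  hG.edge_of_child h.live_x (h.virt_x _) hw

theorem b_not_desc_x {b : ℕ} (hb : G.child y d.flip = some b) : ¬ G.Desc b x := fun hd =>
  (h.of_xy hG).asymm (Side.of_flip.1 (hG.order (h.edge_b hG hb) hd))

/-! #### The logical tree -/

/-- The logical tree after the rotation: `p` has the child `x`, which has the children `w` and `z`. -/
theorem edge_iff {t : Side} {m n : ℕ} : G'.Edge t m n ↔
    (m = p ∧ t = c ∧ n = x) ∨ (m = x ∧ t = d.flip ∧ n = z) ∨
    (m = z ∧ t = d ∧ G.child x d.flip = some n) ∨ (m = z ∧ t = d.flip ∧ G.child y d.flip = some n) ∨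
    (m ≠ y ∧ m ≠ z ∧ n ≠ z ∧ ¬ (m = p ∧ t = c) ∧ ¬ (m = x ∧ t = d.flip) ∧ G.Edge t m n) := by
  have hpz := h.ne_z hG h.live_p
  have hxz := h.ne_z hG h.live_x
  have hpx := h.p_ne_x hG
  have hpy := h.p_ne_y hG
  have hyx := h.y_ne_x hG
  unfold Edge
  rw [h.live']
  by_cases e1 : m = p ∧ t = c
  · obtain ⟨rfl, rfl⟩ := e1
    rw [star_of_virt h.virt_p']
    simp [hpz, hpx, hpy, h.live_p, eq_comm]
  by_cases e2 : m = x ∧ t = d.flip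
  · obtain ⟨rfl, rfl⟩ := e2
    rw [star_of_none (h.virt_x' hG _), h.child_x']
    simp [hxz, hpx.symm, hyx.symm, h.live_x, eq_comm]
  by_cases e3 : m = z
  · subst e3
    rw [star_of_none (h.virt_z' hG _)]
    rcases t.eq_or_eq_flip d with rfl | rfl
    · rw [h.child_z]; simp [hpz.symm, hxz.symm, (Side.flip_ne t).symm]
    · rw [h.child_z_flip]; simp [hpz.symm, hxz.symm, (Side.flip_ne d)]
  · have hs : G'.star m t = G.star m t := by
      unfold star; rw [h.virt' m t e1, h.child' m t e3 e2]
    rw [hs]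
    have hn : G.star m t = some n → n ≠ z := by
      rintro hm rfl
      unfold star at hm
      cases hv : G.virt m t with
      | none => rw [hv] at hm; exact h.child_ne _ _ hm
      | some v => rw [hv] at hm; exact h.virt_ne _ _ (hv.trans hm)
    simp only [e3, false_or, false_and]
    constructor
    · rintro ⟨⟨h1, h2⟩, h3⟩
      exact .inr (.inr ⟨h2, e3, hn h3, e1, e2, h1, h3⟩)
    · rintro (⟨a, b, -⟩ | ⟨a, b, -⟩ | ⟨h2, -, -, -, -, h1, h3⟩)
      · exact (e1 ⟨a, b⟩).elim
      · exact (e2 ⟨a, b⟩).elim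
      · exact ⟨⟨h1, h2⟩, h3⟩

/-- A set of nodes that is closed under descending remains so, with `z` in it when `y` is. -/
theorem closed {Q : ℕ → Prop} (hQ : ∀ m n t, Q m → G.Edge t m n → Q n) (hxy : Q x → Q y)
    {m n : ℕ} (hm : if m = z then Q y else Q m) (hd : G'.Desc m n) : if n = z then Q y else Q n := by
  have hxz := h.ne_z hG h.live_x
  have hpz := h.ne_z hG h.live_p
  induction hd with
  | refl => exact hm
  | @tail a b _ he ih =>
    obtain ⟨t, he⟩ := he
    rcases (h.edge_iff hG).1 he with ⟨rfl, rfl, rfl⟩ | ⟨rfl, rfl, rfl⟩ | ⟨rfl, rfl, e⟩ | ⟨rfl, rfl, e⟩ |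
      ⟨-, e1, e2, -, -, he⟩
    · rw [if_neg hpz] at ih
      rw [if_neg hxz]
      exact hQ _ _ _ (hQ _ _ _ ih (h.edge_p hG)) (h.edge_y hG)
    · rw [if_neg hxz] at ih
      rw [if_pos rfl]; exact hxy ih
    · rw [if_pos rfl] at ih
      have ha := h.edge_a hG e
      rw [if_neg (h.ne_z hG (hG.edge_live ha))]
      exact hQ _ _ _ (hQ _ _ _ ih (h.edge_y hG)) ha
    · rw [if_pos rfl] at ih
      have hb := h.edge_b hG e
      rw [if_neg (h.ne_z hG (hG.edge_live hb))]
      exact hQ _ _ _ ih hb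
    · rw [if_neg e1] at ih
      rw [if_neg e2]
      exact hQ _ _ _ ih he

theorem desc_y_of_desc_x {v : ℕ} (hv : v ≠ x) (hd : G.Desc v x) : G.Desc v y := by
  rcases hd.cases_tail with e | ⟨a, h1, t, h2⟩
  · exact (hv e.symm).elim
  · rwa [← (hG.edge_inj h2 (h.edge_y hG)).1]

/-- Nothing changes below a proper descendant of `y` other than `x`. -/
theorem desc_below {v n : ℕ} (hvx : v ≠ x) (hv : ∃ t, ∃ u, G.Edge t u v ∧ G.Desc y u)
    (hd : G'.Desc v n) : n ≠ z ∧ G.Desc v n := by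
  obtain ⟨t, u, he, hu⟩ := hv
  have hvz := h.ne_z hG (hG.edge_live he)
  have hvy : ¬ G.Desc v y := fun hd => hG.not_edge_desc he (hd.trans hu)
  have := h.closed hG (Q := G.Desc v) (fun a b t ha hb => ha.tail ⟨t, hb⟩)
    (fun hd => h.desc_y_of_desc_x hG hvx hd) (m := v) (n := n) (by rw [if_neg hvz]) hd
  by_cases e : n = z
  · rw [if_pos e] at this; exact (hvy this).elim
  · rw [if_neg e] at this; exact ⟨e, this⟩

/-- The subtrees of `a`, `w` and `b` are moved as a whole. -/
theorem a_below {a : ℕ} (ha : G.child x d.flip = some a) :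
    a ≠ x ∧ ∃ t, ∃ u, G.Edge t u a ∧ G.Desc y u :=
  ⟨fun e => hG.not_edge_desc (h.edge_a hG ha) (e ▸ .refl), _, _, h.edge_a hG ha,
    .single ⟨_, h.edge_y hG⟩⟩

theorem w_below {w : ℕ} (hw : G.child x d = some w) :
    w ≠ x ∧ ∃ t, ∃ u, G.Edge t u w ∧ G.Desc y u :=
  ⟨fun e => hG.not_edge_desc (h.edge_w hG hw) (e ▸ .refl), _, _, h.edge_w hG hw,
    .single ⟨_, h.edge_y hG⟩⟩

theorem b_below {b : ℕ} (hb : G.child y d.flip = some b) :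
    b ≠ x ∧ ∃ t, ∃ u, G.Edge t u b ∧ G.Desc y u :=
  ⟨fun e => h.b_not_desc_x hG hb (e ▸ .refl), _, _, h.edge_b hG hb, .refl⟩

theorem order' {t : Side} {m n n' : ℕ} (he : G'.Edge t m n) (hd : G'.Desc n n') :
    t.Of (G'.key n') (G'.key m) := by
  have hpz := h.ne_z hG h.live_p
  have hxz := h.ne_z hG h.live_x
  -- the keys below the copy are on the right sides of `x` and of the copy
  have low : ∀ {a}, G.child x d.flip = some a → ∀ {n'}, G'.Desc a n' →
      d.flip.Of (G'.key n') (G.key x) ∧ d.Of (G'.key n') (G.key y) := by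
    intro a ha n' hd
    obtain ⟨h1, h2⟩ := h.a_below hG ha
    obtain ⟨hn, hd⟩ := h.desc_below hG h1 h2 hd
    rw [h.key' _ hn]
    exact ⟨hG.order (h.edge_a hG ha) hd, hG.order (h.edge_y hG) (.head ⟨_, h.edge_a hG ha⟩ hd)⟩
  have high : ∀ {b}, G.child y d.flip = some b → ∀ {n'}, G'.Desc b n' →
      d.flip.Of (G'.key n') (G.key y) := by
    intro b hb n' hd
    obtain ⟨h1, h2⟩ := h.b_below hG hb
    obtain ⟨hn, hd⟩ := h.desc_below hG h1 h2 hd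
    rw [h.key' _ hn]
    exact hG.order (h.edge_b hG hb) hd
  have hyx : d.flip.Of (G.key y) (G.key x) := Side.of_flip.2 (h.of_xy hG)
  -- a node whose subtree contains `x`, if at all, only together with `y`
  have main : m ≠ z → m ≠ x → (∀ Q : ℕ → Prop, (∀ a b t, Q a → G.Edge t a b → Q b) →
      (∀ v, G.Edge t m v → Q v) → Q n) → n ≠ z → t.Of (G'.key n') (G'.key m) := by
    intro hmz hmx hn hnz
    let Q : ℕ → Prop := fun n => ∃ v, G.Edge t m v ∧ G.Desc v n
    have hQ : ∀ a b t, Q a → G.Edge t a b → Q b := by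
      rintro a b t ⟨v, h1, h2⟩ h3
      exact ⟨v, h1, h2.tail ⟨t, h3⟩⟩
    have hmy : m ≠ y := by
      intro e
      rcases (h.edge_iff hG).1 he with ⟨e1, -⟩ | ⟨e1, -⟩ | ⟨e1, -⟩ | ⟨e1, -⟩ | ⟨e1, -⟩
      · exact h.p_ne_y hG (e1.symm.trans e)
      · exact hmx e1
      · exact hmz e1
      · exact hmz e1
      · exact e1 e
    have hxy : Q x → Q y := by
      rintro ⟨v, h1, h2⟩
      refine ⟨v, h1, h.desc_y_of_desc_x hG ?_ h2⟩
      rintro rfl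
      exact hmy (hG.edge_inj h1 (h.edge_y hG)).1
    have := h.closed hG hQ hxy (m := n) (n := n')
      (by rw [if_neg hnz]; exact hn Q hQ fun v hv => ⟨v, hv, .refl⟩) hd
    rw [h.key' m hmz]
    by_cases e : n' = z
    · rw [if_pos e] at this
      obtain ⟨v, h1, h2⟩ := this
      rw [e, h.key_z]; exact hG.order h1 h2
    · rw [if_neg e] at this
      obtain ⟨v, h1, h2⟩ := this
      rw [h.key' _ e]; exact hG.order h1 h2
  rcases (h.edge_iff hG).1 he with ⟨rfl, rfl, rfl⟩ | ⟨rfl, rfl, rfl⟩ | ⟨rfl, rfl, e⟩ | ⟨rfl, rfl, e⟩ |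
      ⟨-, e1, e2, -, e3, he'⟩
  · exact main hpz (h.p_ne_x hG) (fun Q hQ hc => hQ _ _ _ (hc _ (h.edge_p hG)) (h.edge_y hG)) hxz
  · rw [h.key_x' hG]
    rcases hd.cases_head with rfl | ⟨a, ⟨t, he'⟩, hd⟩
    · rwa [h.key_z]
    · rcases (h.edge_iff hG).1 he' with ⟨e, -⟩ | ⟨e, -⟩ | ⟨-, -, e⟩ | ⟨-, -, e⟩ | ⟨-, e, -⟩
      · exact (hpz e.symm).elim
      · exact (hxz e.symm).elim
      · exact (low e hd).1
      · exact (high e hd).trans hyx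
      · exact (e rfl).elim
  · rw [h.key_z]; exact (low e hd).2
  · rw [h.key_z]; exact high e hd
  · by_cases hmx : m = x
    · subst hmx
      obtain rfl : t = d := (t.eq_or_eq_flip d).resolve_right fun e => e3 ⟨rfl, e⟩
      have hw : G.child m t = some n := by
        have := he'.2
        rwa [star_of_none (h.virt_x t)] at this
      obtain ⟨h1, h2⟩ := h.w_below hG hw
      obtain ⟨hn, hd⟩ := h.desc_below hG h1 h2 hd
      rw [h.key' _ hn, h.key' _ e1]
      exact hG.order he' hd
    · exact main e1 hmx (fun Q hQ hc => hc _ he') e2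

/-! #### Searches after a rotation -/

theorem of_x_of_not_of_y (hk : d.flip.Of k (G.key y)) : d.flip.Of k (G.key x) :=
  hk.trans (Side.of_flip.2 (h.of_xy hG))

theorem edge_px : G'.Edge c p x := (h.edge_iff hG).2 (.inl ⟨rfl, rfl, rfl⟩)

theorem edge_xz : G'.Edge d.flip x z := (h.edge_iff hG).2 (.inr (.inl ⟨rfl, rfl, rfl⟩))

theorem edge_za {a : ℕ} (ha : G.child x d.flip = some a) : G'.Edge d z a :=
  (h.edge_iff hG).2 (.inr (.inr (.inl ⟨rfl, rfl, ha⟩)))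

theorem edge_zb {b : ℕ} (hb : G.child y d.flip = some b) : G'.Edge d.flip z b :=
  (h.edge_iff hG).2 (.inr (.inr (.inr (.inl ⟨rfl, rfl, hb⟩))))

theorem sstep_px (hk : c.Of k (G.key p)) : G'.SStep k p x :=
  ⟨c, by rwa [h.key_p' hG], h.edge_px hG⟩

theorem sstep_xz (hk : d.flip.Of k (G.key x)) : G'.SStep k x z :=
  ⟨d.flip, by rwa [h.key_x' hG], h.edge_xz hG⟩

/-- A search in the logical tree still visits the nodes other than `y` that it used to visit. -/
theorem star {v n : ℕ} (hs : G.Star k v n) (hv : v ∈ G.live) (hvy : v ≠ y)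
    (hk : v = x → d.Of k (G.key y)) :
    (n ≠ y → G'.Star k v n) ∧ (n = y → G'.Star k v p ∧ c.Of k (G.key p)) := by
  have hpy := h.p_ne_y hG
  have hyx := h.y_ne_x hG
  induction hs with
  | refl => exact ⟨fun _ => .refl, fun e => (hvy e).elim⟩
  | @tail m n hm hs ih =>
    obtain ⟨t, ht, he⟩ := hs
    constructor
    · intro hn
      by_cases hmy : m = y
      · subst hmy
        obtain ⟨h1, h2⟩ := ih.2 rfl
        have h3 := h1.tail (h.sstep_px hG h2)
        have hc : G.child m t = some n := by
          have := he.2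
          rwa [star_of_none (h.virt_y t)] at this
        rcases t.eq_or_eq_flip d with rfl | rfl
        · rw [h.child_y] at hc; cases hc; exact h3
        · exact (h3.tail (h.sstep_xz hG (h.of_x_of_not_of_y hG ht))).tail
            ⟨d.flip, by rwa [h.key_z], h.edge_zb hG hc⟩
      · have h1 := ih.1 hmy
        by_cases hx : m = x ∧ t = d.flip
        · obtain ⟨rfl, rfl⟩ := hx
          have hc : G.child m d.flip = some n := by
            have := he.2
            rwa [star_of_none (h.virt_x _)] at this
          have hk' : d.Of k (G.key y) := by
            by_cases hvx : v = m
            · exact hk hvx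
            · exact (hG.gen_parent hv (Star.gen hm) hvx (h.edge_y hG)).1
          exact (h1.tail (h.sstep_xz hG ht)).tail ⟨d, by rwa [h.key_z], h.edge_za hG hc⟩
        · have hp : ¬ (m = p ∧ t = c) := by
            rintro ⟨rfl, rfl⟩
            have := he.2
            rw [(h.edge_p hG).2] at this
            cases this; exact hn rfl
          refine h1.tail ⟨t, by rwa [h.key' m (h.ne_z hG he.1)], (h.edge_iff hG).2 ?_⟩
          exact .inr (.inr (.inr (.inr
            ⟨hmy, h.ne_z hG he.1, h.ne_z hG (hG.edge_live he), hp, hx, he⟩)))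
    · rintro rfl
      obtain ⟨rfl, rfl⟩ := hG.edge_inj he (h.edge_p hG)
      exact ⟨ih.1 hpy, ht⟩

/-- A search in the new graph can take a new turn only once it has come to `x`, in the old graph or by
the virtual edge. -/
theorem gen_split {v n : ℕ} (hv : v ≠ z) (hg : G'.Gen k v n) :
    G.Gen k v n ∨ ((G.Gen k v x ∨ (G.Gen k v p ∧ c.Of k (G.key p))) ∧ G'.Gen k x n) := by
  have hxz := h.ne_z hG h.live_x
  induction hg using ReflTransGen.head_induction_on with
  | refl => exact .inl .refl
  | @head a b hs hg ih =>
    by_cases hax : a = x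
    · subst hax; exact .inr ⟨.inl .refl, .head hs hg⟩
    obtain ⟨t, ht, hn⟩ := hs
    rw [h.key' a hv] at ht
    rw [h.child' a t hv fun e => hax e.1] at hn
    have cont : (G.GStep k a b) → G.Gen k a n ∨
        ((G.Gen k a x ∨ (G.Gen k a p ∧ c.Of k (G.key p))) ∧ G'.Gen k x n) := by
      intro hs
      have hb : b ≠ z := by
        rintro rfl
        obtain ⟨t, -, e | e⟩ := hs
        · exact h.child_ne _ _ e
        · exact h.virt_ne _ _ e
      rcases ih hb with ih | ⟨ih | ⟨ih, ih'⟩, ih''⟩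
      · exact .inl (.head hs ih)
      · exact .inr ⟨.inl (.head hs ih), ih''⟩
      · exact .inr ⟨.inr ⟨.head hs ih, ih'⟩, ih''⟩
    by_cases hap : a = p ∧ t = c
    · obtain ⟨rfl, rfl⟩ := hap
      rw [h.virt_p'] at hn
      rcases hn with hn | hn
      · exact cont ⟨t, ht, .inl hn⟩
      · cases hn; exact .inr ⟨.inr ⟨.refl, ht⟩, hg⟩
    · rw [h.virt' a t hap] at hn
      exact cont ⟨t, ht, hn⟩

/-- A path in the new memory uses the new pointer from `x` to `z` or existed before. -/
theorem path_split {v n : ℕ} (hv : v ≠ z) (hg : G'.Path k v n) :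
    G.Path k v n ∨ (G.Path k v x ∧ d.flip.Of k (G.key x) ∧ G'.Path k z n) := by
  have hxz := h.ne_z hG h.live_x
  induction hg using ReflTransGen.head_induction_on with
  | refl => exact .inl .refl
  | @head a b hs hg ih =>
    obtain ⟨t, ht, hn⟩ := hs
    rw [h.key' a hv] at ht
    by_cases hax : a = x ∧ t = d.flip
    · obtain ⟨rfl, rfl⟩ := hax
      rw [h.child_x'] at hn
      cases hn; exact .inr ⟨.refl, ht, hg⟩
    rw [h.child' a t hv hax] at hn
    have hb : b ≠ z := by rintro rfl; exact h.child_ne _ _ hn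
    rcases ih hb with ih | ⟨ih, ih'⟩
    · exact .inl (.head ⟨t, ht, hn⟩ ih)
    · exact .inr ⟨.head ⟨t, ht, hn⟩ ih, ih'⟩

omit h in
theorem below_live {v : ℕ} (hv : v ≠ x ∧ ∃ t, ∃ u, G.Edge t u v ∧ G.Desc y u) :
    v ∈ G.live := by
  obtain ⟨-, t, u, he, -⟩ := hv
  exact hG.edge_live he

theorem below_ne {v : ℕ} (hv : v ≠ x ∧ ∃ t, ∃ u, G.Edge t u v ∧ G.Desc y u) : v ≠ y := by
  obtain ⟨-, t, u, he, hu⟩ := hv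
  rintro rfl
  exact hG.not_edge_desc he hu

/-- Searches that start in the subtrees of `a`, `w` and `b` do not meet a modified node. -/
theorem below_not_gen {v : ℕ} (hv : v ≠ x ∧ ∃ t, ∃ u, G.Edge t u v ∧ G.Desc y u) :
    ¬ G.Gen k v x ∧ ¬ G.Gen k v p := by
  have hl := below_live hG hv
  obtain ⟨hvx, t, u, he, hu⟩ := hv
  constructor
  · intro hg
    have := Star.desc (hG.star_of_gen hl h.live_x hg)
    exact hG.not_edge_desc he ((h.desc_y_of_desc_x hG hvx this).trans hu)
  · intro hg
    have := Star.desc (hG.star_of_gen hl h.live_p hg)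
    exact hG.not_edge_desc he ((this.tail ⟨_, h.edge_p hG⟩).trans hu)

theorem star_below {v n : ℕ} (hv : v ≠ x ∧ ∃ t, ∃ u, G.Edge t u v ∧ G.Desc y u)
    (hn : n ∈ G'.live) (hg : G'.Gen k v n) : G'.Star k v n := by
  have hl := below_live hG hv
  obtain ⟨h1, h2⟩ := h.below_not_gen (k := k) hG hv
  rcases h.gen_split hG (h.ne_z hG hl) hg with hg | ⟨hg | ⟨hg, -⟩, -⟩
  · have hnz : n ≠ z := by
      rintro rfl
      rcases hg.cases_tail with e | ⟨m, -, t, -, e | e⟩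
      · exact h.ne_z hG hl e.symm
      · exact h.child_ne _ _ e
      · exact h.virt_ne _ _ e
    obtain ⟨hn, hny⟩ := ((h.live' n).1 hn).resolve_left hnz
    exact (h.star hG (hG.star_of_gen hl hn hg) hl (h.below_ne hG hv) fun e => (hv.1 e).elim).1 hny
  · exact (h1 hg).elim
  · exact (h2 hg).elim

theorem star_from_z {n : ℕ} (hn : n ∈ G'.live) (hg : G'.Gen k z n) : G'.Star k z n := by
  rcases hg.cases_head with rfl | ⟨m, ⟨t, ht, hm⟩, hg⟩
  · exact .refl
  · rw [h.key_z] at ht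
    rw [h.virt_z' hG] at hm
    replace hm := hm.resolve_right (by simp)
    rcases t.eq_or_eq_flip d with rfl | rfl
    · rw [h.child_z] at hm
      exact .head ⟨t, by rwa [h.key_z], h.edge_za hG hm⟩ (h.star_below hG (h.a_below hG hm) hn hg)
    · rw [h.child_z_flip] at hm
      exact .head ⟨d.flip, by rwa [h.key_z], h.edge_zb hG hm⟩
        (h.star_below hG (h.b_below hG hm) hn hg)

theorem star_from_x {n : ℕ} (hn : n ∈ G'.live) (hg : G'.Gen k x n) : G'.Star k x n := by
  have hxz := h.ne_z hG h.live_x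
  rcases hg.cases_head with rfl | ⟨m, ⟨t, ht, hm⟩, hg⟩
  · exact .refl
  · rw [h.key_x' hG] at ht
    rw [h.virt_x' hG] at hm
    replace hm := hm.resolve_right (by simp)
    rcases t.eq_or_eq_flip d with rfl | rfl
    · rw [h.child' x t hxz fun e => Side.flip_ne t e.2.symm] at hm
      have hw := h.edge_w hG hm
      refine .head ⟨t, by rwa [h.key_x' hG], (h.edge_iff hG).2 ?_⟩
        (h.star_below hG (h.w_below hG hm) hn hg)
      exact .inr (.inr (.inr (.inr ⟨(h.y_ne_x hG).symm, hxz, h.ne_z hG (hG.edge_live hw),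
        fun e => h.p_ne_x hG e.1.symm, fun e => Side.flip_ne t e.2.symm, hw⟩)))
    · rw [h.child_x'] at hm
      cases hm
      exact .head (h.sstep_xz hG ht) (h.star_from_z hG hn hg)

theorem star_of_gen {v n : ℕ} (hv : v ∈ G'.live) (hn : n ∈ G'.live) (hg : G'.Gen k v n) :
    G'.Star k v n := by
  by_cases hvz : v = z
  · subst hvz; exact h.star_from_z hG hn hg
  by_cases hvx : v = x
  · subst hvx; exact h.star_from_x hG hn hg
  obtain ⟨hv, hvy⟩ := ((h.live' v).1 hv).resolve_left hvz
  have hs : ∀ {m}, m ∈ G.live → m ≠ y → G.Gen k v m → G'.Star k v m := fun hm hmy hg =>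
    (h.star hG (hG.star_of_gen hv hm hg) hv hvy fun e => (hvx e).elim).1 hmy
  rcases h.gen_split hG hvz hg with hg | ⟨hg | ⟨hg, hk⟩, hg'⟩
  · have hnz : n ≠ z := by
      rintro rfl
      rcases hg.cases_tail with e | ⟨m, -, t, -, e | e⟩
      · exact hvz e.symm
      · exact h.child_ne _ _ e
      · exact h.virt_ne _ _ e
    obtain ⟨hn, hny⟩ := ((h.live' n).1 hn).resolve_left hnz
    exact hs hn hny hg
  · exact (hs h.live_x (h.y_ne_x hG).symm hg).trans (h.star_from_x hG hn hg')
  · exact ((hs h.live_p (h.p_ne_y hG) hg).tail (h.sstep_px hG hk)).trans (h.star_from_x hG hn hg')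

section

variable {P Q : Option ℕ → Prop}

theorem inev_z (hk : d.Of k (G.key y)) (hi : G'.Inev k Q (G.child x d.flip)) :
    G'.Inev k Q (some z) :=
  .step' (s := d) (by rwa [h.key_z]) (h.virt_z' hG _) (by rwa [h.child_z])

theorem inev_z_flip (hk : d.flip.Of k (G.key y)) (hi : G'.Inev k Q (G.child y d.flip)) :
    G'.Inev k Q (some z) :=
  .step' (s := d.flip) (by rwa [h.key_z]) (h.virt_z' hG _) (by rwa [h.child_z_flip])

theorem inev_x_flip (hk : d.flip.Of k (G.key x)) (hi : G'.Inev k Q (some z)) :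
    G'.Inev k Q (some x) :=
  .step' (s := d.flip) (by rwa [h.key_x' hG]) (h.virt_x' hG _) (by rwa [h.child_x'])

/-- What a search finds below `y` it also finds below `x`. -/
theorem inev_x_of_inev_y (hi : G'.Inev k Q (some y))
    (hy : Q (some y) → G.key y = k ∧ Q (some z)) : G'.Inev k Q (some x) := by
  cases hi with
  | now hq =>
    obtain ⟨h1, h2⟩ := hy hq
    exact h.inev_x_flip hG (h1 ▸ Side.of_flip.2 (h.of_xy hG)) (.now h2)
  | @step _ t ht hc _ =>
    rw [h.key_y' hG] at ht
    rw [h.child_y' hG] at hc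
    rcases t.eq_or_eq_flip d with rfl | rfl
    · rwa [h.child_y] at hc
    · exact h.inev_x_flip hG (h.of_x_of_not_of_y hG ht) (h.inev_z_flip hG ht hc)

/-- A search that could meet `x` only by passing `y`, on the side of `x`, behaves as before: at the child
`z` of `x` it turns to `a`, where it went from `x`, and if it takes the virtual edge it meets the same
nodes as below `y`. -/
theorem inev {o : Option ℕ} (ho : o ≠ some z) (hi : G.Inev k P o)
    (hk : ∀ m, o = some m → G.Gen k m x → d.Of k (G.key y)) (hPQ : ∀ o, o ≠ some z → P o → Q o)
    (hy : Q (some y) → G.key y = k ∧ Q (some z)) : G'.Inev k Q o := by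
  induction hi with
  | now hp => exact .now (hPQ _ ho hp)
  | @step m t ht h1 h2 ih1 ih2 =>
    have hmz : m ≠ z := fun e => ho (e ▸ rfl)
    have j1 := ih1 (h.child_ne m t) fun u hu hg => hk m rfl (.head ⟨t, ht, .inl hu⟩ hg)
    have j2 := fun v hv => ih2 v hv (hv ▸ h.virt_ne m t) fun u hu hg =>
      hk m rfl (.head ⟨t, ht, .inr (hv.trans hu)⟩ hg)
    by_cases hx : m = x ∧ t = d.flip
    · obtain ⟨rfl, rfl⟩ := hx
      exact h.inev_x_flip hG ht (h.inev_z hG (hk m rfl .refl) j1)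
    · refine .step (s := t) (by rwa [h.key' m hmz]) (by rwa [h.child' m t hmz hx]) ?_
      by_cases hp : m = p ∧ t = c
      · obtain ⟨rfl, rfl⟩ := hp
        rw [h.virt_p']
        rintro _ ⟨⟩
        rw [h.child_p] at j1
        exact h.inev_x_of_inev_y hG j1 hy
      · rw [h.virt' m t hp]
        exact j2

end

theorem hits {n v : ℕ} (hn : n ≠ y) (hv : v ≠ z) (hi : G.Hits k n v)
    (hk : G.Gen k v x → d.Of k (G.key y)) : G'.Hits k n v :=
  h.inev hG (by simpa using hv) hi (by rintro m ⟨⟩; exact hk) (fun _ _ e => e)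
    fun e => (hn (Option.some.inj e).symm).elim

theorem res {b : Bool} {o : Option ℕ} (ho : o ≠ some z) (hi : G.Res k b o)
    (hk : ∀ m, o = some m → G.Gen k m x → d.Of k (G.key y)) : G'.Res k b o := by
  refine h.inev hG ho hi hk ?_ ?_
  · rintro o ho (⟨rfl, rfl⟩ | ⟨m, rfl, e1, e2⟩)
    · exact .inl ⟨rfl, rfl⟩
    · have hm : m ≠ z := by simpa using ho
      exact .inr ⟨m, rfl, by rw [h.key' m hm, e1], by rw [h.del' m hm, e2]⟩
  · rintro (⟨e, -⟩ | ⟨m, e, e1, e2⟩)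
    · cases e
    · cases e
      rw [h.key_y' hG] at e1
      rw [h.del' y (h.ne_z hG h.live_y)] at e2
      exact ⟨e1, .inr ⟨z, rfl, by rw [h.key_z, e1], by rw [h.del_z, e2]⟩⟩

theorem hits_below {v n : ℕ} (hv : v ≠ x ∧ ∃ t, ∃ u, G.Edge t u v ∧ G.Desc y u)
    (hn : n ∈ G'.live) (hp : G'.Path k v n) : G'.Hits k n v := by
  have hl := below_live hG hv
  obtain ⟨h1, h2⟩ := h.below_not_gen (k := k) hG hv
  rcases h.path_split hG (h.ne_z hG hl) hp with hp | ⟨hp, -⟩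
  · have hnz : n ≠ z := by
      rintro rfl
      rcases hp.cases_tail with e | ⟨m, -, t, -, e⟩
      · exact h.ne_z hG hl e.symm
      · exact h.child_ne _ _ e
    obtain ⟨hn, hny⟩ := ((h.live' n).1 hn).resolve_left hnz
    exact h.hits hG hny (h.ne_z hG hl) (hG.hits_of_path hl hn hp) fun hg => (h1 hg).elim
  · exact (h1 (Path.gen hp)).elim

theorem hits_from_z {n : ℕ} (hn : n ∈ G'.live) (hp : G'.Path k z n) : G'.Hits k n z := by
  rcases hp.cases_head with rfl | ⟨m, ⟨t, ht, hm⟩, hp⟩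
  · exact .now rfl
  · rw [h.key_z] at ht
    rcases t.eq_or_eq_flip d with rfl | rfl
    · rw [h.child_z] at hm
      exact h.inev_z hG ht (hm ▸ h.hits_below hG (h.a_below hG hm) hn hp)
    · rw [h.child_z_flip] at hm
      exact h.inev_z_flip hG ht (hm ▸ h.hits_below hG (h.b_below hG hm) hn hp)

/-- A search that starts at `x` for a key on the other side of `y` has to be treated separately: it used
to end below `x`, and may now find nodes below `b`. -/
theorem hits_of_path {v n : ℕ} (hv : v ∈ G'.live) (hn : n ∈ G'.live) (hp : G'.Path k v n) :
    G'.Hits k n v := by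
  by_cases hvz : v = z
  · subst hvz; exact h.hits_from_z hG hn hp
  obtain ⟨hv, hvy⟩ := ((h.live' v).1 hv).resolve_left hvz
  by_cases hx : v = x ∧ ¬ d.Of k (G.key y)
  · obtain ⟨rfl, hk⟩ := hx
    rcases hp.cases_head with rfl | ⟨m, ⟨t, ht, hm⟩, hp⟩
    · exact .now rfl
    · rw [h.key_x' hG] at ht
      rcases t.eq_or_eq_flip d with rfl | rfl
      · exact (hk (ht.trans (h.of_xy hG))).elim
      · rw [h.child_x'] at hm
        cases hm
        exact h.inev_x_flip hG ht (h.hits_from_z hG hn hp)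
  · have hk : G.Gen k v x → d.Of k (G.key y) := by
      intro hg
      by_contra hk
      exact h.not_gen_x hG hv (fun e => hx ⟨e, hk⟩) hk hg
    rcases h.path_split hG hvz hp with hp | ⟨hp, hk', hp'⟩
    · have hnz : n ≠ z := by
        rintro rfl
        rcases hp.cases_tail with e | ⟨m, -, t, -, e⟩
        · exact hvz e.symm
        · exact h.child_ne _ _ e
      obtain ⟨hn, hny⟩ := ((h.live' n).1 hn).resolve_left hnz
      exact h.hits hG hny hvz (hG.hits_of_path hv hn hp) hk
    · refine (h.hits hG (h.y_ne_x hG).symm hvz (hG.hits_of_path hv h.live_x hp) hk).bind ?_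
      rintro _ rfl
      exact h.inev_x_flip hG hk' (h.hits_from_z hG hn hp')

theorem outcome_child {q : Option ℕ}
    (hq : ∀ v, q = some v → v ≠ x ∧ ∃ t, ∃ u, G.Edge t u v ∧ G.Desc y u) :
    ∃ b, G'.Res k b q := by
  cases q with
  | none => exact ⟨false, res_none⟩
  | some v =>
    have hv := hq v rfl
    have hl := below_live hG hv
    obtain ⟨b, hb⟩ := hG.outcome k hl
    refine ⟨b, h.res hG (by simpa using h.ne_z hG hl) hb ?_⟩
    rintro m ⟨⟩ hg
    exact ((h.below_not_gen hG hv).1 hg).elim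

theorem outcome_z : ∃ b, G'.Res k b (some z) := by
  rcases d.of_or (k : WithTop K) (G.key y) with hk | hk | hk
  · exact ⟨_, .now (.inr ⟨z, rfl, by rw [h.key_z, hk], rfl⟩)⟩
  · obtain ⟨b, hb⟩ := h.outcome_child (k := k) hG (q := G.child x d.flip)
      (fun _ hv => h.a_below hG hv)
    exact ⟨b, h.inev_z hG hk hb⟩
  · obtain ⟨b, hb⟩ := h.outcome_child (k := k) hG (q := G.child y d.flip)
      (fun _ hv => h.b_below hG hv)
    exact ⟨b, h.inev_z_flip hG hk hb⟩

theorem outcome {v : ℕ} (hv : v ∈ G'.live) : ∃ b, G'.Res k b (some v) := by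
  by_cases hvz : v = z
  · subst hvz; exact h.outcome_z hG
  obtain ⟨hv, hvy⟩ := ((h.live' v).1 hv).resolve_left hvz
  by_cases hx : v = x ∧ ¬ d.Of k (G.key y)
  · obtain ⟨rfl, hk⟩ := hx
    have hk' : d.flip.Of k (G.key v) := by
      rcases d.of_or (k : WithTop K) (G.key y) with e | e | e
      · rw [e]; exact Side.of_flip.2 (h.of_xy hG)
      · exact (hk e).elim
      · exact h.of_x_of_not_of_y hG e
    obtain ⟨b, hb⟩ := h.outcome_z (k := k) hG
    exact ⟨b, h.inev_x_flip hG hk' hb⟩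
  · obtain ⟨b, hb⟩ := hG.outcome k hv
    refine ⟨b, h.res hG (by simpa using hvz) hb ?_⟩
    rintro m ⟨⟩ hg
    by_contra hk
    exact h.not_gen_x hG hv (fun e => hx ⟨e, hk⟩) hk hg

theorem root_ne : root ≠ x ∧ root ≠ y ∧ root ≠ z :=
  ⟨fun e => hG.root_edge (e ▸ h.edge_y hG), fun e => hG.root_edge (e ▸ h.edge_p hG),
    h.ne_z hG hG.root_live⟩

/-- Searches from the root come to `x` only for keys on its side of `y`. -/
theorem root_gen (hg : G.Gen k root x) : d.Of k (G.key y) := by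
  by_contra hk
  exact h.not_gen_x hG hG.root_live (h.root_ne hG).1 hk hg

theorem res_root {b : Bool} (hb : G.Res k b (some root)) : G'.Res k b (some root) :=
  h.res hG (by simpa using (h.root_ne hG).2.2) hb (by rintro m ⟨⟩ hg; exact h.root_gen hG hg)

theorem inv : G'.Inv := by
  refine ⟨?_, ?_, ?_, ?_, fun he hd => h.order' hG he hd, ?_, fun hv hn => h.star_of_gen hG hv hn,
    fun hv hn => h.hits_of_path hG hv hn, fun k v hv => h.outcome hG hv⟩
  · exact (h.live' _).2 (.inr ⟨hG.root_live, (h.root_ne hG).2.1⟩)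
  · intro t m he
    rcases (h.edge_iff hG).1 he with ⟨-, -, e⟩ | ⟨-, -, e⟩ | ⟨-, -, e⟩ | ⟨-, -, e⟩ | ⟨-, -, -, -, -, e⟩
    · exact (h.root_ne hG).1 e
    · exact (h.root_ne hG).2.2 e
    · exact hG.root_edge (h.edge_a hG e)
    · exact hG.root_edge (h.edge_b hG e)
    · exact hG.root_edge e
  · intro t m n he
    have below : ∀ {v}, (v ≠ x ∧ ∃ t, ∃ u, G.Edge t u v ∧ G.Desc y u) → v ∈ G'.live := fun hv =>
      (h.live' _).2 (.inr ⟨below_live hG hv, h.below_ne hG hv⟩)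
    rcases (h.edge_iff hG).1 he with ⟨-, -, rfl⟩ | ⟨-, -, e⟩ | ⟨-, -, e⟩ | ⟨-, -, e⟩ |
      ⟨-, -, -, e, -, he⟩
    · exact (h.live' _).2 (.inr ⟨h.live_x, (h.y_ne_x hG).symm⟩)
    · exact (h.live' _).2 (.inl e)
    · exact below (h.a_below hG e)
    · exact below (h.b_below hG e)
    · refine (h.live' _).2 (.inr ⟨hG.edge_live he, ?_⟩)
      rintro rfl
      exact e (hG.edge_inj he (h.edge_p hG))
  · -- the parent of each node is determined by its old parent
    intro t m t' m' n he he'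
    have key : ∀ {t m}, G'.Edge t m n → (n = x ∧ m = p ∧ t = c) ∨ (n = z ∧ m = x ∧ t = d.flip) ∨
        (G.Edge d.flip x n ∧ m = z ∧ t = d) ∨ (G.Edge d.flip y n ∧ m = z ∧ t = d.flip) ∨
        (n ≠ z ∧ m ≠ y ∧ ¬ (m = x ∧ t = d.flip) ∧ G.Edge t m n) := by
      intro t m he
      rcases (h.edge_iff hG).1 he with ⟨a, b, e⟩ | ⟨a, b, e⟩ | ⟨a, b, e⟩ | ⟨a, b, e⟩ |
        ⟨e1, -, e2, -, e3, he⟩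
      · exact .inl ⟨e, a, b⟩
      · exact .inr (.inl ⟨e, a, b⟩)
      · exact .inr (.inr (.inl ⟨h.edge_a hG e, a, b⟩))
      · exact .inr (.inr (.inr (.inl ⟨h.edge_b hG e, a, b⟩)))
      · exact .inr (.inr (.inr (.inr ⟨e2, e1, e3, he⟩)))
    have hxz := h.ne_z hG h.live_x
    have hyx := h.y_ne_x hG
    have hnz : ∀ {t m}, G.Edge t m n → n ≠ z := fun he => h.ne_z hG (hG.edge_live he)
    have hx : ∀ {t m}, n = x → G.Edge t m n → m = y ∧ t = d := fun e he =>
      hG.edge_inj he (e ▸ h.edge_y hG)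
    have hxf : n = x → ¬ G.Edge d.flip y n := fun e he => Side.flip_ne d (hx e he).2
    rcases key he with ⟨a, b, e⟩ | ⟨a, b, e⟩ | ⟨a, b, e⟩ | ⟨a, b, e⟩ | ⟨a, b, e, f⟩ <;>
      rcases key he' with ⟨a', b', e'⟩ | ⟨a', b', e'⟩ | ⟨a', b', e'⟩ | ⟨a', b', e'⟩ | ⟨a', b', e', f'⟩
    · exact ⟨b.trans b'.symm, e.trans e'.symm⟩
    · exact (hxz (a.symm.trans a')).elim
    · exact (hyx (hx a a').1.symm).elim
    · exact (hxf a a').elim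
    · exact (b' (hx a f').1).elim
    · exact (hxz (a'.symm.trans a)).elim
    · exact ⟨b.trans b'.symm, e.trans e'.symm⟩
    · exact (hnz a' a).elim
    · exact (hnz a' a).elim
    · exact (a' a).elim
    · exact (hyx (hx a' a).1.symm).elim
    · exact (hnz a a').elim
    · exact ⟨b.trans b'.symm, e.trans e'.symm⟩
    · exact (hyx (hG.edge_inj a' a).1).elim
    · exact (e' (hG.edge_inj f' a)).elim
    · exact (hxf a' a).elim
    · exact (hnz a a').elim
    · exact (hyx (hG.edge_inj a a').1).elim
    · exact ⟨b.trans b'.symm, e.trans e'.symm⟩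
    · exact (b' (hG.edge_inj f' a).1).elim
    · exact (b (hx a' f).1).elim
    · exact (a a').elim
    · exact (e (hG.edge_inj f a')).elim
    · exact (b (hG.edge_inj f a').1).elim
    · exact hG.edge_inj f f'
  · intro m t v hv
    by_cases hp : m = p ∧ t = c
    · rw [hp.1]
      exact (h.live' _).2 (.inr ⟨h.live_p, h.p_ne_y hG⟩)
    · rw [h.virt' m t hp] at hv
      refine (h.live' _).2 (.inr ⟨hG.virt_live hv, ?_⟩)
      rintro rfl
      rw [h.virt_y] at hv; cases hv

theorem good {P : Bool → Prop} {n : ℕ} (hg : G.Good k P n) (hn : n ≠ z)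
    (hP : ∀ b, G'.Res k b (some root) → P b) : G'.Good k P n := by
  refine hg.transfer (w := x) {m | m ≠ z} (h.inv hG) hP h.live_x ?_
    (fun m t _ _ e e' => h.child_ne m t (e' ▸ e)) hn ?_ ?_ ?_
  · exact (h.live' _).2 (.inr ⟨h.live_x, (h.y_ne_x hG).symm⟩)
  · exact fun m h2 h1 => ⟨h.key' m h2, funext fun t => h.child' m t h2 (fun e => h1 e.1), h.del' m h2⟩
  · exact fun m hm hl => (((h.live' m).1 hl).resolve_left hm).1
  · intro m hm hl hpm
    have hmz := h.ne_z hG hm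
    refine Hits.path (h.hits hG (((h.live' m).1 hl).resolve_left hmz).2 (h.root_ne hG).2.2
      (hG.hits_of_path hG.root_live hm hpm) (h.root_gen hG))

end Rotate
end Graph

/-! ### Memory with auxiliary state -/

@[simp] theorem Node.setChild_key (n : Node T K) (s v) : (n.setChild s v).key = n.key := by
  cases s <;> rfl
@[simp] theorem Node.setChild_del (n : Node T K) (s v) : (n.setChild s v).del = n.del := by
  cases s <;> rfl
@[simp] theorem Node.setChild_rem (n : Node T K) (s v) : (n.setChild s v).rem = n.rem := by
  cases s <;> rfl
@[simp] theorem Node.setChild_lock (n : Node T K) (s v) : (n.setChild s v).lock = n.lock := by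
  cases s <;> rfl
@[simp] theorem Node.setChild_child (n : Node T K) (s v) : (n.setChild s v).child s = v := by
  cases s <;> rfl
theorem Node.setChild_child_of_ne (n : Node T K) {s t : Side} (v) (h : t ≠ s) :
    (n.setChild s v).child t = n.child t := by
  cases s <;> cases t <;> first | rfl | exact (h rfl).elim

theorem Heap.modify_mem_self (H : Heap T K) (l : ℕ) (f : Node T K → Node T K) :
    (H.modify l f).mem l = f (H.mem l) := by simp [Heap.modify]

theorem Heap.modify_mem_of_ne (H : Heap T K) {l m : ℕ} (f : Node T K → Node T K) (h : m ≠ l) :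
    (H.modify l f).mem m = H.mem m := by simp [Heap.modify, h]

/-- The state of a location: not allocated, known to the allocating thread only, part of the
logical tree, or cut off from it. -/
inductive Status (T : Type*)
  | free
  | priv (t : T)
  | live
  | gone

/-- Auxiliary state: the status of each location and the virtual edges of the search graph. -/
structure Ghost (T : Type*) where
  st : ℕ → Status T
  virt : ℕ → Side → Option ℕ

/-- A location is public when it is or was part of the logical tree. -/
def Ghost.Pub (g : Ghost T) (n : ℕ) : Prop := g.st n = .live ∨ g.st n = .gone

open Classical in
/-- The search graph formed by the public nodes.  The other locations, which no search meets, get fixed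
contents, so that writing to them leaves the graph unchanged. -/
noncomputable def shape (H : Heap T K) (g : Ghost T) : Graph K where
  key n := if g.Pub n then (H.mem n).key else ⊤
  child n s := if g.Pub n then (H.mem n).child s else none
  del n := if g.Pub n then (H.mem n).del else false
  live := {n | g.st n = .live}
  virt := g.virt

section shape
variable {H : Heap T K} {g : Ghost T} {n : ℕ}

theorem shape_key (h : g.Pub n) : (shape H g).key n = (H.mem n).key := if_pos h
theorem shape_child (h : g.Pub n) (s : Side) : (shape H g).child n s = (H.mem n).child s := if_pos h
theorem shape_del (h : g.Pub n) : (shape H g).del n = (H.mem n).del := if_pos h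
theorem mem_live : n ∈ (shape H g).live ↔ g.st n = .live := Iff.rfl

end shape

/-- The invariant of the memory.  The flag `rem` is read only under the lock, so while a node is locked its
flag may lag behind its status.  In the same way virtual edges exist only at locked nodes. -/
structure HInv (H : Heap T K) (g : Ghost T) : Prop where
  graph : (shape H g).Inv
  closed : ∀ {n s m}, g.Pub n → (H.mem n).child s = some m → g.Pub m
  alloc : ∀ {n}, g.st n ≠ .free → n ∈ H.alloc
  rem_live : ∀ {n}, g.st n = .live → (H.mem n).rem = false
  rem_gone : ∀ {n}, g.st n = .gone → (H.mem n).rem = true ∨ (H.mem n).lock ≠ none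
  virt_lock : ∀ {n s}, g.virt n s ≠ none → (H.mem n).lock ≠ none

namespace HInv

variable {H : Heap T K} {g : Ghost T} (h : HInv H g)
include h

theorem pub_root : g.Pub root := .inl h.graph.root_live

theorem child_ne {z : ℕ} (hz : ¬ g.Pub z) (m : ℕ) (t : Side) : (shape H g).child m t ≠ some z := by
  by_cases hm : g.Pub m
  · rw [shape_child hm]; exact fun e => hz (h.closed hm e)
  · simp [shape, hm]

theorem virt_ne {z : ℕ} (hz : ¬ g.Pub z) (m : ℕ) (t : Side) : (shape H g).virt m t ≠ some z :=
  fun e => hz (.inl (h.graph.edge_live ⟨h.graph.virt_live e, Graph.star_of_virt e⟩))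

theorem path_pub {k : K} {n m : ℕ} (hn : g.Pub n) (hp : (shape H g).Path k n m) : g.Pub m := by
  induction hp with
  | refl => exact hn
  | tail _ hs ih =>
    obtain ⟨s, -, hc⟩ := hs
    rw [shape_child ih] at hc
    exact h.closed ih hc

theorem searchPath_iff {k : K} {n m : ℕ} (hn : g.Pub n) :
    SearchPath H k n m ↔ (shape H g).Path k n m := by
  have key : ∀ {a b}, g.Pub a → (NextChild H k a b ↔ (shape H g).PStep k a b) := by
    intro a b ha
    unfold NextChild Graph.PStep
    rw [shape_key ha]
    constructor
    · rintro (⟨h1, h2⟩ | ⟨h1, h2⟩)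
      · exact ⟨.left, h1, by rw [shape_child ha]; exact h2⟩
      · exact ⟨.right, h1, by rw [shape_child ha]; exact h2⟩
    · rintro ⟨s, h1, h2⟩
      rw [shape_child ha] at h2
      cases s
      · exact .inl ⟨h1, h2⟩
      · exact .inr ⟨h1, h2⟩
  constructor
  · intro hp
    induction hp with
    | refl => exact .refl
    | tail _ hs ih => exact ih.tail ((key (h.path_pub hn ih)).1 hs)
  · intro hp
    induction hp with
    | refl => exact .refl
    | tail hp hs ih => exact ih.tail ((key (h.path_pub hn hp)).2 hs)

/-- The abstract set holds the keys that searches from the root find. -/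
theorem mem_absSet {k : K} {b : Bool} (hb : (shape H g).Res k b (some root)) :
    b = true ↔ k ∈ absSet H := by
  rw [hb.true_iff]
  constructor
  · rintro ⟨n, h1, h2, h3⟩
    have hn := h.path_pub h.pub_root h1
    rw [shape_key hn] at h2
    rw [shape_del hn] at h3
    exact ⟨n, (h.searchPath_iff h.pub_root).2 h1, h2, h3⟩
  · rintro ⟨n, h1, h2, h3⟩
    have h1 := (h.searchPath_iff h.pub_root).1 h1
    have hn := h.path_pub h.pub_root h1
    exact ⟨n, h1, by rw [shape_key hn, h2], by rw [shape_del hn, h3]⟩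

theorem edge_of_child {m n : ℕ} {s : Side} (hm : g.st m = .live) (hv : g.virt m s = none)
    (hc : (H.mem m).child s = some n) : (shape H g).Edge s m n :=
  h.graph.edge_of_child hm hv (by rwa [shape_child (.inl hm)])

theorem live_of_child {m n : ℕ} {s : Side} (hm : g.st m = .live) (hv : g.virt m s = none)
    (hc : (H.mem m).child s = some n) : g.st n = .live :=
  h.graph.edge_live (h.edge_of_child hm hv hc)

end HInv

/-! ### Actions that other threads tolerate -/

/-- An action of thread `t` takes memory and auxiliary state from `H`, `g` to `H'`, `g'`: it
preserves the invariant and does not disturb what other threads rely on. -/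
structure Effect (t : T) (H : Heap T K) (g : Ghost T) (H' : Heap T K) (g' : Ghost T) : Prop where
  inv : HInv H' g'
  pub : ∀ {l}, g.Pub l → g'.Pub l
  key : ∀ {l}, g.Pub l → (H'.mem l).key = (H.mem l).key
  good : ∀ {k P n}, g.Pub n → (shape H g).Good k P n →
    (∀ b, (shape H' g').Res k b (some root) → P b) → (shape H' g').Good k P n
  own : ∀ {t' l}, t' ≠ t → g.Pub l → (H.mem l).lock = some t' →
    H'.mem l = H.mem l ∧ g'.st l = g.st l ∧ g'.virt l = g.virt l
  priv : ∀ {t' l}, t' ≠ t → g.st l = .priv t' → g'.st l = g.st l ∧ H'.mem l = H.mem l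

section effects

variable {H H' : Heap T K} {g g' : Ghost T} {t : T}

theorem Effect.refl (h : HInv H g) : Effect t H g H g where
  inv := h
  pub := id
  key _ := rfl
  good _ h _ := h
  own _ _ _ := ⟨rfl, rfl, rfl⟩
  priv _ _ := ⟨rfl, rfl⟩

theorem shape_eq (hst : ∀ l, g.Pub l ↔ g'.Pub l) (hlive : ∀ l, g.st l = .live ↔ g'.st l = .live)
    (hvirt : g'.virt = g.virt)
    (hkey : ∀ l, g.Pub l → (H'.mem l).key = (H.mem l).key)
    (hchild : ∀ l s, g.Pub l → (H'.mem l).child s = (H.mem l).child s)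
    (hdel : ∀ l, g.Pub l → (H'.mem l).del = (H.mem l).del) : shape H' g' = shape H g := by
  unfold shape
  congr 1
  · funext l
    by_cases hl : g.Pub l
    · rw [if_pos hl, if_pos ((hst l).1 hl), hkey l hl]
    · rw [if_neg hl, if_neg fun h => hl ((hst l).2 h)]
  · funext l s
    by_cases hl : g.Pub l
    · rw [if_pos hl, if_pos ((hst l).1 hl), hchild l s hl]
    · rw [if_neg hl, if_neg fun h => hl ((hst l).2 h)]
  · funext l
    by_cases hl : g.Pub l
    · rw [if_pos hl, if_pos ((hst l).1 hl), hdel l hl]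
    · rw [if_neg hl, if_neg fun h => hl ((hst l).2 h)]
  · ext l; exact (hlive l).symm

theorem Ghost.Pub.ne_priv {l : ℕ} (h : g.Pub l) : g.st l ≠ .priv t := by
  intro e
  rcases h with h | h <;> rw [e] at h <;> cases h

theorem Ghost.not_pub_of_priv {l : ℕ} (h : g.st l = .priv t) : ¬ g.Pub l :=
  fun hp => hp.ne_priv h

theorem shape_modify {l : ℕ} {f : Node T K → Node T K}
    (hkey : (f (H.mem l)).key = (H.mem l).key) (hchild : ∀ s, (f (H.mem l)).child s = (H.mem l).child s)
    (hdel : (f (H.mem l)).del = (H.mem l).del) : shape (H.modify l f) g = shape H g := by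
  have hm : ∀ m, ((H.modify l f).mem m).key = (H.mem m).key ∧
      (∀ s, ((H.modify l f).mem m).child s = (H.mem m).child s) ∧
      ((H.modify l f).mem m).del = (H.mem m).del := by
    intro m
    by_cases e : m = l
    · subst e; rw [H.modify_mem_self]; exact ⟨hkey, hchild, hdel⟩
    · rw [H.modify_mem_of_ne f e]; exact ⟨rfl, fun _ => rfl, rfl⟩
  exact shape_eq (fun _ => Iff.rfl) (fun _ => Iff.rfl) rfl (fun l _ => (hm l).1)
    (fun l s _ => (hm l).2.1 s) (fun l _ => (hm l).2.2)

/-- Changing the lock or the mark of a public node that no other thread has locked. -/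
theorem effect_modify (h : HInv H g) {l : ℕ} {f : Node T K → Node T K} (hl : g.Pub l)
    (hlock : ∀ t', t' ≠ t → (H.mem l).lock ≠ some t')
    (hkey : (f (H.mem l)).key = (H.mem l).key) (hchild : ∀ s, (f (H.mem l)).child s = (H.mem l).child s)
    (hdel : (f (H.mem l)).del = (H.mem l).del) (hlive : g.st l = .live → (f (H.mem l)).rem = false)
    (hgone : g.st l = .gone → (f (H.mem l)).rem = true ∨ (f (H.mem l)).lock ≠ none)
    (hvirt : ∀ s, g.virt l s ≠ none → (f (H.mem l)).lock ≠ none) :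
    Effect t H g (H.modify l f) g := by
  have hs : shape (H.modify l f) g = shape H g := shape_modify hkey hchild hdel
  have hm : ∀ {m}, m ≠ l → (H.modify l f).mem m = H.mem m := fun e => H.modify_mem_of_ne f e
  refine ⟨⟨hs ▸ h.graph, ?_, fun hn => h.alloc hn, ?_, ?_, ?_⟩, id, ?_, ?_, ?_, ?_⟩
  · intro n s m hn hc
    by_cases e : n = l
    · subst e; rw [H.modify_mem_self, hchild] at hc; exact h.closed hn hc
    · rw [hm e] at hc; exact h.closed hn hc
  · intro n hn
    by_cases e : n = l
    · subst e; rw [H.modify_mem_self]; exact hlive hn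
    · rw [hm e]; exact h.rem_live hn
  · intro n hn
    by_cases e : n = l
    · subst e; rw [H.modify_mem_self]; exact hgone hn
    · rw [hm e]; exact h.rem_gone hn
  · intro n s hn
    by_cases e : n = l
    · subst e; rw [H.modify_mem_self]; exact hvirt s hn
    · rw [hm e]; exact h.virt_lock hn
  · intro n hn
    by_cases e : n = l
    · subst e; rw [H.modify_mem_self]; exact hkey
    · rw [hm e]
  · intro k P n hn hg hP
    rw [hs]; exact hg
  · intro t' n ht' hn hlk
    have e : n ≠ l := by rintro rfl; exact hlock t' ht' hlk
    exact ⟨hm e, rfl, rfl⟩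
  · intro t' n ht' hn
    have e : n ≠ l := by rintro rfl; exact hl.ne_priv hn
    exact ⟨rfl, hm e⟩

/-- Allocating or changing a private node. -/
theorem effect_priv (h : HInv H g) {z : ℕ} (hz : g.st z = .free ∨ g.st z = .priv t)
    (hmem : ∀ m, m ≠ z → H'.mem m = H.mem m) (halloc : H.alloc ⊆ H'.alloc) (hza : z ∈ H'.alloc)
    (hst : ∀ m, m ≠ z → g'.st m = g.st m) (hstz : g'.st z = .priv t) (hvirt : g'.virt = g.virt) :
    Effect t H g H' g' ∧ shape H' g' = shape H g := by
  have hzp : ¬ g.Pub z := by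
    rintro (e | e) <;> rcases hz with hz | hz <;> rw [hz] at e <;> cases e
  have hzp' : ¬ g'.Pub z := Ghost.not_pub_of_priv hstz
  have hne : ∀ {m}, g.Pub m → m ≠ z := fun hm e => hzp (e ▸ hm)
  have hpub : ∀ l, g.Pub l ↔ g'.Pub l := by
    intro l
    by_cases e : l = z
    · subst e; exact iff_of_false hzp hzp'
    · unfold Ghost.Pub; rw [hst l e]
  have hlive : ∀ l, g.st l = .live ↔ g'.st l = .live := by
    intro l
    by_cases e : l = z
    · subst e; exact iff_of_false (fun e => hzp (.inl e)) (fun e => hzp' (.inl e))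
    · rw [hst l e]
  have hs : shape H' g' = shape H g := shape_eq hpub hlive hvirt
    (fun l hl => by rw [hmem l (hne hl)]) (fun l s hl => by rw [hmem l (hne hl)])
    (fun l hl => by rw [hmem l (hne hl)])
  refine ⟨⟨⟨hs ▸ h.graph, ?_, ?_, ?_, ?_, ?_⟩, fun hl => (hpub _).1 hl, fun hl => by rw [hmem _ (hne hl)],
    fun hn hg hP => by rwa [hs], ?_, ?_⟩, hs⟩
  · intro n s m hn hc
    rw [← hpub] at hn
    rw [hmem n (hne hn)] at hc
    exact (hpub _).1 (h.closed hn hc)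
  · intro n hn
    by_cases e : n = z
    · rwa [e]
    · rw [hst n e] at hn; exact halloc (h.alloc hn)
  · intro n hn
    have hn := (hlive n).2 hn
    rw [hmem n (hne (.inl hn))]; exact h.rem_live hn
  · intro n hn
    have e : n ≠ z := fun e => hzp' (e ▸ .inr hn)
    rw [hst n e] at hn
    rw [hmem n e]; exact h.rem_gone hn
  · intro n s hn
    rw [hvirt] at hn
    have hl : g.st n = .live := by
      cases hv : g.virt n s with
      | none => exact (hn hv).elim
      | some x => exact h.graph.virt_live hv
    rw [hmem n (hne (.inl hl))]; exact h.virt_lock hn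
  · intro t' l ht' hl hlk
    exact ⟨hmem l (hne hl), hst l (hne hl), by rw [hvirt]⟩
  · intro t' l ht' hl
    have e : l ≠ z := by
      rintro rfl
      rcases hz with hz | hz <;> rw [hz] at hl <;> cases hl
      exact ht' rfl
    exact ⟨hst l e, hmem l e⟩

/-- Writing a child pointer or the flag of a locked node, together with changes of the auxiliary
state: the acting thread may publish its private nodes and cut off nodes that it has locked. -/
theorem effect_write (h : HInv H g) {w : ℕ} {f : Node T K → Node T K} (hw : g.Pub w)
    (hlock : (H.mem w).lock = some t)
    (hf : (f (H.mem w)).key = (H.mem w).key ∧ (f (H.mem w)).rem = (H.mem w).rem ∧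
      (f (H.mem w)).lock = (H.mem w).lock)
    (hinv : (shape (H.modify w f) g').Inv)
    (hgood : ∀ {k P n}, g.Pub n → (shape H g).Good k P n →
      (∀ b, (shape (H.modify w f) g').Res k b (some root) → P b) →
      (shape (H.modify w f) g').Good k P n)
    (hst : ∀ l, g'.st l = g.st l ∨ (g.st l = .priv t ∧ g'.st l = .live ∧ (H.mem l).rem = false ∧
      ∀ s u, (H.mem l).child s = some u → g.Pub u) ∨
      (g.st l = .live ∧ (H.mem l).lock = some t ∧ g'.st l = .gone))
    (hvirt : ∀ l, g'.virt l = g.virt l ∨ (H.mem l).lock = some t)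
    (hv : ∀ s u, (f (H.mem w)).child s = some u → g'.Pub u) :
    Effect t H g (H.modify w f) g' := by
  set H' := H.modify w f with hH'
  have hww : H'.mem w = f (H.mem w) := H.modify_mem_self w _
  have hm : ∀ {m}, m ≠ w → H'.mem m = H.mem m := fun e => H.modify_mem_of_ne _ e
  have hkey : ∀ m, (H'.mem m).key = (H.mem m).key ∧ (H'.mem m).rem = (H.mem m).rem ∧
      (H'.mem m).lock = (H.mem m).lock := by
    intro m
    by_cases e : m = w
    · subst e; rwa [hww]
    · rw [hm e]; simp
  have hpub : ∀ {l}, g.Pub l → g'.Pub l := by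
    intro l hl
    rcases hst l with e | ⟨e, -⟩ | ⟨-, -, e⟩
    · unfold Ghost.Pub; rwa [e]
    · exact (hl.ne_priv e).elim
    · exact .inr e
  refine ⟨⟨hinv, ?_, ?_, ?_, ?_, ?_⟩, hpub, fun _ => (hkey _).1, hgood, ?_, ?_⟩
  · intro n s' m hn hc
    by_cases e : n = w
    · subst e
      rw [hww] at hc
      exact hv _ _ hc
    · rw [hm e] at hc
      rcases hst n with e | ⟨-, -, -, hp⟩ | ⟨e, -⟩
      · exact hpub (h.closed (by unfold Ghost.Pub at hn ⊢; rwa [e] at hn) hc)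
      · exact hpub (hp _ _ hc)
      · exact hpub (h.closed (.inl e) hc)
  · intro n hn
    refine h.alloc fun e => hn ?_
    rcases hst n with e' | ⟨e', -⟩ | ⟨e', -⟩
    · rw [e', e]
    · rw [e] at e'; cases e'
    · rw [e] at e'; cases e'
  · intro n hn
    rw [(hkey n).2.1]
    rcases hst n with e | ⟨-, -, e, -⟩ | ⟨-, -, e⟩
    · exact h.rem_live (e ▸ hn)
    · exact e
    · rw [hn] at e; cases e
  · intro n hn
    rw [(hkey n).2.1, (hkey n).2.2]
    rcases hst n with e | ⟨-, e, -⟩ | ⟨-, e, -⟩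
    · exact h.rem_gone (e ▸ hn)
    · rw [hn] at e; cases e
    · right; rw [e]; simp
  · intro n s' hn
    rw [(hkey n).2.2]
    rcases hvirt n with e | e
    · exact h.virt_lock (e ▸ hn)
    · rw [e]; simp
  · intro t' l ht' hl hlk
    have hnt : (H.mem l).lock ≠ some t := by rw [hlk]; simpa using ht'
    have e : l ≠ w := fun e => hnt (e ▸ hlock)
    refine ⟨hm e, ?_, ?_⟩
    · rcases hst l with e | ⟨e, -⟩ | ⟨-, e, -⟩
      · exact e
      · exact (hl.ne_priv e).elim
      · exact (hnt e).elim
    · exact (hvirt l).resolve_right hnt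
  · intro t' l ht' hl
    have e : l ≠ w := fun e => hw.ne_priv (e ▸ hl)
    refine ⟨?_, hm e⟩
    rcases hst l with e | ⟨e, -⟩ | ⟨e, -⟩
    · exact e
    · rw [hl] at e; cases e; exact (ht' rfl).elim
    · rw [hl] at e; cases e

end effects

/-! ### Locked nodes -/

section owned

/-- Thread `t` holds the lock of `l`, at which no virtual edge starts; a node that is cut off has been
marked. -/
structure Own (H : Heap T K) (g : Ghost T) (t : T) (l : ℕ) : Prop where
  pub : g.Pub l
  lock : (H.mem l).lock = some t
  virt : ∀ s, g.virt l s = none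
  rem : g.st l = .gone → (H.mem l).rem = true

/-- Thread `t` holds the lock of the live node `l`, at which no virtual edge starts. -/
structure OwnLive (H : Heap T K) (g : Ghost T) (t : T) (l : ℕ) : Prop where
  live : g.st l = .live
  lock : (H.mem l).lock = some t
  virt : ∀ s, g.virt l s = none

/-- Thread `t` holds the lock of `l`, which it has cut off but need not have marked yet. -/
structure Cut (H : Heap T K) (g : Ghost T) (t : T) (l : ℕ) : Prop where
  gone : g.st l = .gone
  lock : (H.mem l).lock = some t
  virt : ∀ s, g.virt l s = none

variable {H H' : Heap T K} {g g' : Ghost T} {t : T} {l : ℕ}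

theorem OwnLive.pub (h : OwnLive H g t l) : g.Pub l := .inl h.live

theorem Cut.pub (h : Cut H g t l) : g.Pub l := .inr h.gone

theorem OwnLive.own (h : OwnLive H g t l) : Own H g t l :=
  ⟨h.pub, h.lock, h.virt, fun e => by rw [h.live] at e; cases e⟩

theorem Own.ownLive (h : Own H g t l) (hr : (H.mem l).rem = false) : OwnLive H g t l := by
  refine ⟨h.pub.resolve_right fun e => ?_, h.lock, h.virt⟩
  rw [h.rem e] at hr; cases hr

theorem Own.congr (h : Own H g t l) (hm : H'.mem l = H.mem l) (hs : g'.st l = g.st l)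
    (hv : g'.virt l = g.virt l) : Own H' g' t l :=
  ⟨by unfold Ghost.Pub; rw [hs]; exact h.pub, by rw [hm]; exact h.lock,
    by rw [hv]; exact h.virt, by rw [hs, hm]; exact h.rem⟩

theorem OwnLive.congr (h : OwnLive H g t l) (hm : H'.mem l = H.mem l) (hs : g'.st l = g.st l)
    (hv : g'.virt l = g.virt l) : OwnLive H' g' t l :=
  ⟨by rw [hs]; exact h.live, by rw [hm]; exact h.lock, by rw [hv]; exact h.virt⟩

theorem Cut.congr (h : Cut H g t l) (hm : H'.mem l = H.mem l) (hs : g'.st l = g.st l)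
    (hv : g'.virt l = g.virt l) : Cut H' g' t l :=
  ⟨by rw [hs]; exact h.gone, by rw [hm]; exact h.lock, by rw [hv]; exact h.virt⟩

variable {t' : T} (E : Effect t' H g H' g') (ht : t ≠ t')
include E ht

theorem Own.stable (h : Own H g t l) : Own H' g' t l :=
  have e := E.own ht h.pub h.lock
  h.congr e.1 e.2.1 e.2.2

theorem Own.mem_eq (h : Own H g t l) : H'.mem l = H.mem l := (E.own ht h.pub h.lock).1

theorem OwnLive.stable (h : OwnLive H g t l) : OwnLive H' g' t l :=
  have e := E.own ht h.pub h.lock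
  h.congr e.1 e.2.1 e.2.2

theorem OwnLive.mem_eq (h : OwnLive H g t l) : H'.mem l = H.mem l := (E.own ht h.pub h.lock).1

theorem Cut.stable (h : Cut H g t l) : Cut H' g' t l :=
  have e := E.own ht h.pub h.lock
  h.congr e.1 e.2.1 e.2.2

end owned

/-! ### The invariant of a thread -/

/-- The state of the current operation of a thread: there is none, it awaits its linearization and
`P` holds of the answers that were right about its key at some moment since its invocation, or it
has been linearized with return value `b`. -/
inductive Ctx (K : Type*)
  | idle
  | todo (o : SetOp K) (P : Bool → Prop)
  | done (b : Bool)

/-- More answers may become admissible as time passes. -/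
inductive Ctx.Le : Ctx K → Ctx K → Prop
  | refl {c} : Ctx.Le c c
  | todo {o P Q} (h : ∀ b, P b → Q b) : Ctx.Le (.todo o P) (.todo o Q)

/-- The answer that is right for the abstract set `S` is admissible. -/
def Ctx.Valid : Ctx K → Set K → Prop
  | .todo o P, S => ∀ b : Bool, (b = true ↔ o.key ∈ S) → P b
  | _, _ => True

/-- What `locate`, called by `c`, knows about a node that it has reached. -/
def Trav (H : Heap T K) (g : Ghost T) (ctx : Ctx K) (c : Call K) (n : ℕ) : Prop :=
  g.Pub n ∧ match c with
    | .op o => ∃ P, ctx = .todo o P ∧ (shape H g).Good o.key P n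
    | .aux _ _ => ctx = .idle

/-- `locate`, called by the operation `o`, has found the node `n`. -/
def At (H : Heap T K) (g : Ghost T) (ctx : Ctx K) (o : SetOp K) (n : ℕ) : Prop :=
  Trav H g ctx (.op o) n ∧ (H.mem n).key = o.key

/-- What is left to do after releasing the locks agrees with the state of the operation. -/
def After.Ok (ctx : Ctx K) : After K → Prop
  | .ret b => ctx = .done b
  | .restart o => ∃ P, ctx = .todo o P
  | .done => ctx = .idle

/-- A thread that removes `y`, the child of `z` on side `s`, has locked both. -/
structure Rmv (H : Heap T K) (g : Ghost T) (t : T) (s : Side) (z y : ℕ) : Prop where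
  ownZ : OwnLive H g t z
  ownY : OwnLive H g t y
  ne : z ≠ y
  child : (H.mem z).child s = some y

/-- A thread that rotates has locked `p`, its child `y` on side `c`, and the child `x` of `y` on
side `d`. -/
structure Rot (H : Heap T K) (g : Ghost T) (t : T) (c d : Side) (p y x : ℕ) : Prop where
  ownP : OwnLive H g t p
  ownY : OwnLive H g t y
  ownX : OwnLive H g t x
  ne : [p, y, x].Nodup
  child_p : (H.mem p).child c = some y
  child_y : (H.mem y).child d = some x

/-- What holds of the memory when thread `t` is at a control point. -/
def TInv (H : Heap T K) (g : Ghost T) (t : T) (ctx : Ctx K) : PC K → Prop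
  | .idle => ctx = .idle
  | .ret b => ctx = .done b
  | .release held a => held.Nodup ∧ (∀ l ∈ held, Own H g t l) ∧ a.Ok ctx
  | .locKey c x y => Trav H g ctx c x ∧ Trav H g ctx c y
  | .locCmp c x => Trav H g ctx c x ∧ (H.mem x).key ≠ c.key
  | .locNext c s x => Trav H g ctx c x ∧ s.Of c.key (H.mem x).key
  | .conDel y => ∃ k, At H g ctx (.contains k) y
  | .delLock k y => At H g ctx (.delete k) y
  | .delRem k y => At H g ctx (.delete k) y ∧ Own H g t y
  | .delDel y => ∃ k, At H g ctx (.delete k) y ∧ OwnLive H g t y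
  | .delSet y r => ∃ k, At H g ctx (.delete k) y ∧ OwnLive H g t y ∧ r = !(H.mem y).del
  | .insLockY k y => At H g ctx (.insert k) y
  | .insRemY k y => At H g ctx (.insert k) y ∧ Own H g t y
  | .insDelY y => ∃ k, At H g ctx (.insert k) y ∧ OwnLive H g t y
  | .insSetY y r => ∃ k, At H g ctx (.insert k) y ∧ OwnLive H g t y ∧ r = (H.mem y).del
  | .insLockX k x => Trav H g ctx (.op (.insert k)) x
  | .insRemX k x => Trav H g ctx (.op (.insert k)) x ∧ Own H g t x
  | .insKey1 k x => Trav H g ctx (.op (.insert k)) x ∧ OwnLive H g t x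
  | .insLeft k x => Trav H g ctx (.op (.insert k)) x ∧ OwnLive H g t x ∧
      Side.left.Of k (H.mem x).key
  | .insKey2 k x => Trav H g ctx (.op (.insert k)) x ∧ OwnLive H g t x
  | .insRight k x => Trav H g ctx (.op (.insert k)) x ∧ OwnLive H g t x ∧
      Side.right.Of k (H.mem x).key
  | .insNew k s x => Trav H g ctx (.op (.insert k)) x ∧ OwnLive H g t x ∧ s.Of k (H.mem x).key ∧
      (H.mem x).child s = none
  | .insLink s x n => ∃ k : K, Trav H g ctx (.op (.insert k)) x ∧ OwnLive H g t x ∧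
      s.Of k (H.mem x).key ∧ (H.mem x).child s = none ∧ g.st n = .priv t ∧ H.mem n = Node.fresh k
  | .rmvLockZ _ z => ctx = .idle ∧ g.Pub z
  | .rmvY _ z => ctx = .idle ∧ Own H g t z
  | .rmvRemZ s z y => ctx = .idle ∧ Own H g t z ∧ (H.mem z).child s = some y
  | .rmvLockY s z y => ctx = .idle ∧ OwnLive H g t z ∧ (H.mem z).child s = some y
  | .rmvDel s z y => ctx = .idle ∧ Rmv H g t s z y
  | .rmvInner s z y => ctx = .idle ∧ Rmv H g t s z y ∧ (H.mem y).del = true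
  | .rmvGetOuter s z y => ctx = .idle ∧ Rmv H g t s z y ∧ (H.mem y).del = true ∧
      (H.mem y).child s.flip = none
  | .rmvOuter s z y => ctx = .idle ∧ Rmv H g t s z y ∧ (H.mem y).del = true
  | .rmvGetInner s z y => ctx = .idle ∧ Rmv H g t s z y ∧ (H.mem y).del = true ∧
      (H.mem y).child s = none
  | .rmvLink s z y v => ctx = .idle ∧ Rmv H g t s z y ∧ (H.mem y).del = true ∧
      ∃ e : Side, (H.mem y).child e = none ∧ (H.mem y).child e.flip = v
  | .rmvMark z y => ctx = .idle ∧ Own H g t z ∧ Cut H g t y ∧ z ≠ y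
  | .rotLockP _ _ p => ctx = .idle ∧ g.Pub p
  | .rotY _ _ p => ctx = .idle ∧ Own H g t p
  | .rotRemP c _ p y => ctx = .idle ∧ Own H g t p ∧ (H.mem p).child c = some y
  | .rotLockY c _ p y => ctx = .idle ∧ OwnLive H g t p ∧ (H.mem p).child c = some y
  | .rotX c _ p y => ctx = .idle ∧ Rmv H g t c p y
  | .rotLockX c d p y x => ctx = .idle ∧ Rmv H g t c p y ∧ (H.mem y).child d = some x
  | .dupKey c d p y x => ctx = .idle ∧ Rot H g t c d p y x
  | .dupLeft c d p y x q => ctx = .idle ∧ Rot H g t c d p y x ∧ (H.mem y).key = q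
  | .dupRight c d p y x q l => ctx = .idle ∧ Rot H g t c d p y x ∧ (H.mem y).key = q ∧
      (H.mem y).left = l
  | .dupDel c d p y x q l r => ctx = .idle ∧ Rot H g t c d p y x ∧ (H.mem y).key = q ∧
      (H.mem y).left = l ∧ (H.mem y).right = r
  | .dupRem c d p y x q l r b => ctx = .idle ∧ Rot H g t c d p y x ∧ (H.mem y).key = q ∧
      (H.mem y).left = l ∧ (H.mem y).right = r ∧ (H.mem y).del = b
  | .dupNew c d p y x q l r b b' => ctx = .idle ∧ Rot H g t c d p y x ∧ (H.mem y).key = q ∧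
      (H.mem y).left = l ∧ (H.mem y).right = r ∧ (H.mem y).del = b ∧ (H.mem y).rem = b'
  | .rotGet c d p y x z => ctx = .idle ∧ Rot H g t c d p y x ∧ g.st z = .priv t ∧
      H.mem z = { H.mem y with lock := none }
  | .rotSetZ c d p y x z v => ctx = .idle ∧ Rot H g t c d p y x ∧ g.st z = .priv t ∧
      H.mem z = { H.mem y with lock := none } ∧ (H.mem x).child d.flip = v
  | .rotSetX c d p y x z => ctx = .idle ∧ Rot H g t c d p y x ∧ g.st z = .priv t ∧
      H.mem z = Node.setChild { H.mem y with lock := none } d ((H.mem x).child d.flip)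
  | .rotSetP c p y x => ctx = .idle ∧ g.st p = .live ∧ (H.mem p).lock = some t ∧
      g.virt p c = some x ∧ (∀ s, s ≠ c → g.virt p s = none) ∧ Cut H g t y ∧ Own H g t x ∧
      [p, y, x].Nodup
  | .rotMark p y x => ctx = .idle ∧ Own H g t p ∧ Cut H g t y ∧ Own H g t x ∧ [p, y, x].Nodup

/-! ### Stability under the actions of other threads -/

section stable

variable {H H' : Heap T K} {g g' : Ghost T} {t t' : T} {ctx ctx' : Ctx K}

theorem Effect.valid_good (E : Effect t' H g H' g') {k : K} {P : Bool → Prop}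
    (hP : ∀ b : Bool, (b = true ↔ k ∈ absSet H') → P b) {b : Bool}
    (hb : (shape H' g').Res k b (some root)) : P b :=
  hP b (E.inv.mem_absSet hb)

theorem Trav.effect {c : Call K} {n : ℕ} (h : Trav H g ctx c n) (E : Effect t' H g H' g')
    (hle : ctx.Le ctx') (hv : ctx'.Valid (absSet H')) : Trav H' g' ctx' c n := by
  obtain ⟨hn, h⟩ := h
  refine ⟨E.pub hn, ?_⟩
  cases c with
  | op o =>
    obtain ⟨P, rfl, h⟩ := h
    cases hle with
    | refl => exact ⟨P, rfl, E.good hn h fun b hb => E.valid_good hv hb⟩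
    | todo hle => exact ⟨_, rfl, E.good hn (h.mono hle) fun b hb => E.valid_good hv hb⟩
  | aux a k =>
    cases h; cases hle; rfl

theorem At.effect {o : SetOp K} {n : ℕ} (h : At H g ctx o n) (E : Effect t' H g H' g')
    (hle : ctx.Le ctx') (hv : ctx'.Valid (absSet H')) : At H' g' ctx' o n :=
  ⟨h.1.effect E hle hv, (E.key h.1.1).trans h.2⟩

theorem After.Ok.mono {a : After K} (h : a.Ok ctx) (hle : ctx.Le ctx') : a.Ok ctx' := by
  cases hle with
  | refl => exact h
  | todo hle =>
    cases a with
    | ret b => cases h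
    | restart o => obtain ⟨P, h⟩ := h; cases h; exact ⟨_, rfl⟩
    | done => cases h

theorem Ctx.Le.idle (hle : ctx.Le ctx') (h : ctx = .idle) : ctx' = .idle := by
  subst h; cases hle; rfl

theorem Rmv.stable {s : Side} {z y : ℕ} (h : Rmv H g t s z y) (E : Effect t' H g H' g') (ht : t ≠ t') :
    Rmv H' g' t s z y :=
  ⟨h.ownZ.stable E ht, h.ownY.stable E ht, h.ne, by rw [h.ownZ.mem_eq E ht]; exact h.child⟩

theorem Rot.stable {c d : Side} {p y x : ℕ} (h : Rot H g t c d p y x) (E : Effect t' H g H' g')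
    (ht : t ≠ t') : Rot H' g' t c d p y x :=
  ⟨h.ownP.stable E ht, h.ownY.stable E ht, h.ownX.stable E ht, h.ne, by rw [h.ownP.mem_eq E ht]; exact h.child_p,
    by rw [h.ownY.mem_eq E ht]; exact h.child_y⟩

/-- What a thread knows survives the actions of other threads. -/
theorem TInv.stable {q : PC K} (h : TInv H g t ctx q) (E : Effect t' H g H' g') (ht : t ≠ t')
    (hle : ctx.Le ctx') (hv : ctx'.Valid (absSet H')) : TInv H' g' t ctx' q := by
  cases q <;> simp only [TInv] at h ⊢
  case idle => exact hle.idle h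
  case ret b => subst h; cases hle; rfl
  case release held a =>
    exact ⟨h.1, fun l hl => (h.2.1 l hl).stable E ht, h.2.2.mono hle⟩
  case locKey c x y => exact ⟨h.1.effect E hle hv, h.2.effect E hle hv⟩
  case locCmp c x => exact ⟨h.1.effect E hle hv, by rw [E.key h.1.1]; exact h.2⟩
  case locNext c s x => exact ⟨h.1.effect E hle hv, by rw [E.key h.1.1]; exact h.2⟩
  case conDel y => exact h.imp fun k h => h.effect E hle hv
  case delLock k y => exact h.effect E hle hv
  case delRem k y => exact ⟨h.1.effect E hle hv, h.2.stable E ht⟩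
  case delDel y => exact h.imp fun k h => ⟨h.1.effect E hle hv, h.2.stable E ht⟩
  case delSet y r =>
    exact h.imp fun k h =>
      ⟨h.1.effect E hle hv, h.2.1.stable E ht, by rw [h.2.1.mem_eq E ht]; exact h.2.2⟩
  case insLockY k y => exact h.effect E hle hv
  case insRemY k y => exact ⟨h.1.effect E hle hv, h.2.stable E ht⟩
  case insDelY y => exact h.imp fun k h => ⟨h.1.effect E hle hv, h.2.stable E ht⟩
  case insSetY y r =>
    exact h.imp fun k h =>
      ⟨h.1.effect E hle hv, h.2.1.stable E ht, by rw [h.2.1.mem_eq E ht]; exact h.2.2⟩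
  case insLockX k x => exact h.effect E hle hv
  case insRemX k x => exact ⟨h.1.effect E hle hv, h.2.stable E ht⟩
  case insKey1 k x => exact ⟨h.1.effect E hle hv, h.2.stable E ht⟩
  case insLeft k x =>
    exact ⟨h.1.effect E hle hv, h.2.1.stable E ht, by rw [h.2.1.mem_eq E ht]; exact h.2.2⟩
  case insKey2 k x => exact ⟨h.1.effect E hle hv, h.2.stable E ht⟩
  case insRight k x =>
    exact ⟨h.1.effect E hle hv, h.2.1.stable E ht, by rw [h.2.1.mem_eq E ht]; exact h.2.2⟩
  case insNew k s x =>
    exact ⟨h.1.effect E hle hv, h.2.1.stable E ht, by rw [h.2.1.mem_eq E ht]; exact h.2.2⟩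
  case insLink s x n =>
    obtain ⟨k, h1, h2, h3, h4, h5, h6⟩ := h
    have e := E.priv ht h5
    exact ⟨k, h1.effect E hle hv, h2.stable E ht, by rw [h2.mem_eq E ht]; exact h3,
      by rw [h2.mem_eq E ht]; exact h4, e.1.trans h5, e.2.trans h6⟩
  case rmvLockZ s z => exact ⟨hle.idle h.1, E.pub h.2⟩
  case rmvY s z => exact ⟨hle.idle h.1, h.2.stable E ht⟩
  case rmvRemZ s z y =>
    exact ⟨hle.idle h.1, h.2.1.stable E ht, by rw [h.2.1.mem_eq E ht]; exact h.2.2⟩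
  case rmvLockY s z y =>
    exact ⟨hle.idle h.1, h.2.1.stable E ht, by rw [h.2.1.mem_eq E ht]; exact h.2.2⟩
  case rmvDel s z y => exact ⟨hle.idle h.1, h.2.stable E ht⟩
  case rmvInner s z y =>
    exact ⟨hle.idle h.1, h.2.1.stable E ht, by rw [h.2.1.ownY.mem_eq E ht]; exact h.2.2⟩
  case rmvGetOuter s z y =>
    exact ⟨hle.idle h.1, h.2.1.stable E ht, by rw [h.2.1.ownY.mem_eq E ht]; exact h.2.2⟩
  case rmvOuter s z y =>
    exact ⟨hle.idle h.1, h.2.1.stable E ht, by rw [h.2.1.ownY.mem_eq E ht]; exact h.2.2⟩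
  case rmvGetInner s z y =>
    exact ⟨hle.idle h.1, h.2.1.stable E ht, by rw [h.2.1.ownY.mem_eq E ht]; exact h.2.2⟩
  case rmvLink s z y v =>
    exact ⟨hle.idle h.1, h.2.1.stable E ht, by rw [h.2.1.ownY.mem_eq E ht]; exact h.2.2⟩
  case rmvMark z y => exact ⟨hle.idle h.1, h.2.1.stable E ht, h.2.2.1.stable E ht, h.2.2.2⟩
  case rotLockP c d p => exact ⟨hle.idle h.1, E.pub h.2⟩
  case rotY c d p => exact ⟨hle.idle h.1, h.2.stable E ht⟩
  case rotRemP c d p y =>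
    exact ⟨hle.idle h.1, h.2.1.stable E ht, by rw [h.2.1.mem_eq E ht]; exact h.2.2⟩
  case rotLockY c d p y =>
    exact ⟨hle.idle h.1, h.2.1.stable E ht, by rw [h.2.1.mem_eq E ht]; exact h.2.2⟩
  case rotX c d p y => exact ⟨hle.idle h.1, h.2.stable E ht⟩
  case rotLockX c d p y x =>
    exact ⟨hle.idle h.1, h.2.1.stable E ht, by rw [h.2.1.ownY.mem_eq E ht]; exact h.2.2⟩
  case dupKey c d p y x => exact ⟨hle.idle h.1, h.2.stable E ht⟩
  case dupLeft c d p y x q =>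
    exact ⟨hle.idle h.1, h.2.1.stable E ht, by rw [h.2.1.ownY.mem_eq E ht]; exact h.2.2⟩
  case dupRight c d p y x q l =>
    exact ⟨hle.idle h.1, h.2.1.stable E ht, by rw [h.2.1.ownY.mem_eq E ht]; exact h.2.2⟩
  case dupDel c d p y x q l r =>
    exact ⟨hle.idle h.1, h.2.1.stable E ht, by rw [h.2.1.ownY.mem_eq E ht]; exact h.2.2⟩
  case dupRem c d p y x q l r b =>
    exact ⟨hle.idle h.1, h.2.1.stable E ht, by rw [h.2.1.ownY.mem_eq E ht]; exact h.2.2⟩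
  case dupNew c d p y x q l r b b' =>
    exact ⟨hle.idle h.1, h.2.1.stable E ht, by rw [h.2.1.ownY.mem_eq E ht]; exact h.2.2⟩
  case rotGet c d p y x z =>
    have e := E.priv ht h.2.2.1
    exact ⟨hle.idle h.1, h.2.1.stable E ht, e.1.trans h.2.2.1,
      by rw [h.2.1.ownY.mem_eq E ht, e.2]; exact h.2.2.2⟩
  case rotSetZ c d p y x z v =>
    have e := E.priv ht h.2.2.1
    exact ⟨hle.idle h.1, h.2.1.stable E ht, e.1.trans h.2.2.1,
      by rw [h.2.1.ownY.mem_eq E ht, h.2.1.ownX.mem_eq E ht, e.2]; exact h.2.2.2⟩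
  case rotSetX c d p y x z =>
    have e := E.priv ht h.2.2.1
    exact ⟨hle.idle h.1, h.2.1.stable E ht, e.1.trans h.2.2.1,
      by rw [h.2.1.ownY.mem_eq E ht, h.2.1.ownX.mem_eq E ht, e.2]; exact h.2.2.2⟩
  case rotSetP c p y x =>
    obtain ⟨h1, h2, h3, h4, h5, h6, h7, h8⟩ := h
    have e := E.own ht (.inl h2) h3
    exact ⟨hle.idle h1, e.2.1.trans h2, by rw [e.1]; exact h3, by rw [e.2.2]; exact h4,
      by rw [e.2.2]; exact h5, h6.stable E ht, h7.stable E ht, h8⟩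
  case rotMark p y x =>
    exact ⟨hle.idle h.1, h.2.1.stable E ht, h.2.2.1.stable E ht, h.2.2.2.1.stable E ht, h.2.2.2.2⟩

end stable

/-! ### The effects of the actions -/

section

variable {H H' : Heap T K} {g g' : Ghost T} {t : T}

theorem absSet_eq (h : HInv H g) (h' : HInv H' g')
    (hr : ∀ k b, (shape H g).Res k b (some root) → (shape H' g').Res k b (some root)) :
    absSet H' = absSet H := by
  ext k
  obtain ⟨b, hb⟩ := h.graph.outcome k h.graph.root_live
  rw [← h.mem_absSet hb, ← h'.mem_absSet (hr k b hb)]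

theorem mem_absSet_of_ne (h : HInv H g) (h' : HInv H' g') {k k₀ : K} (hk : k ≠ k₀)
    (hr : ∀ k b, k ≠ k₀ → (shape H g).Res k b (some root) → (shape H' g').Res k b (some root)) :
    k ∈ absSet H' ↔ k ∈ absSet H := by
  obtain ⟨b, hb⟩ := h.graph.outcome k h.graph.root_live
  rw [← h.mem_absSet hb, ← h'.mem_absSet (hr k b hk hb)]

theorem absSet_insert (h : HInv H g) (h' : HInv H' g') {k₀ : K}
    (h₀ : (shape H' g').Res k₀ true (some root))
    (hr : ∀ k b, k ≠ k₀ → (shape H g).Res k b (some root) → (shape H' g').Res k b (some root)) :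
    absSet H' = absSet H ∪ {k₀} := by
  ext k
  by_cases hk : k = k₀
  · subst hk; simpa using (h'.mem_absSet h₀)
  · rw [mem_absSet_of_ne h h' hk hr]; simp [hk]

theorem absSet_delete (h : HInv H g) (h' : HInv H' g') {k₀ : K}
    (h₀ : (shape H' g').Res k₀ false (some root))
    (hr : ∀ k b, k ≠ k₀ → (shape H g).Res k b (some root) → (shape H' g').Res k b (some root)) :
    absSet H' = absSet H \ {k₀} := by
  ext k
  by_cases hk : k = k₀
  · subst hk; simpa using (h'.mem_absSet h₀)
  · rw [mem_absSet_of_ne h h' hk hr]; simp [hk]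

/-- A free lock implies that no virtual edge starts at the node, and that the node is marked if it is
gone. -/
theorem effect_lock (h : HInv H g) {l : ℕ} (hl : g.Pub l) (hfree : (H.mem l).lock = none) :
    Effect t H g (H.modify l fun n => { n with lock := some t }) g ∧
      absSet (H.modify l fun n => { n with lock := some t }) = absSet H ∧
      Own (H.modify l fun n => { n with lock := some t }) g t l := by
  have E : Effect t H g (H.modify l fun n => { n with lock := some t }) g :=
    effect_modify h hl (by simp [hfree]) rfl (fun s => by cases s <;> rfl) rfl h.rem_live (by simp)
      (by simp)
  refine ⟨E, absSet_eq h E.inv ?_, hl, ?_, ?_, ?_⟩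
  · intro k b hb
    rwa [shape_modify (f := fun n => { n with lock := some t }) rfl
      (fun s => by cases s <;> rfl) rfl]
  · rw [H.modify_mem_self]
  · intro s
    by_contra hs
    exact h.virt_lock hs hfree
  · intro hg
    rw [H.modify_mem_self]
    exact (h.rem_gone hg).resolve_right fun e => e hfree

theorem effect_unlock (h : HInv H g) {l : ℕ} (hl : Own H g t l) :
    Effect t H g (H.modify l fun n => { n with lock := none }) g ∧
      absSet (H.modify l fun n => { n with lock := none }) = absSet H := by
  have E : Effect t H g (H.modify l fun n => { n with lock := none }) g :=
    effect_modify h hl.pub (fun t' ht' e => ht' (by simpa [hl.lock] using e.symm)) rfl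
      (fun s => by cases s <;> rfl) rfl h.rem_live (fun e => .inl (hl.rem e))
      (fun s e => (e (hl.virt s)).elim)
  refine ⟨E, absSet_eq h E.inv ?_⟩
  intro k b hb
  rwa [shape_modify (f := fun n => { n with lock := none }) rfl
    (fun s => by cases s <;> rfl) rfl]

theorem effect_mark (h : HInv H g) {l : ℕ} (hl : Cut H g t l) :
    Effect t H g (H.modify l fun n => { n with rem := true }) g ∧
      absSet (H.modify l fun n => { n with rem := true }) = absSet H ∧
      Own (H.modify l fun n => { n with rem := true }) g t l := by
  have E : Effect t H g (H.modify l fun n => { n with rem := true }) g :=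
    effect_modify h hl.pub (fun t' ht' e => ht' (by simpa [hl.lock] using e.symm)) rfl
      (fun s => by cases s <;> rfl) rfl (fun e => by rw [hl.gone] at e; cases e)
      (fun e => .inl rfl) (fun s e => (e (hl.virt s)).elim)
  refine ⟨E, absSet_eq h E.inv ?_, hl.pub, ?_, hl.virt, ?_⟩
  · intro k b hb
    rwa [shape_modify (f := fun n => { n with rem := true }) rfl
      (fun s => by cases s <;> rfl) rfl]
  · rw [H.modify_mem_self]; exact hl.lock
  · intro _; rw [H.modify_mem_self]

theorem shape_setDel {y : ℕ} {d : Bool} (hy : g.Pub y) :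
    shape (H.modify y fun n => { n with del := d }) g =
      { shape H g with del := Function.update (shape H g).del y d } := by
  have hm : ∀ {m}, m ≠ y → (H.modify y fun n => { n with del := d }).mem m = H.mem m := fun e =>
    H.modify_mem_of_ne _ e
  have hy' := H.modify_mem_self y fun n => { n with del := d }
  unfold shape
  congr 1
  · funext l
    by_cases e : l = y
    · subst e; rw [hy']
    · rw [hm e]
  · funext l s
    by_cases e : l = y
    · subst e; rw [hy']; cases s <;> rfl
    · rw [hm e]
  · funext l
    by_cases e : l = y
    · subst e; rw [hy', if_pos hy]; simp
    · rw [hm e]; simp [e]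

/-- The linearization point of `delete`, and of an `insert` that finds a node with its key. -/
theorem effect_setDel (h : HInv H g) {y : ℕ} {d : Bool} {k : K} (hy : OwnLive H g t y)
    (hk : (H.mem y).key = k) (hp : (shape H g).Path k root y) :
    Effect t H g (H.modify y fun n => { n with del := d }) g ∧
      absSet (H.modify y fun n => { n with del := d }) =
        (if d then absSet H \ {k} else absSet H ∪ {k}) ∧
      Own (H.modify y fun n => { n with del := d }) g t y := by
  have hk' : (shape H g).key y = k := by rw [shape_key hy.pub, hk]
  have hs := shape_setDel (H := H) (d := d) hy.pub
  have E : Effect t H g (H.modify y fun n => { n with del := d }) g := by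
    refine effect_write h hy.pub hy.lock ⟨rfl, rfl, rfl⟩ ?_ ?_ (fun _ => .inl rfl)
      (fun _ => .inl rfl) ?_
    · rw [hs]; exact h.graph.setDel hy.live hk' hp
    · rw [hs]; exact fun _ hg hP => hg.setDel h.graph hy.live hk' hp hP
    · intro s u hu
      exact h.closed (s := s) hy.pub (by cases s <;> exact hu)
  have hr : ∀ k' b, k' ≠ k → (shape H g).Res k' b (some root) →
      (shape (H.modify y fun n => { n with del := d }) g).Res k' b (some root) := by
    intro k' b hne hb
    rw [hs]; exact Graph.Res.setDel_of_ne hk' hne hb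
  have h₀ : (shape (H.modify y fun n => { n with del := d }) g).Res k (!d) (some root) := by
    rw [hs]; exact Graph.Res.setDel_self h.graph hy.live hk' hp
  refine ⟨E, ?_, hy.pub, ?_, hy.virt, ?_⟩
  · cases d with
    | true => exact absSet_delete h E.inv h₀ hr
    | false => exact absSet_insert h E.inv h₀ hr
  · rw [H.modify_mem_self]; exact hy.lock
  · intro e; rw [hy.live] at e; cases e

theorem shape_congr {l : ℕ} (hp : g.Pub l ↔ g'.Pub l) :
    ((H'.mem l).key = (H.mem l).key → (shape H' g').key l = (shape H g).key l) ∧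
    ((H'.mem l).del = (H.mem l).del → (shape H' g').del l = (shape H g).del l) ∧
    ∀ s, (H'.mem l).child s = (H.mem l).child s → (shape H' g').child l s = (shape H g).child l s := by
  by_cases hl : g.Pub l
  · refine ⟨fun e => ?_, fun e => ?_, fun s e => ?_⟩ <;>
      simp only [shape, if_pos hl, if_pos (hp.1 hl), e]
  · refine ⟨fun e => ?_, fun e => ?_, fun s e => ?_⟩ <;>
      simp only [shape, if_neg hl, if_neg fun h => hl (hp.2 h), e]

theorem setChild_mem_child {w l : ℕ} {s u : Side} {v : Option ℕ} (hne : ¬ (l = w ∧ u = s)) :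
    ((H.modify w fun n => n.setChild s v).mem l).child u = (H.mem l).child u := by
  by_cases e : l = w
  · subst e
    rw [H.modify_mem_self, Node.setChild_child_of_ne]
    exact fun e => hne ⟨rfl, e⟩
  · rw [H.modify_mem_of_ne _ e]

theorem setChild_mem_eq {w : ℕ} {s : Side} {v : Option ℕ} (l : ℕ) :
    ((H.modify w fun n => n.setChild s v).mem l).key = (H.mem l).key ∧
    ((H.modify w fun n => n.setChild s v).mem l).del = (H.mem l).del ∧
    ((H.modify w fun n => n.setChild s v).mem l).rem = (H.mem l).rem ∧
    ((H.modify w fun n => n.setChild s v).mem l).lock = (H.mem l).lock := by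
  by_cases e : l = w
  · subst e; rw [H.modify_mem_self]; simp
  · rw [H.modify_mem_of_ne _ e]; simp

/-- Publishing a private node. -/
def Ghost.publish (g : Ghost T) (z : ℕ) : Ghost T := { g with st := Function.update g.st z .live }

/-- Cutting a node off from the logical tree. -/
def Ghost.cut (g : Ghost T) (y : ℕ) : Ghost T := { g with st := Function.update g.st y .gone }

open Classical in
/-- Setting or deleting a virtual edge. -/
noncomputable def Ghost.setVirt (g : Ghost T) (p : ℕ) (c : Side) (v : Option ℕ) : Ghost T :=
  { g with virt := fun m s => if m = p ∧ s = c then v else g.virt m s }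

/-- The linearization point of an `insert` that adds a node. -/
theorem effect_addLeaf (h : HInv H g) {x z : ℕ} {s : Side} {k : K} (hx : OwnLive H g t x)
    (hs : s.Of k (H.mem x).key) (hc : (H.mem x).child s = none) (hz : g.st z = .priv t)
    (hzm : H.mem z = Node.fresh k) (hp : (shape H g).Path k root x) :
    Effect t H g (H.modify x fun n => n.setChild s (some z)) (g.publish z) ∧ k ∉ absSet H ∧
      absSet (H.modify x fun n => n.setChild s (some z)) = absSet H ∪ {k} ∧
      Own (H.modify x fun n => n.setChild s (some z)) (g.publish z) t x := by
  set H' := H.modify x fun n => n.setChild s (some z) with hH'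
  have hzp : ¬ g.Pub z := Ghost.not_pub_of_priv hz
  have hxz : x ≠ z := fun e => hzp (e ▸ hx.pub)
  have hst : ∀ l, l ≠ z → (g.publish z).st l = g.st l := fun l e => by simp [Ghost.publish, e]
  have hstz : (g.publish z).st z = .live := by simp [Ghost.publish]
  have hzp' : (g.publish z).Pub z := .inl hstz
  have hpub : ∀ l, l ≠ z → (g.Pub l ↔ (g.publish z).Pub l) := fun l e => by
    unfold Ghost.Pub; rw [hst l e]
  have hzm' : H'.mem z = Node.fresh k := by rw [hH', H.modify_mem_of_ne _ hxz.symm, hzm]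
  have A : Graph.AddLeaf (shape H g) (shape H' (g.publish z)) k s x z := by
    refine ⟨hx.live, hx.virt s, ?_, ?_, fun e => hzp (.inl e), h.child_ne hzp, h.virt_ne hzp, ?_, ?_,
      ?_, ?_, ?_, ?_, ?_, ?_, rfl⟩
    · rw [shape_child hx.pub, hc]
    · rwa [shape_key hx.pub]
    · rw [shape_key hzp', hzm']; rfl
    · rw [shape_del hzp', hzm']; rfl
    · intro u; rw [shape_child hzp', hzm']; cases u <;> rfl
    · exact fun m hm => (shape_congr (hpub m hm)).1 (setChild_mem_eq m).1
    · exact fun m hm => (shape_congr (hpub m hm)).2.1 (setChild_mem_eq m).2.1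
    · rw [shape_child ((hpub x hxz).1 hx.pub), hH', H.modify_mem_self, Node.setChild_child]
    · exact fun m u hm hmu => (shape_congr (hpub m hm)).2.2 u (setChild_mem_child hmu)
    · ext m
      rw [mem_live, Set.mem_insert_iff, mem_live]
      by_cases e : m = z
      · subst e; simp [hstz]
      · rw [hst m e]; simp [e]
  have E : Effect t H g H' (g.publish z) := by
    refine effect_write h hx.pub hx.lock (by simp) (A.inv h.graph hp) ?_ ?_ (fun _ => .inl rfl) ?_
    · exact fun hn hg hP => A.good h.graph hp hg (fun e => hzp (e ▸ hn)) hP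
    · intro l
      by_cases e : l = z
      · subst e
        refine .inr (.inl ⟨hz, hstz, by rw [hzm]; rfl, fun s u hu => ?_⟩)
        rw [hzm] at hu
        cases s <;> cases hu
      · exact .inl (hst l e)
    · intro u w hw
      by_cases e : u = s
      · subst e
        rw [Node.setChild_child] at hw
        cases hw; exact hzp'
      · rw [Node.setChild_child_of_ne _ _ e] at hw
        have := h.closed hx.pub hw
        exact (hpub w fun e => hzp (e ▸ this)).1 this
  refine ⟨E, ?_, ?_, ?_⟩
  · obtain ⟨b, hb⟩ := h.graph.outcome k h.graph.root_live
    have h1 := (hb.along (Graph.Path.gen hp)).child A.of_x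
    rw [A.child_x] at h1
    rw [← h.mem_absSet hb, Graph.Res.of_none h1]; simp
  · exact absSet_insert h E.inv (A.res_root h.graph hp) fun k b hk hb => A.res_root_of_ne h.graph hk hb
  · refine ⟨(hpub x hxz).1 hx.pub, ?_, hx.virt, fun e => ?_⟩
    · rw [(setChild_mem_eq x).2.2.2]; exact hx.lock
    · rw [hst x hxz, hx.live] at e; cases e

/-- Unlinking a deleted node with at most one child leaves the abstract set unchanged. -/
theorem effect_unlink (h : HInv H g) {z y : ℕ} {s e : Side} (hr : Rmv H g t s z y)
    (hd : (H.mem y).del = true) (he : (H.mem y).child e = none) :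
    Effect t H g (H.modify z fun n => n.setChild s ((H.mem y).child e.flip)) (g.cut y) ∧
      absSet (H.modify z fun n => n.setChild s ((H.mem y).child e.flip)) = absSet H ∧
      Own (H.modify z fun n => n.setChild s ((H.mem y).child e.flip)) (g.cut y) t z ∧
      Cut (H.modify z fun n => n.setChild s ((H.mem y).child e.flip)) (g.cut y) t y := by
  set H' := H.modify z fun n => n.setChild s ((H.mem y).child e.flip) with hH'
  have hst : ∀ l, l ≠ y → (g.cut y).st l = g.st l := fun l e => by simp [Ghost.cut, e]
  have hsty : (g.cut y).st y = .gone := by simp [Ghost.cut]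
  have hpub : ∀ l, g.Pub l ↔ (g.cut y).Pub l := by
    intro l
    by_cases e : l = y
    · subst e; exact iff_of_true hr.ownY.pub (.inr hsty)
    · unfold Ghost.Pub; rw [hst l e]
  have U : Graph.Unlink (shape H g) (shape H' (g.cut y)) s e z y := by
    refine ⟨hr.ownZ.live, hr.ownY.live, hr.ne.symm, ?_, hr.ownZ.virt s, hr.ownY.virt, ?_, ?_, ?_, ?_,
      ?_, ?_, ?_, rfl⟩
    · rw [shape_child hr.ownZ.pub, hr.child]
    · rw [shape_child hr.ownY.pub, he]
    · rw [shape_del hr.ownY.pub, hd]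
    · exact funext fun m => (shape_congr (hpub m)).1 (setChild_mem_eq m).1
    · exact funext fun m => (shape_congr (hpub m)).2.1 (setChild_mem_eq m).2.1
    · ext m
      rw [mem_live, Set.mem_sdiff, mem_live, Set.mem_singleton_iff]
      by_cases e : m = y
      · subst e; simp [hsty]
      · rw [hst m e]; simp [e]
    · rw [shape_child ((hpub z).1 hr.ownZ.pub), shape_child hr.ownY.pub, hH', H.modify_mem_self,
        Node.setChild_child]
    · exact fun m u hmu => (shape_congr (hpub m)).2.2 u (setChild_mem_child hmu)
  have E : Effect t H g H' (g.cut y) := by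
    refine effect_write h hr.ownZ.pub hr.ownZ.lock (by simp) (U.inv h.graph) ?_ ?_
      (fun _ => .inl rfl) ?_
    · exact fun _ hg hP => U.good h.graph hg hP
    · intro l
      by_cases e : l = y
      · subst e; exact .inr (.inr ⟨hr.ownY.live, hr.ownY.lock, hsty⟩)
      · exact .inl (hst l e)
    · intro u w hw
      refine (hpub w).1 ?_
      by_cases e : u = s
      · subst e
        rw [Node.setChild_child] at hw
        exact h.closed hr.ownY.pub hw
      · rw [Node.setChild_child_of_ne _ _ e] at hw
        exact h.closed hr.ownZ.pub hw
  refine ⟨E, absSet_eq h E.inv fun k b hb => U.res h.graph hb, ?_, hsty, ?_, hr.ownY.virt⟩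
  · refine ⟨(hpub z).1 hr.ownZ.pub, ?_, hr.ownZ.virt, fun e => ?_⟩
    · rw [(setChild_mem_eq z).2.2.2]; exact hr.ownZ.lock
    · rw [hst z hr.ne, hr.ownZ.live] at e; cases e
  · rw [(setChild_mem_eq y).2.2.2]; exact hr.ownY.lock

/-- The first visible write of a rotation rotates the logical tree and creates a virtual edge from `p` to
`x`. -/
theorem effect_rotate (h : HInv H g) {p y x z : ℕ} {c d : Side} (hr : Rot H g t c d p y x)
    (hz : g.st z = .priv t)
    (hzm : H.mem z = Node.setChild { H.mem y with lock := none } d ((H.mem x).child d.flip)) :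
    ∃ g', Effect t H g (H.modify x fun n => n.setChild d.flip (some z)) g' ∧
      absSet (H.modify x fun n => n.setChild d.flip (some z)) = absSet H ∧
      TInv (H.modify x fun n => n.setChild d.flip (some z)) g' t .idle (.rotSetP c p y x) := by
  obtain ⟨hpy, hpx, hyx⟩ : p ≠ y ∧ p ≠ x ∧ y ≠ x := by simpa [and_assoc] using hr.ne
  set H' := H.modify x fun n => n.setChild d.flip (some z) with hH'
  set g' := ((g.publish z).cut y).setVirt p c (some x) with hg'
  have hzp : ¬ g.Pub z := Ghost.not_pub_of_priv hz
  have hne : ∀ {m}, g.Pub m → m ≠ z := fun hm e => hzp (e ▸ hm)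
  have hst : ∀ l, l ≠ z → l ≠ y → g'.st l = g.st l := fun l e e' => by
    simp [hg', Ghost.publish, Ghost.cut, Ghost.setVirt, e, e']
  have hstz : g'.st z = .live := by
    simp [hg', Ghost.publish, Ghost.cut, Ghost.setVirt, (hne hr.ownY.pub).symm]
  have hsty : g'.st y = .gone := by simp [hg', Ghost.publish, Ghost.cut, Ghost.setVirt]
  have hvp : g'.virt p c = some x := by simp [hg', Ghost.publish, Ghost.cut, Ghost.setVirt]
  have hv : ∀ m s, ¬ (m = p ∧ s = c) → g'.virt m s = g.virt m s := fun m s e => by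
    simp only [hg', Ghost.publish, Ghost.cut, Ghost.setVirt]
    rw [if_neg e]
  have hzp' : g'.Pub z := .inl hstz
  have hpub : ∀ l, l ≠ z → (g.Pub l ↔ g'.Pub l) := by
    intro l hl
    by_cases e : l = y
    · subst e; exact iff_of_true hr.ownY.pub (.inr hsty)
    · unfold Ghost.Pub; rw [hst l hl e]
  have hzm' : H'.mem z = Node.setChild { H.mem y with lock := none } d ((H.mem x).child d.flip) := by
    rw [hH', H.modify_mem_of_ne _ (hne hr.ownX.pub).symm, hzm]
  have hzc : ∀ v, (Node.setChild { H.mem y with lock := none } d v : Node T K).child d.flip =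
      (H.mem y).child d.flip := by
    intro v
    rw [Node.setChild_child_of_ne _ _ (Side.flip_ne d)]
    cases d <;> rfl
  have R : Graph.Rotate (shape H g) (shape H' g') c d p y x z := by
    refine ⟨hr.ownP.live, hr.ownY.live, hr.ownX.live, fun e => hzp (.inl e), ?_, ?_, hr.ownP.virt,
      hr.ownY.virt, hr.ownX.virt, h.child_ne hzp, h.virt_ne hzp, ?_, ?_, ?_, ?_, ?_, ?_, ?_, ?_, ?_,
      hvp, hv⟩
    · rw [shape_child hr.ownP.pub, hr.child_p]
    · rw [shape_child hr.ownY.pub, hr.child_y]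
    · rw [shape_key hzp', hzm', shape_key hr.ownY.pub, Node.setChild_key]
    · rw [shape_del hzp', hzm', shape_del hr.ownY.pub, Node.setChild_del]
    · rw [shape_child hzp', hzm', shape_child hr.ownX.pub, Node.setChild_child]
    · rw [shape_child hzp', hzm', shape_child hr.ownY.pub, hzc]
    · exact fun m hm => (shape_congr (hpub m hm)).1 (setChild_mem_eq m).1
    · exact fun m hm => (shape_congr (hpub m hm)).2.1 (setChild_mem_eq m).2.1
    · rw [shape_child ((hpub x (hne hr.ownX.pub)).1 hr.ownX.pub), hH', H.modify_mem_self,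
        Node.setChild_child]
    · exact fun m u hm hmu => (shape_congr (hpub m hm)).2.2 u (setChild_mem_child hmu)
    · intro m
      rw [mem_live, mem_live]
      by_cases e : m = z
      · subst e; simp [hstz]
      · by_cases e' : m = y
        · subst e'; simp [hsty, e]
        · rw [hst m e e']; simp [e, e']
  have E : Effect t H g H' g' := by
    refine effect_write h hr.ownX.pub hr.ownX.lock (by simp) (R.inv h.graph) ?_ ?_ ?_ ?_
    · exact fun hn hg hP => R.good h.graph hg (hne hn) hP
    · intro l
      by_cases e : l = z
      · subst e
        refine .inr (.inl ⟨hz, hstz, ?_, ?_⟩)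
        · rw [hzm, Node.setChild_rem]; exact h.rem_live hr.ownY.live
        · intro s u hu
          rw [hzm] at hu
          rcases s.eq_or_eq_flip d with rfl | rfl
          · rw [Node.setChild_child] at hu; exact h.closed hr.ownX.pub hu
          · rw [hzc] at hu; exact h.closed hr.ownY.pub hu
      · by_cases e' : l = y
        · subst e'; exact .inr (.inr ⟨hr.ownY.live, hr.ownY.lock, hsty⟩)
        · exact .inl (hst l e e')
    · intro l
      by_cases e : l = p
      · subst e; exact .inr hr.ownP.lock
      · exact .inl (funext fun s => hv l s fun e' => e e'.1)
    · intro u w hw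
      by_cases e : u = d.flip
      · subst e
        rw [Node.setChild_child] at hw
        cases hw; exact hzp'
      · rw [Node.setChild_child_of_ne _ _ e] at hw
        have := h.closed hr.ownX.pub hw
        exact (hpub w (hne this)).1 this
  refine ⟨g', E, absSet_eq h E.inv fun k b hb => R.res_root h.graph hb, rfl, ?_, ?_, hvp, ?_,
    ⟨hsty, ?_, ?_⟩, ⟨?_, ?_, ?_, ?_⟩, hr.ne⟩
  · rw [hst p (hne hr.ownP.pub) hpy]; exact hr.ownP.live
  · rw [(setChild_mem_eq p).2.2.2]; exact hr.ownP.lock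
  · exact fun s hs => (hv p s fun e => hs e.2).trans (hr.ownP.virt s)
  · rw [(setChild_mem_eq y).2.2.2]; exact hr.ownY.lock
  · exact fun s => (hv y s fun e => hpy e.1.symm).trans (hr.ownY.virt s)
  · exact (hpub x (hne hr.ownX.pub)).1 hr.ownX.pub
  · rw [(setChild_mem_eq x).2.2.2]; exact hr.ownX.lock
  · exact fun s => (hv x s fun e => hpx e.1.symm).trans (hr.ownX.virt s)
  · intro e
    rw [hst x (hne hr.ownX.pub) hyx.symm, hr.ownX.live] at e; cases e

/-- The second visible write of a rotation turns the virtual edge into a pointer. -/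
theorem effect_commit (h : HInv H g) {p y x : ℕ} {c : Side}
    (hi : TInv H g t .idle (.rotSetP c p y x)) :
    ∃ g', Effect t H g (H.modify p fun n => n.setChild c (some x)) g' ∧
      absSet (H.modify p fun n => n.setChild c (some x)) = absSet H ∧
      TInv (H.modify p fun n => n.setChild c (some x)) g' t .idle (.rotMark p y x) := by
  obtain ⟨-, hpl, hpt, hpv, hpv', hy, hx, hnd⟩ := hi
  obtain ⟨hpy, hpx, hyx⟩ : p ≠ y ∧ p ≠ x ∧ y ≠ x := by simpa [and_assoc] using hnd
  set H' := H.modify p fun n => n.setChild c (some x) with hH'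
  set g' := g.setVirt p c none with hg'
  have hvp : g'.virt p c = none := by simp [hg', Ghost.setVirt]
  have hv : ∀ m s, ¬ (m = p ∧ s = c) → g'.virt m s = g.virt m s := fun m s e => by
    simp only [hg', Ghost.setVirt]
    rw [if_neg e]
  have C : Graph.Commit (shape H g) (shape H' g') c p x := by
    refine ⟨hpv, ?_, ?_, rfl, ?_, ?_, hvp, hv⟩
    · exact funext fun m => (shape_congr (g' := g') Iff.rfl).1 (setChild_mem_eq m).1
    · exact funext fun m => (shape_congr (g' := g') Iff.rfl).2.1 (setChild_mem_eq m).2.1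
    · rw [shape_child (g := g') (.inl hpl), hH', H.modify_mem_self, Node.setChild_child]
    · exact fun m u hmu => (shape_congr (g' := g') Iff.rfl).2.2 u (setChild_mem_child hmu)
  have E : Effect t H g H' g' := by
    refine effect_write h (.inl hpl) hpt (by simp) (C.inv h.graph)
      (fun hn hg hP => C.good h.graph hg hP) (fun _ => .inl rfl) ?_ ?_
    · intro l
      by_cases e : l = p
      · subst e; exact .inr hpt
      · exact .inl (funext fun s => hv l s fun e' => e e'.1)
    · intro u w hw
      by_cases e : u = c
      · subst e
        rw [Node.setChild_child] at hw
        cases hw; exact hx.pub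
      · rw [Node.setChild_child_of_ne _ _ e] at hw
        exact h.closed (.inl hpl) hw
  refine ⟨g', E, absSet_eq h E.inv fun k b hb => C.res h.graph hb, rfl, ⟨.inl hpl, ?_, ?_, ?_⟩,
    ⟨hy.gone, ?_, ?_⟩, ⟨hx.pub, ?_, ?_, ?_⟩, hnd⟩
  · rw [(setChild_mem_eq p).2.2.2]; exact hpt
  · intro s
    by_cases e : s = c
    · subst e; exact hvp
    · exact (hv p s fun e' => e e'.2).trans (hpv' s e)
  · intro e
    change g.st p = .gone at e
    rw [hpl] at e; cases e
  · rw [(setChild_mem_eq y).2.2.2]; exact hy.lock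
  · exact fun s => (hv y s fun e => hpy e.1.symm).trans (hy.virt s)
  · rw [(setChild_mem_eq x).2.2.2]; exact hx.lock
  · exact fun s => (hv x s fun e => hpx e.1.symm).trans (hx.virt s)
  · rw [(setChild_mem_eq x).2.2.1]; exact hx.rem

end

/-! ### Single steps of a thread -/

section

variable {H H' : Heap T K} {g g' : Ghost T} {t : T} {ctx : Ctx K}

/-- Whenever `b` tells whether the key is present, the operation `o` may return `b`, and it leaves
the set unchanged. -/
def SetOp.Inert (o : SetOp K) (b : Bool) : Prop :=
  ∀ S : Set K, (b = true ↔ o.key ∈ S) → o.Returns S b ∧ o.apply S = S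

theorem SetOp.inert_contains (k : K) (b : Bool) : (SetOp.contains k).Inert b :=
  fun _ h => ⟨h, rfl⟩

theorem SetOp.inert_delete (k : K) : (SetOp.delete k).Inert false := by
  intro S h
  refine ⟨h, ?_⟩
  have : k ∉ S := by simpa [SetOp.key] using h
  simp [SetOp.apply, this]

/-- How an action of thread `t` relates to its operation: either the abstract set stays the same,
and the operation may be linearized at an earlier moment; or the operation is linearized now. -/
inductive Outcome (H H' : Heap T K) (g' : Ghost T) (t : T) (ctx : Ctx K) (q : PC K) : Prop
  | silent (hS : absSet H' = absSet H) (hi : TInv H' g' t ctx q)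
  | past (o : SetOp K) (P : Bool → Prop) (b : Bool) (hS : absSet H' = absSet H)
      (hctx : ctx = .todo o P) (hb : P b) (ho : o.Inert b) (hi : TInv H' g' t (.done b) q)
  | now (o : SetOp K) (P : Bool → Prop) (b : Bool) (hctx : ctx = .todo o P)
      (hb : o.Returns (absSet H) b) (hS : absSet H' = o.apply (absSet H))
      (hi : TInv H' g' t (.done b) q)

/-- The calls that a thread may execute while its operation is in the given state. -/
def Call.Ok (ctx : Ctx K) : Call K → Prop
  | .op o => ∃ P, ctx = .todo o P
  | .aux _ _ => ctx = .idle

/-- A traversal may always start afresh at the root. -/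
theorem TInv.start (h : HInv H g) (hv : ctx.Valid (absSet H)) {c : Call K} (hc : c.Ok ctx) :
    TInv H g t ctx (.start c) := by
  have hT : Trav H g ctx c root := by
    refine ⟨h.pub_root, ?_⟩
    cases c with
    | op o =>
      obtain ⟨P, rfl⟩ := hc
      exact ⟨P, rfl, h.graph.good_of_path .refl fun b hb => hv b (h.mem_absSet hb)⟩
    | aux a k => exact hc
  exact ⟨hT, hT⟩

theorem TInv.finish (h : HInv H g) (hv : ctx.Valid (absSet H)) {held : List ℕ} {a : After K}
    (hn : held.Nodup) (ho : ∀ l ∈ held, Own H g t l) (ha : a.Ok ctx) :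
    TInv H g t ctx (.finish held a) := by
  cases held with
  | cons l ls => exact ⟨hn, ho, ha⟩
  | nil =>
    cases a with
    | ret b => exact ha
    | restart o => exact TInv.start h hv (c := .op o) ha
    | done => exact ha

theorem TInv.finish₁ (h : HInv H g) (hv : ctx.Valid (absSet H)) {l : ℕ} {a : After K}
    (ho : Own H g t l) (ha : a.Ok ctx) : TInv H g t ctx (.finish [l] a) :=
  TInv.finish h hv (by simp) (by simpa using ho) ha

theorem TInv.finish₂ (h : HInv H g) {z y : ℕ}
    (hz : Own H g t z) (hy : Own H g t y) (hne : z ≠ y) : TInv H g t .idle (.finish [z, y] .done) :=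
  TInv.finish (ctx := .idle) h trivial (by simpa using hne) (by simpa using ⟨hz, hy⟩) rfl

theorem Trav.path {o : SetOp K} {n : ℕ} (h : Trav H g ctx (.op o) n) (hn : g.st n = .live) :
    (shape H g).Path o.key root n := by
  obtain ⟨-, P, -, h⟩ := h
  exact (h n .refl).1 hn

theorem At.path {o : SetOp K} {n : ℕ} (h : At H g ctx o n) (hn : g.st n = .live) :
    (shape H g).Path o.key root n := h.1.path hn

/-- The answer that a search gives according to the flag of the node it has found is admissible. -/
theorem At.answer {o : SetOp K} {n : ℕ} (h : At H g ctx o n) :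
    ∃ P, ctx = .todo o P ∧ P (!(H.mem n).del) := by
  obtain ⟨⟨hn, P, hc, h⟩, hk⟩ := h
  refine ⟨P, hc, ?_⟩
  rw [← shape_del hn]
  exact (h n .refl).2.1 (by rw [shape_key hn, hk])

theorem Trav.ok {o : SetOp K} {n : ℕ} (h : Trav H g ctx (.op o) n) :
    After.Ok ctx (.restart o) := by
  obtain ⟨-, P, h, -⟩ := h
  exact ⟨P, h⟩

/-- A live node found by a search tells whether its key is present. -/
theorem HInv.mem_absSet_iff_del (h : HInv H g) {y : ℕ} {k : K} (hy : g.st y = .live)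
    (hk : (H.mem y).key = k) (hp : (shape H g).Path k root y) :
    (!(H.mem y).del) = true ↔ k ∈ absSet H := by
  obtain ⟨b, hb⟩ := h.graph.outcome k h.graph.root_live
  have hk' : (shape H g).key y = k := by rw [shape_key (.inl hy), hk]
  have e := (hb.along hp.gen).eq_del hk'
  rw [shape_del (.inl hy)] at e
  rw [← e]; exact h.mem_absSet hb

theorem TInv.located {c : Call K} {x y : ℕ} (hx : Trav H g ctx c x) (hy : Trav H g ctx c y)
    (hk : (H.mem y).key = c.key) : TInv H g t ctx (.located c x (some y)) := by
  cases c with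
  | op o =>
    cases o with
    | contains k => exact ⟨k, hy, hk⟩
    | insert k => exact ⟨hy, hk⟩
    | delete k => exact ⟨hy, hk⟩
  | aux a k => cases a <;> exact ⟨hx.2, hx.1⟩

/-- Reading the next pointer.  When it is null, a `contains` or `delete` learns that its key was absent at
some moment since its invocation. -/
theorem outcome_locate (h : HInv H g) {c : Call K} {s : Side} {x : ℕ} (hx : Trav H g ctx c x)
    (hs : s.Of c.key (H.mem x).key) :
    Outcome H H g t ctx (.locate c x ((H.mem x).child s)) := by
  cases hc : (H.mem x).child s with
  | some y =>
    refine .silent rfl ⟨hx, h.closed hx.1 hc, ?_⟩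
    have hp := hx.1
    cases c with
    | op o =>
      obtain ⟨-, P, rfl, hx⟩ := hx
      exact ⟨P, rfl, hx.step ⟨s, by rw [shape_key hp]; exact hs, by rw [shape_child hp, hc]⟩⟩
    | aux a k => exact hx.2
  | none =>
    cases c with
    | op o =>
      have hT := hx
      obtain ⟨hp, P, rfl, hx⟩ := hx
      have hf : P false :=
        (hx x .refl).2.2 s (by rw [shape_key hp]; exact hs) (by rw [shape_child hp, hc])
      cases o with
      | contains k => exact .past _ P false rfl rfl hf (SetOp.inert_contains k false) rfl
      | insert k => exact .silent rfl hT
      | delete k => exact .past _ P false rfl rfl hf (SetOp.inert_delete k) rfl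
    | aux a k => cases a <;> exact .silent rfl ⟨hx.2, hx.1⟩

theorem OwnLive.modify {l w : ℕ} {f : Node T K → Node T K} (h : OwnLive H g t l) (e : l ≠ w) :
    OwnLive (H.modify w f) g t l := h.congr (H.modify_mem_of_ne f e) rfl rfl

theorem Own.modify {l w : ℕ} {f : Node T K → Node T K} (h : Own H g t l) (e : l ≠ w) :
    Own (H.modify w f) g t l := h.congr (H.modify_mem_of_ne f e) rfl rfl

theorem Own.ne_of_free {l w : ℕ} (h : Own H g t l) (hw : (H.mem w).lock = none) : l ≠ w := by
  rintro rfl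
  have := h.lock
  rw [hw] at this; cases this

theorem Rot.congr {c d : Side} {p y x : ℕ} (h : Rot H g t c d p y x)
    (hm : ∀ l, g.Pub l → H'.mem l = H.mem l) (hs : ∀ l, g.Pub l → g'.st l = g.st l)
    (hv : g'.virt = g.virt) : Rot H' g' t c d p y x :=
  have key : ∀ {l}, OwnLive H g t l → OwnLive H' g' t l := fun ho =>
    ho.congr (hm _ ho.pub) (hs _ ho.pub) (by rw [hv])
  ⟨key h.ownP, key h.ownY, key h.ownX, h.ne, by rw [hm _ h.ownP.pub]; exact h.child_p,
    by rw [hm _ h.ownY.pub]; exact h.child_y⟩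

theorem HInv.ownLive_of_child (h : HInv H g) {z y : ℕ} {s : Side} (hz : OwnLive H g t z)
    (hc : (H.mem z).child s = some y) : g.st y = .live :=
  h.live_of_child hz.live (hz.virt s) hc

/-- Locking the child of a locked live node. -/
theorem OwnLive.lock_child (h : HInv H g) {z y : ℕ} {s : Side} (hz : OwnLive H g t z)
    (hc : (H.mem z).child s = some y)
    (ho : Own (H.modify y fun n => { n with lock := some t }) g t y) :
    OwnLive (H.modify y fun n => { n with lock := some t }) g t y :=
  ⟨h.ownLive_of_child hz hc, ho.lock, ho.virt⟩

theorem modify_lock_child (y l : ℕ) (s : Side) (v : Option T) :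
    ((H.modify y fun n => { n with lock := v }).mem l).child s = (H.mem l).child s := by
  by_cases e : l = y
  · subst e; rw [H.modify_mem_self]; cases s <;> rfl
  · rw [H.modify_mem_of_ne _ e]

/-- Allocating a node makes it private. -/
theorem effect_new (h : HInv H g) {z : ℕ} (hz : z ∉ H.alloc) (n : Node T K) :
    Effect t H g (H.place z n) { g with st := Function.update g.st z (.priv t) } ∧
      absSet (H.place z n) = absSet H ∧
      (∀ l, g.Pub l → (H.place z n).mem l = H.mem l) ∧
      ∀ l, g.Pub l → Function.update g.st z (.priv t) l = g.st l := by
  have hf : g.st z = .free := by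
    by_contra e; exact hz (h.alloc e)
  have hne : ∀ l, g.Pub l → l ≠ z := by
    rintro l (e | e) rfl <;> rw [hf] at e <;> cases e
  obtain ⟨E, hs⟩ := effect_priv (H' := H.place z n) (t := t)
    (g' := { g with st := Function.update g.st z (.priv t) }) h (.inl hf)
    (fun m e => by simp [Heap.place, e]) (Set.subset_insert _ _) (Set.mem_insert _ _)
    (fun m e => by simp [e]) (by simp) rfl
  exact ⟨E, absSet_eq h E.inv fun k b hb => by rwa [hs],
    fun l hl => by simp [Heap.place, hne l hl], fun l hl => by simp [hne l hl]⟩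

theorem effect_modify_priv (h : HInv H g) {z : ℕ} (hz : g.st z = .priv t) (f : Node T K → Node T K) :
    Effect t H g (H.modify z f) g ∧ absSet (H.modify z f) = absSet H := by
  obtain ⟨E, hs⟩ := effect_priv (H' := H.modify z f) (g' := g) h (.inr hz)
    (fun m e => H.modify_mem_of_ne f e) (le_refl _)
    (h.alloc (by rw [hz]; simp)) (fun _ _ => rfl) hz rfl
  exact ⟨E, absSet_eq h E.inv fun k b hb => by rwa [hs]⟩

/-- A step of a thread preserves the invariant of the memory and its own, and linearizes its operation
if necessary. -/
theorem exec_effect {pc q : PC K} (h : HInv H g) (hi : TInv H g t ctx pc)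
    (hv : ctx.Valid (absSet H)) (hx : (code pc).Exec t H H' q) :
    ∃ g', Effect t H g H' g' ∧ Outcome H H' g' t ctx q := by
  have read : ∀ {q}, TInv H g t ctx q → ∃ g', Effect t H g H g' ∧ Outcome H H g' t ctx q :=
    fun hi => ⟨g, .refl h, .silent rfl hi⟩
  have lock : ∀ {l q}, g.Pub l → (H.mem l).lock = none →
      (Effect t H g (H.modify l fun n => { n with lock := some t }) g →
        ctx.Valid (absSet (H.modify l fun n => { n with lock := some t })) →
        Own (H.modify l fun n => { n with lock := some t }) g t l →
        TInv (H.modify l fun n => { n with lock := some t }) g t ctx q) →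
      ∃ g', Effect t H g (H.modify l fun n => { n with lock := some t }) g' ∧
        Outcome H (H.modify l fun n => { n with lock := some t }) g' t ctx q := by
    intro l q hl hf hq
    obtain ⟨E, hS, ho⟩ := effect_lock (t := t) h hl hf
    exact ⟨g, E, .silent hS (hq E (by rwa [hS]) ho)⟩
  cases pc <;> simp only [code] at hx <;> cases hx <;> simp only [TInv] at hi <;>
    beta_reduce
  case release held a l hl =>
    obtain ⟨hn, ho, ha⟩ := hi
    obtain ⟨E, hS⟩ := effect_unlock h (ho l hl)
    refine ⟨g, E, .silent hS (TInv.finish E.inv (by rwa [hS]) (hn.erase l) ?_ ha)⟩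
    intro m hm
    rw [hn.mem_erase_iff] at hm
    exact (ho m hm.2).modify hm.1
  case locKey c x y =>
    refine read ?_
    split
    · exact TInv.located hi.1 hi.2 ‹_›
    · exact ⟨hi.2, ‹_›⟩
  case locCmp c x =>
    refine read ?_
    split
    · exact ⟨hi.1, ‹_›⟩
    · exact ⟨hi.1, lt_of_le_of_ne (not_lt.1 ‹_›) hi.2.symm⟩
  case locNext c s x => exact ⟨g, .refl h, outcome_locate h hi.1 hi.2⟩
  case conDel y =>
    obtain ⟨k, hi⟩ := hi
    obtain ⟨P, rfl, hP⟩ := hi.answer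
    exact ⟨g, .refl h, .past _ P _ rfl rfl hP (SetOp.inert_contains k _) rfl⟩
  case delLock k y hf =>
    exact lock hi.1.1 hf fun E hv ho => ⟨hi.effect E .refl hv, ho⟩
  case delRem k y =>
    refine read ?_
    split
    · exact TInv.finish₁ h hv hi.2 hi.1.1.ok
    · exact ⟨k, hi.1, hi.2.ownLive (Bool.eq_false_of_not_eq_true ‹_›)⟩
  case delDel y =>
    obtain ⟨k, h1, h2⟩ := hi
    exact read ⟨k, h1, h2, rfl⟩
  case delSet y r =>
    obtain ⟨k, h1, h2, rfl⟩ := hi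
    have hp := h1.path h2.live
    obtain ⟨E, hS, ho⟩ := effect_setDel (d := true) h h2 h1.2 hp
    obtain ⟨P, rfl, -⟩ := h1.answer
    exact ⟨g, E, .now (.delete k) P _ rfl (h.mem_absSet_iff_del h2.live h1.2 hp) hS
      (TInv.finish₁ (ctx := .done _) E.inv trivial ho rfl)⟩
  case insLockY k y hf =>
    exact lock hi.1.1 hf fun E hv ho => ⟨hi.effect E .refl hv, ho⟩
  case insRemY k y =>
    refine read ?_
    split
    · exact TInv.finish₁ h hv hi.2 hi.1.1.ok
    · exact ⟨k, hi.1, hi.2.ownLive (Bool.eq_false_of_not_eq_true ‹_›)⟩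
  case insDelY y =>
    obtain ⟨k, h1, h2⟩ := hi
    exact read ⟨k, h1, h2, rfl⟩
  case insSetY y r =>
    obtain ⟨k, h1, h2, rfl⟩ := hi
    have hp := h1.path h2.live
    obtain ⟨E, hS, ho⟩ := effect_setDel (d := false) h h2 h1.2 hp
    obtain ⟨P, rfl, -⟩ := h1.answer
    refine ⟨g, E, .now (.insert k) P _ rfl ?_ hS (TInv.finish₁ (ctx := .done _) E.inv trivial ho rfl)⟩
    have := not_congr (h.mem_absSet_iff_del h2.live h1.2 hp)
    simpa [SetOp.Returns, SetOp.key] using this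
  case insLockX k x hf =>
    exact lock hi.1 hf fun E hv ho => ⟨hi.effect E .refl hv, ho⟩
  case insRemX k x =>
    refine read ?_
    split
    · exact TInv.finish₁ h hv hi.2 hi.1.ok
    · exact ⟨hi.1, hi.2.ownLive (Bool.eq_false_of_not_eq_true ‹_›)⟩
  case insKey1 k x =>
    refine read ?_
    split
    · exact ⟨hi.1, hi.2, ‹_›⟩
    · exact hi
  case insLeft k x =>
    refine read ?_
    split
    · exact ⟨hi.1, hi.2.1, hi.2.2, ‹_›⟩
    · exact ⟨hi.1, hi.2.1⟩
  case insKey2 k x =>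
    refine read ?_
    split
    · exact ⟨hi.1, hi.2, ‹_›⟩
    · exact TInv.finish₁ h hv hi.2.own hi.1.ok
  case insRight k x =>
    refine read ?_
    split
    · exact ⟨hi.1, hi.2.1, hi.2.2, ‹_›⟩
    · exact TInv.finish₁ h hv hi.2.1.own hi.1.ok
  case insNew k s x n hn =>
    obtain ⟨h1, h2, h3, h4⟩ := hi
    obtain ⟨E, hS, hm, hst⟩ := effect_new (t := t) h hn (Node.fresh k)
    refine ⟨_, E, .silent hS ⟨k, h1.effect E .refl (by rwa [hS]), ?_, ?_, ?_, ?_, ?_⟩⟩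
    · exact h2.congr (hm _ h2.pub) (hst _ h2.pub) rfl
    · rw [hm _ h2.pub]; exact h3
    · rw [hm _ h2.pub]; exact h4
    · simp
    · simp [Heap.place]
  case insLink s x n =>
    obtain ⟨k, h1, h2, h3, h4, h5, h6⟩ := hi
    obtain ⟨E, hk, hS, ho⟩ := effect_addLeaf h h2 h3 h4 h5 h6 (h1.path h2.live)
    obtain ⟨-, P, rfl, -⟩ := h1
    exact ⟨_, E, .now (.insert k) P true rfl (by simpa [SetOp.Returns] using hk) hS
      (TInv.finish₁ (ctx := .done _) E.inv trivial ho rfl)⟩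
  case rmvLockZ s z hf =>
    exact lock hi.2 hf fun E hv ho => ⟨hi.1, ho⟩
  case rmvY s z =>
    refine read ?_
    split
    · exact TInv.finish₁ h hv hi.2 hi.1
    · exact ⟨hi.1, hi.2, ‹_›⟩
  case rmvRemZ s z y =>
    refine read ?_
    split
    · exact TInv.finish₁ h hv hi.2.1 hi.1
    · exact ⟨hi.1, hi.2.1.ownLive (Bool.eq_false_of_not_eq_true ‹_›), hi.2.2⟩
  case rmvLockY s z y hf =>
    obtain ⟨h1, h2, h3⟩ := hi
    refine lock (h.closed h2.pub h3) hf fun E hv ho => ⟨h1, h2.modify (h2.own.ne_of_free hf), ?_, ?_, ?_⟩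
    · exact h2.lock_child h h3 ho
    · exact h2.own.ne_of_free hf
    · rw [modify_lock_child]; exact h3
  case rmvDel s z y =>
    refine read ?_
    split
    · exact ⟨hi.1, hi.2, ‹_›⟩
    · obtain ⟨rfl, hr⟩ := hi
      exact TInv.finish₂ h hr.ownZ.own hr.ownY.own hr.ne
  case rmvInner s z y =>
    refine read ?_
    split
    · exact ⟨hi.1, hi.2.1, hi.2.2, ‹_›⟩
    · exact hi
  case rmvGetOuter s z y =>
    exact read ⟨hi.1, hi.2.1, hi.2.2.1, s.flip, hi.2.2.2, by rw [Side.flip_flip]⟩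
  case rmvOuter s z y =>
    refine read ?_
    split
    · exact ⟨hi.1, hi.2.1, hi.2.2, ‹_›⟩
    · obtain ⟨rfl, hr, -⟩ := hi
      exact TInv.finish₂ h hr.ownZ.own hr.ownY.own hr.ne
  case rmvGetInner s z y =>
    exact read ⟨hi.1, hi.2.1, hi.2.2.1, s, hi.2.2.2, rfl⟩
  case rmvLink s z y v =>
    obtain ⟨h1, h2, h3, e, h4, rfl⟩ := hi
    obtain ⟨E, hS, hz, hy⟩ := effect_unlink h h2 h3 h4
    exact ⟨_, E, .silent hS ⟨h1, hz, hy, h2.ne⟩⟩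
  case rmvMark z y =>
    obtain ⟨rfl, hz, hy, hne⟩ := hi
    obtain ⟨E, hS, ho⟩ := effect_mark h hy
    exact ⟨g, E, .silent hS (TInv.finish₂ E.inv (hz.modify hne) ho hne)⟩
  case rotLockP c d p hf =>
    exact lock hi.2 hf fun E hv ho => ⟨hi.1, ho⟩
  case rotY c d p =>
    refine read ?_
    split
    · exact TInv.finish₁ h hv hi.2 hi.1
    · exact ⟨hi.1, hi.2, ‹_›⟩
  case rotRemP c d p y =>
    refine read ?_
    split
    · exact TInv.finish₁ h hv hi.2.1 hi.1
    · exact ⟨hi.1, hi.2.1.ownLive (Bool.eq_false_of_not_eq_true ‹_›), hi.2.2⟩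
  case rotLockY c d p y hf =>
    obtain ⟨h1, h2, h3⟩ := hi
    refine lock (h.closed h2.pub h3) hf fun E hv ho => ⟨h1, h2.modify (h2.own.ne_of_free hf), ?_, ?_, ?_⟩
    · exact h2.lock_child h h3 ho
    · exact h2.own.ne_of_free hf
    · rw [modify_lock_child]; exact h3
  case rotX c d p y =>
    refine read ?_
    split
    · obtain ⟨rfl, hr⟩ := hi
      exact TInv.finish₂ h hr.ownZ.own hr.ownY.own hr.ne
    · exact ⟨hi.1, hi.2, ‹_›⟩
  case rotLockX c d p y x hf =>
    obtain ⟨h1, h2, h3⟩ := hi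
    have hpx := h2.ownZ.own.ne_of_free hf
    have hyx := h2.ownY.own.ne_of_free hf
    refine lock (h.closed h2.ownY.pub h3) hf fun E hv ho =>
      ⟨h1, h2.ownZ.modify hpx, h2.ownY.modify hyx, h2.ownY.lock_child h h3 ho, ?_, ?_, ?_⟩
    · simpa using ⟨⟨h2.ne, hpx⟩, hyx⟩
    · rw [modify_lock_child]; exact h2.child
    · rw [modify_lock_child]; exact h3
  case dupKey c d p y x => exact read ⟨hi.1, hi.2, rfl⟩
  case dupLeft c d p y x q => exact read ⟨hi.1, hi.2.1, hi.2.2, rfl⟩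
  case dupRight c d p y x q l => exact read ⟨hi.1, hi.2.1, hi.2.2.1, hi.2.2.2, rfl⟩
  case dupDel c d p y x q l r =>
    exact read ⟨hi.1, hi.2.1, hi.2.2.1, hi.2.2.2.1, hi.2.2.2.2, rfl⟩
  case dupRem c d p y x q l r b =>
    exact read ⟨hi.1, hi.2.1, hi.2.2.1, hi.2.2.2.1, hi.2.2.2.2.1, hi.2.2.2.2.2, rfl⟩
  case dupNew c d p y x q l r b b' z hz =>
    obtain ⟨h1, h2, rfl, rfl, rfl, rfl, rfl⟩ := hi
    obtain ⟨E, hS, hm, hst⟩ := effect_new (t := t) h hz { H.mem y with lock := none }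
    refine ⟨_, E, .silent hS ⟨h1, h2.congr hm hst rfl, by simp, ?_⟩⟩
    rw [hm _ h2.ownY.pub]; simp [Heap.place]
  case rotGet c d p y x z => exact read ⟨hi.1, hi.2.1, hi.2.2.1, hi.2.2.2, rfl⟩
  case rotSetZ c d p y x z v =>
    obtain ⟨h1, h2, h3, h4, rfl⟩ := hi
    obtain ⟨E, hS⟩ := effect_modify_priv h h3 fun n => n.setChild d ((H.mem x).child d.flip)
    have hm : ∀ l, g.Pub l →
        (H.modify z fun n => n.setChild d ((H.mem x).child d.flip)).mem l = H.mem l := fun l hl =>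
      H.modify_mem_of_ne _ fun e => hl.ne_priv (e ▸ h3)
    refine ⟨g, E, .silent hS ⟨h1, h2.congr hm (fun _ _ => rfl) rfl, h3, ?_⟩⟩
    rw [hm _ h2.ownY.pub, hm _ h2.ownX.pub, H.modify_mem_self, h4]
  case rotSetX c d p y x z =>
    obtain ⟨rfl, h2, h3, h4⟩ := hi
    obtain ⟨g', E, hS, hi⟩ := effect_rotate h h2 h3 h4
    exact ⟨g', E, .silent hS hi⟩
  case rotSetP c p y x =>
    obtain ⟨rfl, -⟩ := id hi
    obtain ⟨g', E, hS, hi⟩ := effect_commit h hi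
    exact ⟨g', E, .silent hS hi⟩
  case rotMark p y x =>
    obtain ⟨rfl, hp, hy, hx, hne⟩ := hi
    obtain ⟨E, hS, ho⟩ := effect_mark h hy
    obtain ⟨hpy, hpx, hyx⟩ : p ≠ y ∧ p ≠ x ∧ y ≠ x := by simpa [and_assoc] using hne
    refine ⟨g, E, .silent hS (TInv.finish (ctx := .idle) E.inv trivial hne ?_ rfl)⟩
    simpa using ⟨hp.modify hpy, ho, hx.modify hyx.symm⟩

end

end

/-! ### Linearizations -/

section

variable {T K : Type*} {h : List (Event T K)} {e : Event T K} {L L₁ L₂ : List (ℕ × SetOp K × Bool)}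
  {S S₁ S' : Set K} {t t' : T} {i i' : ℕ} {o : SetOp K} {b : Bool}

theorem getElem?_concat_eq_some {α : Type*} {l : List α} {a c : α} :
    (l ++ [a])[i]? = some c ↔ l[i]? = some c ∨ i = l.length ∧ a = c := by
  rcases lt_trichotomy i l.length with hi | rfl | hi
  · rw [List.getElem?_append_left hi]; simp [hi.ne]
  · simp
  · rw [List.getElem?_eq_none (by simpa using hi), List.getElem?_eq_none hi.le]; simp [hi.ne']

theorem Legal.append {M M' : List (SetOp K × Bool)} (h : Legal S M S₁) (h' : Legal S₁ M' S') :
    Legal S (M ++ M') S' := by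
  induction h with
  | nil => exact h'
  | cons hr _ ih => exact .cons hr (ih h')

theorem Legal.split {M M' : List (SetOp K × Bool)} (h : Legal S (M ++ M') S') :
    ∃ S₁, Legal S M S₁ ∧ Legal S₁ M' S' := by
  induction M generalizing S with
  | nil => exact ⟨S, .nil, h⟩
  | cons a M ih =>
    cases h with
    | cons hr h =>
      obtain ⟨S₁, h1, h2⟩ := ih h
      exact ⟨S₁, .cons hr h1, h2⟩

theorem Legal.unique {M : List (SetOp K × Bool)} (h : Legal S M S₁) (h' : Legal S M S') :
    S₁ = S' := by
  induction h with
  | nil => cases h'; rfl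
  | cons _ _ ih => cases h' with | cons _ h' => exact ih h'

/-- The invocation at position `i` is by thread `t`, which has not responded since. -/
def Pending (h : List (Event T K)) (t : T) (i : ℕ) : Prop :=
  (∃ o, h[i]? = some (.inv t o)) ∧ ∀ j b, i < j → h[j]? ≠ some (.res t b)

theorem Pending.not_precedes (hp : Pending h t i) : ¬ Precedes h i i' := by
  rintro ⟨j, o, b, ⟨t', h1, h2, h3, -⟩, -⟩
  obtain ⟨⟨o', h4⟩, h5⟩ := hp
  rw [h1] at h4
  cases h4
  exact h5 j b h2 h3

theorem Completes.of_concat {j : ℕ} (hc : Completes (h ++ [e]) i j o b) (hj : j < h.length) :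
    Completes h i j o b := by
  obtain ⟨t, h1, h2, h3, h4⟩ := hc
  rw [List.getElem?_append_left (h2.trans hj)] at h1
  rw [List.getElem?_append_left hj] at h3
  refine ⟨t, h1, h2, h3, fun m hm hm' b' => ?_⟩
  have := h4 m hm hm' b'
  rwa [List.getElem?_append_left (hm'.trans hj)] at this

theorem Precedes.of_concat (hp : Precedes (h ++ [e]) i i') (hi : i' ≤ h.length) : Precedes h i i' := by
  obtain ⟨j, o, b, hc, hj⟩ := hp
  exact ⟨j, o, b, hc.of_concat (hj.trans_le hi), hj⟩

theorem lt_length_of_getElem? {α : Type*} {l : List α} {a : α} (h : l[i]? = some a) :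
    i < l.length := by
  by_contra hi
  rw [List.getElem?_eq_none (not_lt.1 hi)] at h; cases h

theorem IsLinearization.lt_length (hl : IsLinearization h L S) {a : ℕ × SetOp K × Bool}
    (ha : a ∈ L) : a.1 < h.length := by
  obtain ⟨t, ht⟩ := hl.invoked a.1 a.2.1 a.2.2 ha
  exact lt_length_of_getElem? ht

/-- A further event leaves a linearization valid if the operation it completes is in it. -/
theorem IsLinearization.concat (hl : IsLinearization h L S)
    (hc : ∀ i o b, Completes (h ++ [e]) i h.length o b → (i, o, b) ∈ L) :
    IsLinearization (h ++ [e]) L S where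
  nodup := hl.nodup
  invoked i o b ha := by
    obtain ⟨t, ht⟩ := hl.invoked i o b ha
    exact ⟨t, getElem?_concat_eq_some.2 (.inl ht)⟩
  completed i j o b hc' := by
    obtain ⟨t, -, -, h3, -⟩ := id hc'
    have hj := lt_length_of_getElem? h3
    rw [List.length_append, List.length_singleton, Nat.lt_succ_iff] at hj
    rcases hj.eq_or_lt with rfl | hj
    · exact hc _ _ _ hc'
    · exact hl.completed i j o b (hc'.of_concat hj)
  realTime := hl.realTime.imp_of_mem fun ha _ hp hp' => hp (hp'.of_concat (hl.lt_length ha).le)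
  legal := hl.legal

/-- Linearizing a pending operation at a position that respects the real-time order. -/
theorem IsLinearization.insert (hl : IsLinearization h (L₁ ++ L₂) S) (hp : Pending h t i)
    (ho : h[i]? = some (.inv t o)) (hi : ∀ a ∈ L₁ ++ L₂, a.1 ≠ i)
    (h₁ : Legal ∅ (L₁.map Prod.snd) S₁) (hr : o.Returns S₁ b)
    (h₂ : Legal (o.apply S₁) (L₂.map Prod.snd) S') (hrt : ∀ a ∈ L₂, ¬ Precedes h a.1 i) :
    IsLinearization h (L₁ ++ (i, o, b) :: L₂) S' := by
  have hperm := List.perm_middle (a := (i, o, b)) (l₁ := L₁) (l₂ := L₂)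
  refine ⟨?_, ?_, ?_, ?_, ?_⟩
  · rw [(hperm.map Prod.fst).nodup_iff, List.map_cons, List.nodup_cons]
    refine ⟨?_, hl.nodup⟩
    intro hm
    obtain ⟨a, ha, e⟩ := List.mem_map.1 hm
    exact hi a ha e
  · intro j o' b' hm
    rcases List.mem_cons.1 (hperm.mem_iff.1 hm) with e | hm
    · cases e; exact ⟨t, ho⟩
    · exact hl.invoked j o' b' hm
  · intro j j' o' b' hc
    exact hperm.mem_iff.2 (.tail _ (hl.completed j j' o' b' hc))
  · obtain ⟨h1, h2, h3⟩ := List.pairwise_append.1 hl.realTime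
    refine List.pairwise_append.2 ⟨h1, List.pairwise_cons.2 ⟨hrt, h2⟩, fun a ha a' ha' => ?_⟩
    rcases List.mem_cons.1 ha' with rfl | ha'
    · exact hp.not_precedes
    · exact h3 a ha a' ha'
  · rw [List.map_append, List.map_cons]
    exact h₁.append (.cons hr h₂)

/-- The current set operation of a thread: its invocation at position `i`, and, once it is
linearized, its return value. -/
inductive Cur (K : Type*)
  | idle
  | todo (i : ℕ) (o : SetOp K)
  | done (i : ℕ) (o : SetOp K) (b : Bool)

/-- The history and the linearization agree with the current operation of `t`. -/
def Cur.Ok (h : List (Event T K)) (L : List (ℕ × SetOp K × Bool)) (t : T) : Cur K → Prop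
  | .idle => ∀ i, ¬ Pending h t i
  | .todo i o => h[i]? = some (.inv t o) ∧ (∀ i', Pending h t i' ↔ i' = i) ∧ ∀ a ∈ L, a.1 ≠ i
  | .done i o b => h[i]? = some (.inv t o) ∧ (∀ i', Pending h t i' ↔ i' = i) ∧ (i, o, b) ∈ L

/-- The operation invoked at position `i` can be inserted into `L`, without violating the
real-time order, where `b` is the right answer to the question whether `k` is present. -/
def Slot (h : List (Event T K)) (L : List (ℕ × SetOp K × Bool)) (i : ℕ) (k : K) (b : Bool) : Prop :=
  ∃ L₁ L₂ S₁, L = L₁ ++ L₂ ∧ Legal ∅ (L₁.map Prod.snd) S₁ ∧ (b = true ↔ k ∈ S₁) ∧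
    ∀ a ∈ L₂, ¬ Precedes h a.1 i

/-- What a thread needs to know about its current operation. -/
def Cur.ctx (h : List (Event T K)) (L : List (ℕ × SetOp K × Bool)) : Cur K → Ctx K
  | .idle => .idle
  | .todo i o => .todo o (Slot h L i o.key)
  | .done _ _ b => .done b

/-- `L` linearizes the history `h`, and ends with contents `S`; `cur` gives the current operation of
each thread. -/
structure LinInv (h : List (Event T K)) (L : List (ℕ × SetOp K × Bool)) (S : Set K) (cur : T → Cur K) :
    Prop where
  lin : IsLinearization h L S
  ok : ∀ t, (cur t).Ok h L t

variable {cur : T → Cur K}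

theorem Cur.ctx_valid (hl : IsLinearization h L S) (c : Cur K) : (c.ctx h L).Valid S := by
  cases c with
  | todo i o => exact fun b hb => ⟨L, [], S, by simp, hl.legal, hb, by simp⟩
  | idle => trivial
  | done => trivial

theorem Slot.concat {k : K} (hs : Slot h L i k b) (hi : i ≤ h.length) : Slot (h ++ [e]) L i k b := by
  obtain ⟨L₁, L₂, S₁, h1, h2, h3, h4⟩ := hs
  exact ⟨L₁, L₂, S₁, h1, h2, h3, fun a ha hp => h4 a ha (hp.of_concat hi)⟩

/-- An event of another thread. -/
def Event.Other (t : T) : Event T K → Prop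
  | .inv t' _ => t ≠ t'
  | .res t' _ => t ≠ t'

theorem pending_concat (he : e.Other t) : Pending (h ++ [e]) t i ↔ Pending h t i := by
  unfold Pending
  refine and_congr (exists_congr fun o => ?_) (forall₃_congr fun j b _ => not_congr ?_) <;>
    rw [getElem?_concat_eq_some] <;> refine or_iff_left ?_ <;> rintro ⟨-, rfl⟩ <;> exact he rfl

theorem Cur.Ok.concat {c : Cur K} (hc : c.Ok h L t) (he : e.Other t) : c.Ok (h ++ [e]) L t := by
  cases c with
  | idle => exact fun i hp => hc i ((pending_concat he).1 hp)
  | todo i o =>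
    exact ⟨getElem?_concat_eq_some.2 (.inl hc.1), fun i' => (pending_concat he).trans (hc.2.1 i'), hc.2.2⟩
  | done i o b =>
    exact ⟨getElem?_concat_eq_some.2 (.inl hc.1), fun i' => (pending_concat he).trans (hc.2.1 i'), hc.2.2⟩

theorem Cur.Ok.ctx_concat {c : Cur K} (hc : c.Ok h L t) :
    (c.ctx h L).Le (c.ctx (h ++ [e]) L) := by
  cases c with
  | todo i o => exact .todo fun b hs => hs.concat (lt_length_of_getElem? hc.1).le
  | idle => exact .refl
  | done => exact .refl

theorem Cur.Ok.insert {c : Cur K} (hc : c.Ok h (L₁ ++ L₂) t') (ht : t' ≠ t)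
    (ho : h[i]? = some (.inv t o)) : c.Ok h (L₁ ++ (i, o, b) :: L₂) t' := by
  cases c with
  | idle => exact hc
  | todo i' o' =>
    refine ⟨hc.1, hc.2.1, fun a ha => ?_⟩
    rcases List.mem_cons.1 (List.perm_middle.mem_iff.1 ha) with rfl | ha
    · rintro rfl
      have := hc.1
      rw [ho] at this
      cases this; exact ht rfl
    · exact hc.2.2 a ha
  | done i' o' b' =>
    exact ⟨hc.1, hc.2.1, List.perm_middle.mem_iff.2 (.tail _ hc.2.2)⟩

/-- Inserting an operation that does not change the set preserves slots. -/
theorem Slot.insert {k : K} {b' : Bool} (hs : Slot h (L₁ ++ L₂) i' k b') (hp : Pending h t i)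
    (h₁ : Legal ∅ (L₁.map Prod.snd) S₁) (hr : o.Returns S₁ b) (ha : o.apply S₁ = S₁ ∨ L₂ = []) :
    Slot h (L₁ ++ (i, o, b) :: L₂) i' k b' := by
  obtain ⟨M₁, M₂, S₂, h1, h2, h3, h4⟩ := hs
  -- the slot is after or before the place of insertion
  rcases List.append_eq_append_iff.1 h1 with ⟨N, rfl, hN⟩ | ⟨N, rfl, hN⟩
  · rcases ha with ha | ha
    · refine ⟨L₁ ++ (i, o, b) :: N, M₂, S₂, by simp [hN], ?_, h3, h4⟩
      rw [List.map_append] at h2 ⊢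
      obtain ⟨S₃, h5, h6⟩ := h2.split
      obtain rfl := h₁.unique h5
      exact h₁.append (.cons hr (by rwa [ha]))
    · rw [ha] at hN
      obtain ⟨rfl, rfl⟩ := List.append_eq_nil_iff.1 hN.symm
      subst ha
      refine ⟨L₁, [(i, o, b)], S₂, rfl, by simpa using h2, h3, fun a ha => ?_⟩
      rw [List.mem_singleton.1 ha]; exact hp.not_precedes
  · refine ⟨M₁, N ++ (i, o, b) :: L₂, S₂, by simp, h2, h3, fun a ha => ?_⟩
    rcases List.mem_cons.1 (List.perm_middle.mem_iff.1 ha) with rfl | ha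
    · exact hp.not_precedes
    · exact h4 a (hN ▸ ha)

variable [DecidableEq T]

theorem LinInv.invoke (hl : LinInv h L S cur) (ht : cur t = .idle) (o : SetOp K) :
    LinInv (h ++ [.inv t o]) L S (Function.update cur t (.todo h.length o)) ∧
      ∀ t', t' ≠ t → ((cur t').ctx h L).Le
        ((Function.update cur t (.todo h.length o) t').ctx (h ++ [.inv t o]) L) := by
  refine ⟨⟨hl.lin.concat ?_, fun t' => ?_⟩, fun t' ht' => ?_⟩
  · rintro i o' b ⟨t', -, -, h3, -⟩
    simp at h3
  · by_cases e : t' = t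
    · subst e
      rw [Function.update_self]
      have hi := hl.ok t'
      rw [ht] at hi
      refine ⟨by simp, fun i' => ⟨?_, ?_⟩, fun a ha => (hl.lin.lt_length ha).ne⟩
      · rintro ⟨⟨o', h1⟩, h2⟩
        rcases getElem?_concat_eq_some.1 h1 with h1 | ⟨h1, -⟩
        · refine (hi i' ⟨⟨o', h1⟩, fun j b hj hb => h2 j b hj ?_⟩).elim
          exact getElem?_concat_eq_some.2 (.inl hb)
        · exact h1
      · rintro rfl
        refine ⟨⟨o, by simp⟩, fun j b hj => ?_⟩
        rw [List.getElem?_eq_none (by simpa using hj)]; simp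
    · rw [Function.update_of_ne e]
      exact (hl.ok t').concat e
  · rw [Function.update_of_ne ht']
    exact (hl.ok t').ctx_concat

theorem LinInv.respond (hl : LinInv h L S cur) (ht : cur t = .done i o b) :
    LinInv (h ++ [.res t b]) L S (Function.update cur t .idle) ∧
      ∀ t', t' ≠ t → ((cur t').ctx h L).Le
        ((Function.update cur t .idle t').ctx (h ++ [.res t b]) L) := by
  have hi := hl.ok t
  rw [ht] at hi
  obtain ⟨hi1, hi2, hi3⟩ := hi
  refine ⟨⟨hl.lin.concat ?_, fun t' => ?_⟩, fun t' ht' => ?_⟩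
  · rintro i' o' b' ⟨t', h1, h2, h3, h4⟩
    obtain ⟨rfl, rfl⟩ : t = t' ∧ b = b' := by simpa using h3
    rw [List.getElem?_append_left h2] at h1
    -- the response completes a pending operation of `t`, and there is only one
    have hp : Pending h t i' := by
      refine ⟨⟨o', h1⟩, fun j b'' hj hb => ?_⟩
      exact h4 j hj (lt_length_of_getElem? hb) b'' (getElem?_concat_eq_some.2 (.inl hb))
    obtain rfl := (hi2 i').1 hp
    rw [hi1] at h1
    cases h1; exact hi3
  · by_cases e : t' = t
    · subst e
      rw [Function.update_self]
      rintro i' ⟨⟨o', h1⟩, h2⟩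
      have h1 : h[i']? = some (.inv t' o') := by
        rcases getElem?_concat_eq_some.1 h1 with h1 | ⟨-, h1⟩
        · exact h1
        · cases h1
      exact h2 h.length b (lt_length_of_getElem? h1) (by simp)
    · rw [Function.update_of_ne e]
      exact (hl.ok t').concat e
  · rw [Function.update_of_ne ht']
    exact (hl.ok t').ctx_concat

/-- Linearizing an operation, either at the end or where it does not change the set. -/
theorem LinInv.insert (hl : LinInv h (L₁ ++ L₂) S cur) (ht : cur t = .todo i o)
    (h₁ : Legal ∅ (L₁.map Prod.snd) S₁) (hr : o.Returns S₁ b)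
    (h₂ : Legal (o.apply S₁) (L₂.map Prod.snd) S') (hrt : ∀ a ∈ L₂, ¬ Precedes h a.1 i)
    (ha : o.apply S₁ = S₁ ∨ L₂ = []) :
    LinInv h (L₁ ++ (i, o, b) :: L₂) S' (Function.update cur t (.done i o b)) ∧
      ∀ t', t' ≠ t → ((cur t').ctx h (L₁ ++ L₂)).Le
        ((Function.update cur t (.done i o b) t').ctx h (L₁ ++ (i, o, b) :: L₂)) := by
  have hi := hl.ok t
  rw [ht] at hi
  obtain ⟨hi1, hi2, hi3⟩ := hi
  have hp : Pending h t i := (hi2 i).2 rfl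
  refine ⟨⟨hl.lin.insert hp hi1 hi3 h₁ hr h₂ hrt, fun t' => ?_⟩, fun t' ht' => ?_⟩
  · by_cases e : t' = t
    · subst e
      rw [Function.update_self]
      exact ⟨hi1, hi2, by simp⟩
    · rw [Function.update_of_ne e]
      exact (hl.ok t').insert e hi1
  · rw [Function.update_of_ne ht']
    cases cur t' with
    | todo i' o' => exact .todo fun b' hs => hs.insert hp h₁ hr ha
    | idle => exact .refl
    | done => exact .refl

/-- Linearizing an operation at the present moment. -/
theorem LinInv.linearize_now (hl : LinInv h L S cur) (ht : cur t = .todo i o) (hr : o.Returns S b) :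
    ∃ L', LinInv h L' (o.apply S) (Function.update cur t (.done i o b)) ∧
      ∀ t', t' ≠ t → ((cur t').ctx h L).Le
        ((Function.update cur t (.done i o b) t').ctx h L') := by
  have hl' : LinInv h (L ++ []) S cur := by rwa [List.append_nil]
  have := hl'.insert ht hl.lin.legal hr .nil (by simp) (.inr rfl)
  rw [List.append_nil] at this
  exact ⟨_, this⟩

/-- Linearizing an operation at an earlier moment. -/
theorem LinInv.linearize_past [LinearOrder K] (hl : LinInv h L S cur) (ht : cur t = .todo i o)
    (hs : Slot h L i o.key b) (ho : o.Inert b) :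
    ∃ L', LinInv h L' S (Function.update cur t (.done i o b)) ∧
      ∀ t', t' ≠ t → ((cur t').ctx h L).Le
        ((Function.update cur t (.done i o b) t').ctx h L') := by
  obtain ⟨L₁, L₂, S₁, rfl, h1, h2, h3⟩ := hs
  obtain ⟨hr, ha⟩ := ho S₁ h2
  have hleg := hl.lin.legal
  rw [List.map_append] at hleg
  obtain ⟨S₂, h4, h5⟩ := hleg.split
  obtain rfl := h1.unique h4
  exact ⟨_, hl.insert ht h1 hr (by rwa [ha]) h3 (.inl ha)⟩

end

/-! ### Executions -/

section

variable {T K : Type*} [LinearOrder K]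

/-- The invariant of executions. -/
def ExecInv (h : List (Event T K)) (σ : State T K) : Prop :=
  ∃ g L cur, HInv σ.heap g ∧ LinInv h L (absSet σ.heap) cur ∧
    ∀ t, TInv σ.heap g t ((cur t).ctx h L) (σ.pc t)

/-- Initially the root is the only public node. -/
def Ghost.init : Ghost T where
  st l := if l = root then .live else .free
  virt _ _ := none

theorem hInv_init : HInv (Heap.init : Heap T K) Ghost.init := by
  have hlive : ∀ {n}, (Ghost.init : Ghost T).st n = .live → n = root := by
    intro n hn
    by_contra e
    simp [Ghost.init, e] at hn
  have hchild : ∀ n s, ((Heap.init : Heap T K).mem n).child s = none := by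
    intro n s; cases s <;> rfl
  have hchild' : ∀ n s, (shape (Heap.init : Heap T K) Ghost.init).child n s = none := by
    intro n s
    simp only [shape, hchild, ite_self]
  have hedge : ∀ {s m n}, ¬ (shape (Heap.init : Heap T K) Ghost.init).Edge s m n := by
    rintro s m n ⟨-, h⟩
    rw [Graph.star_of_none rfl, hchild'] at h; cases h
  have hroot : (Ghost.init : Ghost T).st root = .live := by simp [Ghost.init]
  refine ⟨⟨hroot, hedge, fun h => (hedge h).elim, fun h => (hedge h).elim,
    fun h => (hedge h).elim, ?_, ?_, ?_, ?_⟩, ?_, ?_, ?_, ?_, ?_⟩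
  · intro m s x hx; cases hx
  · intro k v n hv hn _
    rw [hlive hv, hlive hn]
  · intro k v n hv hn _
    rw [hlive hv, hlive hn]; exact .now rfl
  · intro k v hv
    obtain rfl := hlive hv
    refine ⟨false, .step (s := .left) ?_ ?_ ?_⟩
    · rw [shape_key (.inl hroot)]; exact WithTop.coe_lt_top k
    · rw [hchild']; exact Graph.res_none
    · intro x hx; cases hx
  · intro n s m _ hc
    rw [hchild] at hc; cases hc
  · intro n hn
    by_contra e
    have : n ≠ root := e
    simp [Ghost.init, this] at hn
  · intro n _; rfl
  · intro n hn
    simp only [Ghost.init] at hn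
    split at hn <;> cases hn
  · intro n s hn; exact (hn rfl).elim

theorem absSet_init : absSet (Heap.init : Heap T K) = ∅ := by
  refine Set.eq_empty_of_forall_notMem ?_
  rintro k ⟨x, -, hk, -⟩
  cases hk

theorem execInv_init : ExecInv [] (State.init : State T K) := by
  refine ⟨Ghost.init, [], fun _ => .idle, hInv_init, ⟨⟨?_, ?_, ?_, ?_, ?_⟩, ?_⟩, fun t => rfl⟩
  · simp
  · simp
  · rintro i j o b ⟨t, h, -⟩
    simp at h
  · simp
  · change Legal ∅ [] (absSet (Heap.init : Heap T K))
    rw [absSet_init]; exact .nil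
  · rintro t i ⟨⟨o, h⟩, -⟩
    simp at h

variable [DecidableEq T] {h h' : List (Event T K)} {σ σ' : State T K} {t : T}

/-- A step of thread `t` preserves the invariant of the other threads. -/
theorem execInv_update {H' : Heap T K} {g g' : Ghost T} {L L' : List (ℕ × SetOp K × Bool)}
    {cur cur' : T → Cur K} {q : PC K} (hi : ∀ t, TInv σ.heap g t ((cur t).ctx h L) (σ.pc t))
    (E : Effect t σ.heap g H' g') (hl : LinInv h' L' (absSet H') cur')
    (hle : ∀ t', t' ≠ t → ((cur t').ctx h L).Le ((cur' t').ctx h' L'))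
    (hq : TInv H' g' t ((cur' t).ctx h' L') q) :
    ExecInv h' { heap := H', pc := Function.update σ.pc t q } := by
  refine ⟨g', L', cur', E.inv, hl, fun t' => ?_⟩
  by_cases e : t' = t
  · subst e
    simpa using hq
  · simp only [Function.update_of_ne e]
    exact (hi t').stable E e (hle t' e) (Cur.ctx_valid hl.lin _)

theorem ExecInv.step {e : List (Event T K)} (hi : ExecInv h σ) (hs : Step σ e σ') :
    ExecInv (h ++ e) σ' := by
  obtain ⟨g, L, cur, hH, hl, hT⟩ := hi
  cases hs with
  | invoke t o hpc =>
    have ht := hT t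
    rw [hpc] at ht
    have hc : cur t = .idle := by
      cases hc : cur t <;> rw [hc] at ht <;> first | rfl | cases ht
    obtain ⟨hl', hle⟩ := hl.invoke hc o
    refine execInv_update hT (.refl hH) hl' hle (TInv.start hH (Cur.ctx_valid hl'.lin _) ?_)
    rw [Function.update_self]
    exact ⟨_, rfl⟩
  | maintain t a k hpc =>
    have ht := hT t
    rw [hpc] at ht
    rw [List.append_nil]
    exact execInv_update hT (.refl hH) hl (fun _ _ => .refl)
      (TInv.start hH (Cur.ctx_valid hl.lin _) ht)
  | respond t b hpc =>
    have ht := hT t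
    rw [hpc] at ht
    obtain ⟨i, o, hc⟩ : ∃ i o, cur t = .done i o b := by
      cases hc : cur t <;> rw [hc] at ht <;> cases ht
      exact ⟨_, _, rfl⟩
    obtain ⟨hl', hle⟩ := hl.respond hc
    refine execInv_update hT (.refl hH) hl' hle ?_
    rw [Function.update_self]
    exact rfl
  | @act t H' q hx =>
    rw [List.append_nil]
    obtain ⟨g', E, ho⟩ := exec_effect hH (hT t) (Cur.ctx_valid hl.lin _) hx
    have todo : ∀ {o P}, (cur t).ctx h L = .todo o P →
        ∃ i, cur t = .todo i o ∧ P = Slot h L i o.key := by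
      intro o P e
      cases hc : cur t <;> rw [hc] at e <;> cases e
      exact ⟨_, rfl, rfl⟩
    cases ho with
    | silent hS hq => exact execInv_update hT E (by rwa [hS]) (fun _ _ => .refl) hq
    | past o P b hS hctx hb ho hq =>
      obtain ⟨i, hc, rfl⟩ := todo hctx
      obtain ⟨L', hl', hle⟩ := hl.linearize_past hc hb ho
      refine execInv_update hT E (by rwa [hS]) hle ?_
      rw [Function.update_self]
      exact hq
    | now o P b hctx hb hS hq =>
      obtain ⟨i, hc, rfl⟩ := todo hctx
      obtain ⟨L', hl', hle⟩ := hl.linearize_now hc hb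
      refine execInv_update hT E (by rwa [hS]) hle ?_
      rw [Function.update_self]
      exact hq

theorem Reaches.execInv (hr : Reaches h σ) : ExecInv h σ := by
  induction hr with
  | init => exact execInv_init
  | step _ hs ih => exact ih.step hs

end
end CFTree

theorem mainTheorem2 {T K : Type*} [DecidableEq T] [LinearOrder K]
    (h : List (CFTree.Event T K)) (σ : CFTree.State T K) (hσ : CFTree.Reaches h σ) :
    CFTree.Linearizable h ∧
      ∃ L, CFTree.IsLinearization h L (CFTree.absSet σ.heap) := by
  obtain ⟨g, L, cur, -, hl, -⟩ := hσ.execInv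
  exact ⟨⟨L, _, hl.lin⟩, L, hl.lin⟩
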